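/- **Setting.** Let $K\subset\mathbb R^d$ be a connected self-similar set: $K$ is nonempty and compact, and $K=\bigcup_{i=1}^N F_i(K)$ for contractive similitudes $F_1,\dots,F_N$, $N\ge 2$ (overlaps are allowed). *Nested structures.* A nested structure $\{K_\alpha,\Lambda_\alpha\}_{\alpha\in\Lambda}$ of $K$ is a countable family of distinct compact connected subsets $K_\alpha\subset K$ (islands), none a singleton, with a root $\vartheta\in\Lambda$, $K_\vartheta=K$, and finite sets $\Lambda_\alpha\subset\Lambda$ of children, $\#\Lambda_\alpha\ge2$, such that $K_\alpha=\bigcup_{\beta\in\Lambda_\alpha}K_\beta$ and every $\alpha\ne\vartheta$ is an offspring of $\vartheta$. Write $\alpha\sim\beta$ if some similitude maps $K_\alpha$ onto $K_\beta$; fix such similitudes $\phi_{\alpha,\beta}$ with $\phi_{\alpha,\alpha}=\mathrm{id}$ and $\phi_{\gamma,\beta}\circ\phi_{\alpha,\gamma}=\phi_{\alpha,\beta}$ (here and below, identities between these maps are required on the island on which they are used). Let $C_\alpha=\bigcup_{\beta\ne\beta'\in\Lambda_\alpha}K_\beta\cap K_{\beta'}$, and let the boundary of $K_\alpha$ be $$V_\alpha=\bigcup_{\beta\sim\alpha,\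 \beta\ne\vartheta}\phi_{\beta,\alpha}\Big(K_\beta\cap\bigcup_{\gamma\text{ an ancestor of }\beta}C_\gamma\Big).$$ The structure is *f.r.f.t.* (finitely ramified of finite type) if (A1) $\Lambda/\!\sim$ is finite; (A2) whenever $\alpha\sim\alpha'$ there is a bijection $\Lambda_\alpha\to\Lambda_{\alpha'}$, $\beta\mapsto\beta'$, with $\beta\sim\beta'$ and $\phi_{\beta,\beta'}=\phi_{\alpha,\alpha'}$; (A3) every $V_\alpha$ is finite. The classes $\mathcal T_1,\dots,\mathcal T_M$ of $\sim$ are called types; $t(\alpha)$ is the number of the type of $\alpha$, and $t(\vartheta)=1$. In each $\mathcal T_i$ choose $\alpha_i$ with $K_{\alpha_i}$ of largest diameter, $\alpha_1=\vartheta$. The associated directed graph $G$ has the types as states and, for each $i$ and each $\beta\in\Lambda_{\alpha_i}$, one edge from $\mathcal T_i$ to $\mathcal T_{t(\beta)}$. For a child $\beta$ of $\gamma$, let $e(\gamma,\beta)$ be the edge given by the child of $\alpha_{t(\gamma)}$ that corresponds to $\beta$ under (A2); let $\boldsymbol e(\vartheta,\alpha)$ be the walk formed by these edges along the genealogical line from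 $\vartheta$ to $\alpha$. $G$ is strongly connected if for any two states $s,s'$ there is a walk from $s$ to $s'$. *Harmonic structures.* A Laplacian on a finite set $V$ is a symmetric non-positive definite matrix $H$ with nonnegative off-diagonal entries and with $Hu=0$ if and only if $u$ is constant; its Dirichlet form is $\mathcal E_H(u,v)=\sum_{\{x,y\}\subset V,\,x\ne y}H_{xy}(u(x)-u(y))(v(x)-v(y))$. Let $D_{\alpha_i}$ be a Laplacian on $V_{\alpha_i}$ for each $i$ (no datum if $V_{\alpha_i}=\emptyset$), and let $\boldsymbol r=(r_e)$ be positive numbers indexed by the edges of $G$. Put $\mathcal E_{\alpha_i,0}=\mathcal E_{D_{\alpha_i}}$ and, for $n\ge1$, $$\mathcal E_{\alpha_i,n}(u,v)=\sum_{\beta\in\Lambda_{\alpha_i}}r_{e(\alpha_i,\beta)}^{-1}\,\mathcal E_{\alpha_{t(\beta)},n-1}\big(u\circ\phi_{\alpha_{t(\beta)},\beta},\,v\circ\phi_{\alpha_{t(\beta)},\beta}\big),$$ a form in the values of $u,v$ on the union $V_{\alpha_i,n}$ of the boundaries of the islands that are offspring of $\alpha_i$ of generation $n$. The pair $(\{D_{\alpha_i}\},\boldsymbol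 r)$ is a *harmonic structure* if, for all $i$ and all $v:V_{\alpha_i}\to\mathbb R$, $\mathcal E_{\alpha_i,0}(v,v)=\min\{\mathcal E_{\alpha_i,1}(u,u):u|_{V_{\alpha_i}}=v\}$. With $r_{\boldsymbol e}$ the product of the $r_e$ along a walk $\boldsymbol e$, it is *regular* if $r_{\boldsymbol e}<1$ for every cycle $\boldsymbol e$ of $G$, and *homogeneous* if $r_{\boldsymbol e(\vartheta,\alpha)}=r_{\boldsymbol e(\vartheta,\beta)}$ whenever $\alpha\sim\beta$ and $\operatorname{diam}K_\alpha=\operatorname{diam}K_\beta$. The resistance form $(\mathcal E,\mathcal F)$ on $K$ induced by a regular harmonic structure is $$\mathcal F=\{u\in C(K):\lim_n\mathcal E_{\vartheta,n}(u,u)<\infty\},\qquad \mathcal E(u,v)=\lim_n\mathcal E_{\vartheta,n}(u,v).$$ *Tiling.* Let $\mathcal S=\{K_\alpha,\Lambda_\alpha\}_{\alpha\in\Lambda}$ and $\mathcal S'=\{K_{\alpha'},\Lambda'_{\alpha'}\}_{\alpha'\in\Lambda'}$ be two f.r.f.t. nested structures on $K$. Write $\mathcal S'\blacktriangleleft\mathcal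 S$ ($\mathcal S'$ can be tiled by $\mathcal S$) if for any $\alpha'\sim\beta'$ in $\Lambda'$ there are countable sets $L_{\alpha'},L_{\beta'}\subset\Lambda$ such that $K_{\alpha'}\setminus V_{\alpha'}=\bigcup_{\alpha\in L_{\alpha'}}K_\alpha$ with $K_\alpha\cap K_\beta$ finite for distinct $\alpha,\beta\in L_{\alpha'}$, likewise for $\beta'$ and $L_{\beta'}$, and there is a bijection $p:L_{\alpha'}\to L_{\beta'}$ with $\alpha\sim p(\alpha)$ and $\phi_{\alpha,p(\alpha)}=\phi_{\alpha',\beta'}$ for all $\alpha\in L_{\alpha'}$. **Theorem 6.4.** Let $\mathcal S$ and $\mathcal S'$ be two f.r.f.t. nested structures on $K$ with $\mathcal S'\blacktriangleleft\mathcal S$, and suppose that the directed graph $G$ of $\mathcal S$ is strongly connected. Let $(\{D_{\alpha_i}\}_{i=1}^M,\boldsymbol r)$ be a homogeneous regular harmonic structure of $\mathcal S$, with induced resistance form $(\mathcal E,\mathcal F)$. Then there is a homogeneous regular harmonic structure $(\{D_{\alpha'_j}\}_{j=1}^{M'},\boldsymbol r')$ of $\mathcal S'$ that induces the same resistance form $(\mathcal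 E,\mathcal F)$ on $K$. -/

import Mathlib

/-- Euclidean space of dimension `d`. A similitude of it is an element of `Euc d ≃ᵈ Euc d`. -/
abbrev Euc (d : ℕ) : Type := EuclideanSpace ℝ (Fin d)

/-- `K` is a self-similar set: a nonempty compact set which is the union of its images under an
iterated function system of `N ≥ 2` contractive similitudes. Overlaps are allowed. -/
def IsSelfSimilarSet {d : ℕ} (K : Set (Euc d)) : Prop :=
  K.Nonempty ∧ IsCompact K ∧
    ∃ N : ℕ, 2 ≤ N ∧ ∃ F : Fin N → (Euc d ≃ᵈ Euc d),
      (∀ i, Dilation.ratio (F i) < 1) ∧ K = ⋃ i, F i '' K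

/-- A nested structure of `K` with index set `Λ`. Countability of `Λ` follows from `offspring`,
since every set of children is finite. -/
structure NestedStructure {d : ℕ} (K : Set (Euc d)) (Λ : Type*) where
  island : Λ → Set (Euc d)
  /-- the islands are distinct -/
  island_injective : Function.Injective island
  island_subset : ∀ α, island α ⊆ K
  island_compact : ∀ α, IsCompact (island α)
  island_connected : ∀ α, IsConnected (island α)
  /-- no island is a singleton -/
  island_nontrivial : ∀ α, (island α).Nontrivial
  root : Λ
  island_root : island root = K
  children : Λ → Finset Λ
  two_le_card_children : ∀ α, 2 ≤ (children α).card
  island_eq : ∀ α, island α = ⋃ β ∈ children α, island β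
  offspring : ∀ α, α ≠ root → Relation.TransGen (fun γ β => β ∈ children γ) root α

namespace NestedStructure

variable {d : ℕ} {K : Set (Euc d)} {Λ : Type*} (S : NestedStructure K Λ)

/-- `γ` is an ancestor of `β`, that is, `γ ∈ P^n(β)` for some `n ≥ 1`. -/
def IsAncestor (γ β : Λ) : Prop :=
  Relation.TransGen (fun γ β => β ∈ S.children γ) γ β

/-- Equivalence of indices: some similitude maps one island onto the other. -/
def Similar (α β : Λ) : Prop :=
  ∃ f : Euc d ≃ᵈ Euc d, f '' S.island α = S.island β

theorem similar_refl (α : Λ) : S.Similar α α :=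
  ⟨DilationEquiv.refl _, by simp⟩

theorem similar_symm {α β : Λ} (h : S.Similar α β) : S.Similar β α := by
  obtain ⟨f, hf⟩ := h
  refine ⟨f.symm, ?_⟩
  rw [← hf, ← Set.image_comp]
  simp

theorem similar_trans {α β γ : Λ} (h : S.Similar α β) (h2 : S.Similar β γ) :
    S.Similar α γ := by
  obtain ⟨f, hf⟩ := h
  obtain ⟨g, hg⟩ := h2
  refine ⟨f.trans g, ?_⟩
  rw [← hg, ← hf, ← Set.image_comp]
  rfl

def setoid : Setoid Λ where
  r := S.Similar
  iseqv := ⟨S.similar_refl, S.similar_symm, S.similar_trans⟩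

/-- The types of islands. -/
def Types : Type _ := Quotient S.setoid

/-- The type of (the island with index) `α`. -/
def type (α : Λ) : S.Types := Quotient.mk S.setoid α

theorem type_eq_iff {α β : Λ} : S.type α = S.type β ↔ S.Similar α β :=
  ⟨fun h => Quotient.exact (s := S.setoid) h, fun h => Quotient.sound (s := S.setoid) h⟩

/-- The intersections of distinct children of `α`. -/
def C (α : Λ) : Set (Euc d) :=
  ⋃ β ∈ S.children α, ⋃ β' ∈ S.children α, ⋃ _ : β ≠ β', S.island β ∩ S.island β'

end NestedStructure

/-- A nested structure with a coherent choice `φ α β` of similitudes between equivalent islands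
(the value of `φ α β` for inequivalent `α`, `β` is not used). Only the restriction of `φ α β` to
`island α` matters, so identities between these maps are required on the island on which the
left-hand side is defined. -/
structure MarkedNestedStructure {d : ℕ} (K : Set (Euc d)) (Λ : Type*)
    extends NestedStructure K Λ where
  φ : Λ → Λ → (Euc d ≃ᵈ Euc d)
  φ_image : ∀ α β, toNestedStructure.Similar α β → φ α β '' island α = island β
  φ_self : ∀ α, Set.EqOn (φ α α) id (island α)
  φ_comp : ∀ α γ β, toNestedStructure.Similar α γ → toNestedStructure.Similar γ β →
    Set.EqOn (φ γ β ∘ φ α γ) (φ α β) (island α)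

/-- The boundary `V_α` of the island with index `α`. -/
def MarkedNestedStructure.V {d : ℕ} {K : Set (Euc d)} {Λ : Type*}
    (S : MarkedNestedStructure K Λ) (α : Λ) : Set (Euc d) :=
  ⋃ β, ⋃ _ : S.Similar β α ∧ β ≠ S.root,
    S.φ β α '' (S.island β ∩ ⋃ γ, ⋃ _ : S.IsAncestor γ β, S.C γ)

/-- A nested structure that is finitely ramified of finite type (f.r.f.t.). -/
structure FRFT {d : ℕ} (K : Set (Euc d)) (Λ : Type*) extends MarkedNestedStructure K Λ where
  /-- there are finitely many types -/
  finite_types : Finite toNestedStructure.Types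
  /-- equivalent islands are split in the same way -/
  children_equiv : ∀ α α', toNestedStructure.Similar α α' →
    ∃ e : children α ≃ children α', ∀ β : children α,
      toNestedStructure.Similar β (e β) ∧ Set.EqOn (φ β (e β)) (φ α α') (island β)
  /-- all boundaries are finite -/
  finite_V : ∀ α, (toMarkedNestedStructure.V α).Finite

namespace FRFT

variable {d : ℕ} {K : Set (Euc d)} {Λ : Type*} (S : FRFT K Λ)

noncomputable instance instFintypeV (α : Λ) : Fintype (S.V α) := (S.finite_V α).fintype

/-- The correspondence between the children of equivalent indices. It is uniquely determined,
because `φ α α'` maps the island of a child onto the island of the corresponding child. -/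
noncomputable def childEquiv {α α' : Λ} (h : S.Similar α α') : S.children α ≃ S.children α' :=
  (S.children_equiv α α' h).choose

/-- The choice of a representative `α_i` of largest diameter in every type, the root being the
representative of its type. -/
structure Representatives where
  rep : S.Types → Λ
  type_rep : ∀ i, S.type (rep i) = i
  diam_le : ∀ α, Metric.diam (S.island α) ≤ Metric.diam (S.island (rep (S.type α)))
  rep_root : rep (S.type S.root) = S.root

end FRFT

/-- `S'` can be tiled by `S`. -/
def IsTiledBy {d : ℕ} {K : Set (Euc d)} {Λ Λ' : Type*} (S' : FRFT K Λ') (S : FRFT K Λ) : Prop :=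
  let IsTiling : Λ' → Set Λ → Prop := fun α' L =>
    L.Countable ∧ S'.island α' \ S'.V α' = (⋃ α ∈ L, S.island α) ∧
      ∀ α ∈ L, ∀ β ∈ L, α ≠ β → (S.island α ∩ S.island β).Finite
  ∀ α' β' : Λ', S'.Similar α' β' →
    ∃ L M : Set Λ, IsTiling α' L ∧ IsTiling β' M ∧
      ∃ p : L ≃ M, ∀ α : L,
        S.Similar α (p α) ∧ Set.EqOn (S.φ α (p α)) (S'.φ α' β') (S.island α)

/-- Discrete Laplacians on a finite set. -/
structure IsLaplacian {V : Type*} [Fintype V] (H : Matrix V V ℝ) : Prop where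
  symm : H.IsSymm
  nonpos : ∀ u : V → ℝ, u ⬝ᵥ H.mulVec u ≤ 0
  ker : ∀ u : V → ℝ, H.mulVec u = 0 ↔ ∃ c : ℝ, ∀ x, u x = c
  offDiag_nonneg : ∀ x y, x ≠ y → 0 ≤ H x y

/-- The discrete Dirichlet form of a Laplacian (every unordered pair is counted once). -/
noncomputable def dirichletForm {V : Type*} [Fintype V] (H : Matrix V V ℝ) (u v : V → ℝ) : ℝ :=
  (1 / 2) * ∑ x, ∑ y, H x y * (u x - u y) * (v x - v y)

namespace FRFT

variable {d : ℕ} {K : Set (Euc d)} {Λ : Type*} {S : FRFT K Λ}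

namespace Representatives

variable (R : S.Representatives)

theorem similar_rep (γ : Λ) : S.Similar γ (R.rep (S.type γ)) :=
  S.type_eq_iff.1 (R.type_rep _).symm

/-- The edges of the directed graph `G`, whose states are the types: one edge for each type `i` and
each child of its representative (multiple edges and loops are allowed). -/
def Edge : Type _ := Σ i : S.Types, S.children (R.rep i)

variable {R}

def Edge.init (e : R.Edge) : S.Types := e.1

def Edge.final (e : R.Edge) : S.Types := S.type e.2

variable (R)

/-- `R.IsWalk i j w`: the nonempty sequence of edges `w` is a walk from `i` to `j`. -/
inductive IsWalk : S.Types → S.Types → List R.Edge → Prop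
  | single (e : R.Edge) : IsWalk e.init e.final [e]
  | cons (e : R.Edge) {j : S.Types} {w : List R.Edge} :
      IsWalk e.final j w → IsWalk e.init j (e :: w)

/-- The directed graph is strongly connected. -/
def StronglyConnected : Prop := ∀ i j : S.Types, ∃ w, R.IsWalk i j w

/-- The edge `e(γ, β)` for a child `β` of `γ`. -/
noncomputable def edge (γ : Λ) (β : S.children γ) : R.Edge :=
  ⟨S.type γ, S.childEquiv (R.similar_rep γ) β⟩

/-- `R.IsRootWalk α w`: `w` is the sequence of edges `e(ϑ, α)` from the root to `α`, the empty
sequence if `α` is the root. -/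
inductive IsRootWalk : Λ → List R.Edge → Prop
  | root : IsRootWalk S.root []
  | step {γ : Λ} {w : List R.Edge} (β : S.children γ) :
      IsRootWalk γ w → IsRootWalk β (w ++ [R.edge γ β])

end Representatives

/-- A matrix on the boundary of every representative, and a number for every edge. -/
structure NetworkData (R : S.Representatives) where
  D : ∀ i : S.Types, Matrix (S.V (R.rep i)) (S.V (R.rep i)) ℝ
  r : R.Edge → ℝ

namespace NetworkData

variable {R : S.Representatives} (N : NetworkData R)

/-- The form `E_{α_i, n}`. The arguments are functions on the whole space; the form depends only on
their values on the finite set `V_{α_i, n}`. -/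
noncomputable def energy : ℕ → S.Types → (Euc d → ℝ) → (Euc d → ℝ) → ℝ
  | 0, i, u, v => dirichletForm (N.D i) (fun x => u x) (fun x => v x)
  | n + 1, i, u, v =>
      ∑ β : S.children (R.rep i), (N.r ⟨i, β⟩)⁻¹ *
        energy n (S.type β) (u ∘ S.φ (R.rep (S.type β)) β) (v ∘ S.φ (R.rep (S.type β)) β)

/-- The product of the factors along a sequence of edges. -/
def weight (w : List R.Edge) : ℝ := (w.map N.r).prod

end NetworkData

/-- Harmonic structures: Laplacians `D_{α_i}` on `V_{α_i}` and positive factors `r_e` satisfying the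
renormalization equations: `E_{α_i, 0}` is the trace on `V_{α_i}` of `E_{α_i, 1}`. -/
structure HarmonicStructure (R : S.Representatives) extends NetworkData R where
  isLaplacian : ∀ i, IsLaplacian (D i)
  r_pos : ∀ e, 0 < r e
  renormalization : ∀ (i : S.Types) (v : S.V (R.rep i) → ℝ),
    IsLeast {t : ℝ | ∃ u : Euc d → ℝ, (∀ x : S.V (R.rep i), u x = v x) ∧
      t = toNetworkData.energy 1 i u u} (dirichletForm (D i) v v)

namespace HarmonicStructure

variable {R : S.Representatives} (H : HarmonicStructure R)

/-- Regularity: the product of the factors along every cycle is less than one. -/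
def Regular : Prop := ∀ (i : S.Types) (w : List R.Edge), R.IsWalk i i w → H.weight w < 1

/-- Homogeneity: islands of the same type and the same size have the same weight. -/
def Homogeneous : Prop :=
  ∀ (α β : Λ) (w w' : List R.Edge), S.Similar α β →
    Metric.diam (S.island α) = Metric.diam (S.island β) →
    R.IsRootWalk α w → R.IsRootWalk β w' → H.weight w = H.weight w'

/-- The form `E_{H_n}(u, v)` on the vertex set `V_n`, for functions `u`, `v` on `K` (extended by zero
outside `K`, where no point of `V_n` lies). -/
noncomputable def levelForm (n : ℕ) (u v : C(K, ℝ)) : ℝ :=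
  H.energy n (S.type S.root)
    (Function.extend Subtype.val u 0) (Function.extend Subtype.val v 0)

/-- The domain of the induced resistance form on `K`: the continuous functions on `K` whose
energies `E_{H_n}(u)`, which are nondecreasing in `n`, have a finite limit. -/
def domain : Set C(K, ℝ) :=
  {u | ∃ t : ℝ, Filter.Tendsto (fun n => H.levelForm n u u) Filter.atTop (nhds t)}

end HarmonicStructure

end FRFT

/-- Two harmonic structures, of possibly different nested structures on `K`, induce the same
resistance form on `K`: the domains agree, and so do the values `E(u, v) = lim E_{H_n}(u, v)`. -/
def SameResistanceForm {d : ℕ} {K : Set (Euc d)} {Λ Λ' : Type*} {S : FRFT K Λ} {S' : FRFT K Λ'}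
    {R : S.Representatives} {R' : S'.Representatives}
    (H : FRFT.HarmonicStructure R) (H' : FRFT.HarmonicStructure R') : Prop :=
  H'.domain = H.domain ∧ ∀ u ∈ H.domain, ∀ v ∈ H.domain, ∃ t : ℝ,
    Filter.Tendsto (fun n => H.levelForm n u v) Filter.atTop (nhds t) ∧
    Filter.Tendsto (fun n => H'.levelForm n u v) Filter.atTop (nhds t)

/-! The energy of a function is localized. For a set A, `Weight.m u A` is the supremum over n of the
sums of the cell energies of `u` over the islands of generation n contained in A. It is monotone in
A and lower semicontinuous in `u`. It is superadditive over sets with finite intersections, since an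
infinite island cannot lie in two of them, and countably subadditive over relatively open sets, up
to a countable set (`m_le_tsum`). Hence the energy on an island of `S'` without its boundary is the
sum of the energies on its tiles (`m_tile`).

A similitude of `S'` carries tiles to tiles of the same type. On a tile, energy is multiplied by a
ratio of weights. Homogeneity and strong connectivity make this ratio a function of the size ratio
alone (`IsRatio.unique`), so all tiles scale by one number and the whole island scales by it
(`exists_scale`).

The Laplacians of `S'` are the traces of the energy on the boundaries of the representatives
(`exists_trace`), and the factor of an edge is the scaling number of the corresponding child.
Cutting and gluing minimizers on the children gives the renormalization equations
(`IsTrace.isLeast`). The scaling numbers are multiplicative and depend only on size ratios, which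
gives weights and homogeneity.

Regularity is `scale_lt_one`: if a similitude into a proper offspring did not increase energy,
pushing a bump forward repeatedly would give functions of bounded energy with oscillation one on
sets shrinking to a point. This contradicts the equicontinuity that follows from regularity of the
given structure (`exists_oscBound`). Finally, the cells of the new structure are traces of the old
energy, so its discrete energies are bounded by the old one. Gluing minimizers at finer and finer
generations gives the opposite inequality (`m_eq_of_isTrace`), and polarization recovers the form.
-/

namespace FRFT

/-! ### Combinatorics and topology of the islands. -/

section Tree

variable {d : ℕ} {K : Set (Euc d)} {Λ : Type*} (S : FRFT K Λ)

theorem island_infinite (α : Λ) : (S.island α).Infinite :=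
  (S.island_connected α).isPreconnected.infinite_of_nontrivial (S.island_nontrivial α)

variable {S}

theorem phi_mem {α β : Λ} (h : S.Similar α β) {x : Euc d} (hx : x ∈ S.island α) :
    S.φ α β x ∈ S.island β := by
  rw [← S.φ_image α β h]
  exact Set.mem_image_of_mem _ hx

theorem phi_phi {α β γ : Λ} (h : S.Similar α β) (h' : S.Similar β γ) {x : Euc d}
    (hx : x ∈ S.island α) : S.φ β γ (S.φ α β x) = S.φ α γ x :=
  S.φ_comp α β γ h h' hx

theorem phi_self {α : Λ} {x : Euc d} (hx : x ∈ S.island α) : S.φ α α x = x :=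
  S.φ_self α hx

theorem phi_inv {α β : Λ} (h : S.Similar α β) {x : Euc d} (hx : x ∈ S.island α) :
    S.φ β α (S.φ α β x) = x := by
  rw [phi_phi h (S.similar_symm h) hx, phi_self hx]

theorem exists_phi_eq {α β : Λ} (h : S.Similar α β) {y : Euc d} (hy : y ∈ S.island β) :
    ∃ x ∈ S.island α, S.φ α β x = y := by
  rw [← S.φ_image α β h] at hy
  exact hy

theorem mem_C {α : Λ} {x : Euc d} : x ∈ S.C α ↔ ∃ β ∈ S.children α, ∃ β' ∈ S.children α,
    β ≠ β' ∧ x ∈ S.island β ∧ x ∈ S.island β' := by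
  simp only [NestedStructure.C, Set.mem_iUnion, Set.mem_inter_iff, exists_prop]

theorem mem_V {α : Λ} {x : Euc d} : x ∈ S.V α ↔ ∃ β, S.Similar β α ∧ β ≠ S.root ∧
    ∃ y ∈ S.island β, (∃ γ, S.IsAncestor γ β ∧ y ∈ S.C γ) ∧ S.φ β α y = x := by
  simp only [MarkedNestedStructure.V, Set.mem_iUnion, Set.mem_image, Set.mem_inter_iff, exists_prop]
  constructor
  · rintro ⟨β, ⟨h1, h2⟩, y, ⟨h3, h4⟩, h5⟩
    exact ⟨β, h1, h2, y, h3, h4, h5⟩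
  · rintro ⟨β, h1, h2, y, h3, h4, h5⟩
    exact ⟨β, ⟨h1, h2⟩, y, ⟨h3, h4⟩, h5⟩

theorem V_subset (α : Λ) : S.V α ⊆ S.island α := by
  intro x hx
  obtain ⟨β, h, -, y, hy, -, rfl⟩ := mem_V.1 hx
  exact phi_mem h hy

theorem V_map {α β : Λ} (h : S.Similar α β) {x : Euc d} (hx : x ∈ S.V α) : S.φ α β x ∈ S.V β := by
  obtain ⟨δ, h1, h2, y, hy, h3, rfl⟩ := mem_V.1 hx
  exact mem_V.2 ⟨δ, S.similar_trans h1 h, h2, y, hy, h3, (phi_phi h1 h hy).symm⟩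

theorem mem_V_of_mem_C {β γ : Λ} (hβ : β ≠ S.root) (h : S.IsAncestor γ β) {x : Euc d}
    (hx : x ∈ S.island β) (hC : x ∈ S.C γ) : x ∈ S.V β :=
  mem_V.2 ⟨β, S.similar_refl β, hβ, x, hx, ⟨γ, h, hC⟩, phi_self hx⟩

theorem island_subset_of_child {α β : Λ} (h : β ∈ S.children α) : S.island β ⊆ S.island α := by
  rw [S.island_eq α]
  exact Set.subset_biUnion_of_mem (u := fun β => S.island β) h

theorem exists_child_mem {α : Λ} {x : Euc d} (hx : x ∈ S.island α) :
    ∃ β ∈ S.children α, x ∈ S.island β := by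
  rw [S.island_eq α] at hx
  simpa using hx

theorem exists_sibling {α β : Λ} : ∃ β' ∈ S.children α, β' ≠ β :=
  Finset.exists_mem_ne (S.two_le_card_children α) β

/-- Otherwise all points of the infinite set K_β would lie in the intersections C_α, hence in the
finite boundary V_β. -/
theorem not_island_subset_sibling {α β β' : Λ} (hβ : β ∈ S.children α) (hβ' : β' ∈ S.children α)
    (hne : β ≠ β') (hr : β ≠ S.root) : ¬ S.island β ⊆ S.island β' := fun hsub =>
  S.island_infinite β ((S.finite_V β).subset fun _ hx =>
    mem_V_of_mem_C hr (Relation.TransGen.single hβ) hx (mem_C.2 ⟨β, hβ, β', hβ', hne, hx, hsub hx⟩))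

theorem root_notMem_children (α : Λ) : S.root ∉ S.children α := by
  intro h
  obtain ⟨β, hβ, hne⟩ := exists_sibling (S := S) (α := α) (β := S.root)
  refine not_island_subset_sibling hβ h hne hne ?_
  rw [S.island_root]
  exact S.island_subset β

theorem ne_root_of_child {α β : Λ} (h : β ∈ S.children α) : β ≠ S.root := by
  rintro rfl
  exact root_notMem_children _ h

theorem notMem_children_self (α : Λ) : α ∉ S.children α := by
  intro h
  obtain ⟨β, hβ, hne⟩ := exists_sibling (S := S) (α := α) (β := α)
  exact not_island_subset_sibling hβ h hne (ne_root_of_child hβ) (island_subset_of_child hβ)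

theorem island_subset_of_isAncestor {γ β : Λ} (h : S.IsAncestor γ β) :
    S.island β ⊆ S.island γ := by
  induction h with
  | single h => exact island_subset_of_child h
  | tail _ h ih => exact (island_subset_of_child h).trans ih

/-- Around a cycle of children all inclusions are equalities, so an index would be its own child by
injectivity of `island`. -/
theorem not_isAncestor_self (γ : Λ) : ¬ S.IsAncestor γ γ := by
  intro h
  obtain ⟨δ, h1, h2⟩ := Relation.TransGen.head'_iff.1 h
  have hsub : S.island γ ⊆ S.island δ := by
    rcases Relation.reflTransGen_iff_eq_or_transGen.1 h2 with rfl | h3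
    · exact subset_rfl
    · exact island_subset_of_isAncestor h3
  have : γ = δ := S.island_injective (hsub.antisymm (island_subset_of_child h1))
  subst this
  exact notMem_children_self _ h1

theorem childEquiv_similar {α α' : Λ} (h : S.Similar α α') (β : S.children α) :
    S.Similar β (S.childEquiv h β) :=
  ((S.children_equiv α α' h).choose_spec β).1

theorem childEquiv_phi {α α' : Λ} (h : S.Similar α α') (β : S.children α) {x : Euc d}
    (hx : x ∈ S.island β) : S.φ β (S.childEquiv h β) x = S.φ α α' x :=
  ((S.children_equiv α α' h).choose_spec β).2 hx

/-- The point comes from a copy δ of α, where it lies in some C_γ with γ an ancestor of δ. By (A2)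
the child β corresponds to a child of δ under the same similitude, and γ is also an ancestor of that
child. -/
theorem mem_V_child {α β : Λ} (hβ : β ∈ S.children α) {x : Euc d} (hx : x ∈ S.V α)
    (hxβ : x ∈ S.island β) : x ∈ S.V β := by
  obtain ⟨δ, h1, h2, y, hy, ⟨γ, hγ, hC⟩, rfl⟩ := mem_V.1 hx
  obtain ⟨β₀, hb⟩ := (S.childEquiv h1).surjective ⟨β, hβ⟩
  have hs := childEquiv_similar h1 β₀
  have hp := fun x hx => childEquiv_phi h1 β₀ (x := x) hx
  rw [hb] at hs hp
  obtain ⟨z, hz, hzy⟩ := exists_phi_eq hs hxβ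
  have hzy' := hzy
  rw [hp z hz] at hzy
  have : z = y := (S.φ δ α).injective hzy
  subst this
  exact mem_V.2 ⟨β₀, hs, ne_root_of_child β₀.2, z, hz, ⟨γ, hγ.tail β₀.2, hC⟩, hzy'⟩

theorem mem_V_of_mem_siblings {γ β β' : Λ} (hβ : β ∈ S.children γ) (hβ' : β' ∈ S.children γ)
    (hne : β ≠ β') {x : Euc d} (hx : x ∈ S.island β) (hx' : x ∈ S.island β') : x ∈ S.V β :=
  mem_V_of_mem_C (ne_root_of_child hβ) (Relation.TransGen.single hβ) hx
    (mem_C.2 ⟨β, hβ, β', hβ', hne, hx, hx'⟩)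

variable (S)

open scoped Classical in
/-- The indices of the offspring of `α` of generation `n`. -/
noncomputable def desc (α : Λ) : ℕ → Finset Λ
  | 0 => {α}
  | n + 1 => (desc α n).biUnion S.children

/-- The indices of the islands of generation `n`. -/
noncomputable def gen (n : ℕ) : Finset Λ := S.desc S.root n

variable {S}

@[simp] theorem mem_desc_zero {α γ : Λ} : γ ∈ S.desc α 0 ↔ γ = α := by simp [desc]

theorem mem_desc_succ {α γ : Λ} {n : ℕ} :
    γ ∈ S.desc α (n + 1) ↔ ∃ β ∈ S.desc α n, γ ∈ S.children β := by simp [desc]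

theorem mem_desc_add {α γ : Λ} {m n : ℕ} :
    γ ∈ S.desc α (m + n) ↔ ∃ β ∈ S.desc α m, γ ∈ S.desc β n := by
  induction n generalizing γ with
  | zero => simp
  | succ n ih =>
    rw [← add_assoc, mem_desc_succ]
    constructor
    · rintro ⟨δ, h1, h2⟩
      obtain ⟨β, h3, h4⟩ := ih.1 h1
      exact ⟨β, h3, mem_desc_succ.2 ⟨δ, h4, h2⟩⟩
    · rintro ⟨β, h1, h2⟩
      obtain ⟨δ, h3, h4⟩ := mem_desc_succ.1 h2
      exact ⟨δ, ih.2 ⟨β, h1, h3⟩, h4⟩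

theorem mem_desc_one {α γ : Λ} : γ ∈ S.desc α 1 ↔ γ ∈ S.children α := by
  rw [show 1 = 0 + 1 from rfl, mem_desc_succ]; simp

theorem mem_desc_succ_left {α γ : Λ} {n : ℕ} :
    γ ∈ S.desc α (n + 1) ↔ ∃ β ∈ S.children α, γ ∈ S.desc β n := by
  rw [add_comm, mem_desc_add]; simp [mem_desc_one]

theorem island_subset_of_desc {α γ : Λ} {n : ℕ} (h : γ ∈ S.desc α n) :
    S.island γ ⊆ S.island α := by
  induction n generalizing γ with
  | zero => rw [mem_desc_zero.1 h]
  | succ n ih =>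
    obtain ⟨β, h1, h2⟩ := mem_desc_succ.1 h
    exact (island_subset_of_child h2).trans (ih h1)

theorem exists_desc_mem {α : Λ} (n : ℕ) {x : Euc d} (hx : x ∈ S.island α) :
    ∃ γ ∈ S.desc α n, x ∈ S.island γ := by
  induction n with
  | zero => exact ⟨α, by simp, hx⟩
  | succ n ih =>
    obtain ⟨β, h1, h2⟩ := ih
    obtain ⟨γ, h3, h4⟩ := exists_child_mem h2
    exact ⟨γ, mem_desc_succ.2 ⟨β, h1, h3⟩, h4⟩

theorem exists_gen_mem (n : ℕ) {x : Euc d} (hx : x ∈ K) : ∃ γ ∈ S.gen n, x ∈ S.island γ :=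
  exists_desc_mem n (by rwa [S.island_root])

theorem isAncestor_of_desc {α γ : Λ} {n : ℕ} (h : γ ∈ S.desc α (n + 1)) : S.IsAncestor α γ := by
  induction n generalizing γ with
  | zero => exact Relation.TransGen.single (mem_desc_one.1 h)
  | succ n ih =>
    obtain ⟨β, h1, h2⟩ := mem_desc_succ.1 h
    exact (ih h1).tail h2

theorem exists_desc_of_isAncestor {α γ : Λ} (h : S.IsAncestor α γ) :
    ∃ n, γ ∈ S.desc α (n + 1) := by
  induction h with
  | single h => exact ⟨0, mem_desc_one.2 h⟩
  | tail _ h ih =>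
    obtain ⟨n, hn⟩ := ih
    exact ⟨n + 1, mem_desc_succ.2 ⟨_, hn, h⟩⟩

variable (S) in
theorem exists_gen (α : Λ) : ∃ n, α ∈ S.gen n := by
  by_cases h : α = S.root
  · exact ⟨0, by simp [gen, h]⟩
  · obtain ⟨n, hn⟩ := exists_desc_of_isAncestor (S.offspring α h)
    exact ⟨n + 1, hn⟩

/-- If the parents differ, the point is on the boundary of the parent by induction and is inherited
by the child. If they agree, it lies in the intersection of two siblings. -/
theorem mem_V_of_mem_desc {α γ γ' : Λ} {n : ℕ} (h : γ ∈ S.desc α n) (h' : γ' ∈ S.desc α n)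
    (hne : γ ≠ γ') {x : Euc d} (hx : x ∈ S.island γ) (hx' : x ∈ S.island γ') : x ∈ S.V γ := by
  induction n generalizing γ γ' with
  | zero => exact absurd ((mem_desc_zero.1 h).trans (mem_desc_zero.1 h').symm) hne
  | succ n ih =>
    obtain ⟨β, h1, h2⟩ := mem_desc_succ.1 h
    obtain ⟨β', h1', h2'⟩ := mem_desc_succ.1 h'
    by_cases hb : β = β'
    · subst hb
      exact mem_V_of_mem_siblings h2 h2' hne hx hx'
    · exact mem_V_child h2 (ih h1 h1' hb (island_subset_of_child h2 hx)
        (island_subset_of_child h2' hx')) hx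

theorem finite_inter_of_desc {α γ γ' : Λ} {n : ℕ} (h : γ ∈ S.desc α n) (h' : γ' ∈ S.desc α n)
    (hne : γ ≠ γ') : (S.island γ ∩ S.island γ').Finite :=
  (S.finite_V γ).subset fun _ hx => mem_V_of_mem_desc h h' hne hx.1 hx.2

theorem mem_gen_succ {γ : Λ} {n : ℕ} :
    γ ∈ S.gen (n + 1) ↔ ∃ β ∈ S.gen n, γ ∈ S.children β := mem_desc_succ

theorem mem_gen_add {γ : Λ} {m n : ℕ} :
    γ ∈ S.gen (m + n) ↔ ∃ β ∈ S.gen m, γ ∈ S.desc β n := mem_desc_add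

/-- No index is a child of two different offspring of generation n, because its infinite island
would lie in their finite intersection. -/
theorem sum_desc_succ (α : Λ) (n : ℕ) (f : Λ → ℝ) :
    ∑ γ ∈ S.desc α (n + 1), f γ = ∑ β ∈ S.desc α n, ∑ γ ∈ S.children β, f γ := by
  classical
  have : S.desc α (n + 1) = (S.desc α n).biUnion S.children := by
    ext; simp [mem_desc_succ]
  rw [this, Finset.sum_biUnion]
  intro β hβ β' hβ' hne
  rw [Function.onFun, Finset.disjoint_left]
  intro γ h1 h2
  exact S.island_infinite γ ((finite_inter_of_desc hβ hβ' hne).subset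
    (Set.subset_inter (island_subset_of_child h1) (island_subset_of_child h2)))

theorem sum_desc_add (α : Λ) (m n : ℕ) (f : Λ → ℝ) :
    ∑ γ ∈ S.desc α (m + n), f γ = ∑ β ∈ S.desc α m, ∑ γ ∈ S.desc β n, f γ := by
  classical
  have : S.desc α (m + n) = (S.desc α m).biUnion (fun β => S.desc β n) := by
    ext; simp [mem_desc_add]
  rw [this, Finset.sum_biUnion]
  intro β hβ β' hβ' hne
  rw [Function.onFun, Finset.disjoint_left]
  intro γ h1 h2
  exact S.island_infinite γ ((finite_inter_of_desc hβ hβ' hne).subset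
    (Set.subset_inter (island_subset_of_desc h1) (island_subset_of_desc h2)))

theorem sum_desc_succ_left (α : Λ) (n : ℕ) (f : Λ → ℝ) :
    ∑ γ ∈ S.desc α (n + 1), f γ = ∑ β ∈ S.children α, ∑ γ ∈ S.desc β n, f γ := by
  rw [add_comm, sum_desc_add]
  refine Finset.sum_congr ?_ fun _ _ => rfl
  ext; exact mem_desc_one

theorem mem_V_desc {α β : Λ} {n : ℕ} (hβ : β ∈ S.desc α n) {x : Euc d} (hx : x ∈ S.V α)
    (hxβ : x ∈ S.island β) : x ∈ S.V β := by
  induction n generalizing β with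
  | zero => rwa [mem_desc_zero.1 hβ]
  | succ n ih =>
    obtain ⟨δ, h1, h2⟩ := mem_desc_succ.1 hβ
    exact mem_V_child h2 (ih h1 (island_subset_of_child h2 hxβ)) hxβ

variable (S)

theorem island_closed (α : Λ) : IsClosed (S.island α) := (S.island_compact α).isClosed

/-- The island without its boundary. -/
def O (α : Λ) : Set (Euc d) := S.island α \ S.V α

theorem O_subset (α : Λ) : S.O α ⊆ S.island α := Set.sdiff_subset

/-- What is removed from K is closed: the finite boundary and the finitely many other islands of the
same generation. The latter meet K_α only in V_α. -/
theorem exists_open_O (α : Λ) : ∃ U, IsOpen U ∧ S.O α = U ∩ K := by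
  obtain ⟨n, hn⟩ := S.exists_gen α
  refine ⟨(S.V α ∪ ⋃ β ∈ {β | β ∈ S.gen n ∧ β ≠ α}, S.island β)ᶜ, ?_, ?_⟩
  · rw [isOpen_compl_iff]
    refine (S.finite_V α).isClosed.union ?_
    exact Set.Finite.isClosed_biUnion ((S.gen n).finite_toSet.subset fun x hx => hx.1)
      fun β _ => S.island_closed β
  · ext x
    simp only [O, Set.mem_sdiff, Set.mem_inter_iff, Set.mem_compl_iff, Set.mem_union,
      Set.mem_iUnion, not_or, not_exists]
    constructor
    · rintro ⟨h1, h2⟩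
      exact ⟨⟨h2, fun β hβ hx => h2 (mem_V_of_mem_desc hn hβ.1 hβ.2.symm h1 hx)⟩,
        S.island_subset α h1⟩
    · rintro ⟨⟨h1, h2⟩, h3⟩
      obtain ⟨γ, hγ, hx⟩ := exists_gen_mem (S := S) n h3
      by_cases h : γ = α
      · exact ⟨h ▸ hx, h1⟩
      · exact absurd hx (h2 γ ⟨hγ, h⟩)

variable {S}

theorem O_desc_subset {α β : Λ} {n : ℕ} (hβ : β ∈ S.desc α n) : S.O β ⊆ S.O α :=
  fun _ hx => ⟨island_subset_of_desc hβ hx.1, fun hV => hx.2 (mem_V_desc hβ hV hx.1)⟩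

/-- Neighbouring children. -/
def childGraph (S : FRFT K Λ) (γ : Λ) : SimpleGraph (S.children γ) :=
  SimpleGraph.fromRel fun β β' => (S.island β ∩ S.island β').Nonempty

theorem childGraph_adj {γ : Λ} {β β' : S.children γ} : (S.childGraph γ).Adj β β' ↔
    β ≠ β' ∧ (S.island β ∩ S.island β').Nonempty := by
  simp [childGraph, Set.inter_comm]

/-- The children reachable from a given one and the remaining ones would otherwise split the
connected island into two disjoint nonempty closed sets. -/
theorem childGraph_preconnected (γ : Λ) : (S.childGraph γ).Preconnected := by
  classical
  intro β₀ β₁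
  by_contra hnr
  let A : Set (Euc d) := ⋃ β ∈ {β | (S.childGraph γ).Reachable β₀ β}, S.island β
  let B : Set (Euc d) := ⋃ β ∈ {β | ¬ (S.childGraph γ).Reachable β₀ β}, S.island β
  have hA : IsClosed A := Set.Finite.isClosed_biUnion (Set.toFinite _) fun β _ => S.island_closed β
  have hB : IsClosed B := Set.Finite.isClosed_biUnion (Set.toFinite _) fun β _ => S.island_closed β
  have hsub : ∀ β : S.children γ, S.island β ⊆ S.island γ := fun β => island_subset_of_child β.2
  obtain ⟨a, ha⟩ := (S.island_nontrivial β₀).nonempty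
  obtain ⟨b, hb⟩ := (S.island_nontrivial β₁).nonempty
  obtain ⟨x, -, hxA, hxB⟩ := isPreconnected_closed_iff.1 (S.island_connected γ).isPreconnected A B
    hA hB (by
      intro x hx
      obtain ⟨β, hβ, hx⟩ := exists_child_mem hx
      by_cases h : (S.childGraph γ).Reachable β₀ ⟨β, hβ⟩
      · exact Or.inl (Set.mem_biUnion (x := ⟨β, hβ⟩) h hx)
      · exact Or.inr (Set.mem_biUnion (x := ⟨β, hβ⟩) h hx))
    ⟨a, hsub β₀ ha, Set.mem_biUnion (x := β₀) (SimpleGraph.Reachable.refl _) ha⟩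
    ⟨b, hsub β₁ hb, Set.mem_biUnion (x := β₁) hnr hb⟩
  simp only [A, B, Set.mem_iUnion, Set.mem_ofPred_eq] at hxA hxB
  obtain ⟨β, h1, h2⟩ := hxA
  obtain ⟨β', h3, h4⟩ := hxB
  by_cases hne : β = β'
  · exact h3 (hne ▸ h1)
  · exact h3 (h1.trans (childGraph_adj.2 ⟨hne, x, h2, h4⟩).reachable)

theorem V_nonempty_of_child {γ β : Λ} (hβ : β ∈ S.children γ) : (S.V β).Nonempty := by
  obtain ⟨β', hβ', hne⟩ := exists_sibling (S := S) (α := γ) (β := β)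
  obtain ⟨w⟩ := childGraph_preconnected γ ⟨β, hβ⟩ ⟨β', hβ'⟩
  cases w with
  | nil => exact absurd rfl hne
  | @cons _ δ _ h _ =>
    obtain ⟨h1, x, hx, hx'⟩ := childGraph_adj.1 h
    exact ⟨x, mem_V_of_mem_siblings hβ δ.2 (fun h => h1 (Subtype.ext h)) hx hx'⟩

theorem V_nonempty {β : Λ} (hβ : β ≠ S.root) : (S.V β).Nonempty := by
  obtain ⟨γ, -, h⟩ := Relation.TransGen.tail'_iff.1 (S.offspring β hβ)
  exact V_nonempty_of_child h

/-- Functions on finitely many islands that meet in boundary points only can be glued. -/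
theorem exists_glue (T : Finset Λ)
    (hT : ∀ α ∈ T, ∀ β ∈ T, α ≠ β → S.island α ∩ S.island β ⊆ S.V α)
    (u : Euc d → ℝ) (f : Λ → Euc d → ℝ) (hf : ∀ α ∈ T, Set.EqOn (f α) u (S.V α)) :
    ∃ g : Euc d → ℝ, ∀ α ∈ T, Set.EqOn g (f α) (S.island α) := by
  classical
  refine ⟨fun x => if h : ∃ α ∈ T, x ∈ S.island α then f h.choose x else 0, ?_⟩
  intro α hα x hx
  have h : ∃ α ∈ T, x ∈ S.island α := ⟨α, hα, hx⟩
  obtain ⟨h1, h2⟩ := h.choose_spec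
  simp only [dif_pos h]
  by_cases hne : α = h.choose
  · rw [← hne]
  · rw [hf α hα (hT α hα _ h1 hne ⟨hx, h2⟩), hf _ h1 (hT _ h1 α hα (Ne.symm hne) ⟨h2, hx⟩)]

theorem continuousOn_biUnion_island (T : Finset Λ) {g : Euc d → ℝ}
    (h : ∀ α ∈ T, ContinuousOn g (S.island α)) : ContinuousOn g (⋃ α ∈ T, S.island α) := by
  classical
  induction T using Finset.induction_on with
  | empty => simp
  | insert a s ha ih =>
    rw [Finset.set_biUnion_insert]
    refine ContinuousOn.union_of_isClosed (h a (by simp)) (ih fun α hα => h α (by simp [hα]))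
      (S.island_closed a) ?_
    exact Set.Finite.isClosed_biUnion s.finite_toSet fun β _ => S.island_closed β

end Tree

/-! ### Walks in the graph and geometric decay along them. -/

section Walks

variable {d : ℕ} {K : Set (Euc d)} {Λ : Type*} {S : FRFT K Λ}

theorem diam_pos (α : Λ) : 0 < Metric.diam (S.island α) :=
  Metric.diam_pos (S.island_nontrivial α) (S.island_compact α).isBounded

theorem diam_image_of_eqOn {f : Euc d ≃ᵈ Euc d} {A B : Set (Euc d)} (h : f '' A = B) :
    Metric.diam B = Dilation.ratio f * Metric.diam A := by
  rw [← h, Dilation.diam_image]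

theorem diam_similar {α β : Λ} (h : S.Similar α β) :
    Metric.diam (S.island β) = Dilation.ratio (S.φ α β) * Metric.diam (S.island α) :=
  diam_image_of_eqOn (S.φ_image α β h)

theorem diam_child {α α' : Λ} (h : S.Similar α α') (β : S.children α) :
    Metric.diam (S.island (S.childEquiv h β)) =
      Dilation.ratio (S.φ α α') * Metric.diam (S.island β) := by
  refine diam_image_of_eqOn ?_
  rw [← S.φ_image _ _ (childEquiv_similar h β)]
  exact Set.image_congr fun x hx => (childEquiv_phi h β hx).symm

/-- An isometric copy of a compact set inside itself is the whole set. -/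
theorem image_eq_of_isometric {X : Type*} [MetricSpace X] {A : Set X} (hA : IsCompact A)
    {f : X → X} (hf : Isometry f) (hsub : f '' A ⊆ A) : f '' A = A := by
  refine hsub.antisymm fun x hx => ?_
  by_contra hnx
  have hcl : IsClosed (f '' A) := (hA.image hf.continuous).isClosed
  obtain ⟨ε, hε, hball⟩ := Metric.isOpen_iff.1 hcl.isOpen_compl x hnx
  have hit : ∀ n, f^[n] x ∈ A := by
    intro n
    induction n with
    | zero => exact hx
    | succ n ih =>
      rw [Function.iterate_succ_apply']
      exact hsub ⟨_, ih, rfl⟩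
  -- A point at distance ε from the closed image has an ε-separated orbit, which compactness
  -- forbids.
  have hsep : ∀ m k, ε ≤ dist (f^[m + (k + 1)] x) (f^[m] x) := by
    intro m k
    have hm : ∀ m a b, dist (f^[m] a) (f^[m] b) = dist a b := by
      intro m
      induction m with
      | zero => simp
      | succ m ih => intro a b; rw [Function.iterate_succ_apply, Function.iterate_succ_apply, ih,
          hf.dist_eq]
    rw [Function.iterate_add_apply, hm]
    by_contra hlt
    refine hball (Metric.mem_ball.2 (not_le.1 hlt)) ?_
    rw [Function.iterate_succ_apply']
    exact ⟨_, hit k, rfl⟩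
  obtain ⟨a, -, φ, hφ, hlim⟩ := hA.tendsto_subseq hit
  obtain ⟨N, hN⟩ := Metric.cauchySeq_iff.1 hlim.cauchySeq ε hε
  have h1 := hN (N + 1) (by omega) N le_rfl
  have h2 : φ N < φ (N + 1) := hφ (Nat.lt_succ_self N)
  have h3 := hsep (φ N) (φ (N + 1) - φ N - 1)
  rw [show φ N + (φ (N + 1) - φ N - 1 + 1) = φ (N + 1) by omega] at h3
  exact absurd h1 (not_lt.2 h3)

/-- With equal diameters the similitude would be an isometry of a compact island into itself, hence
onto, and the two islands would coincide. -/
theorem diam_lt {α β : Λ} (h : S.IsAncestor α β) (hs : S.Similar α β) :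
    Metric.diam (S.island β) < Metric.diam (S.island α) := by
  have hsub := island_subset_of_isAncestor h
  refine lt_of_le_of_ne (Metric.diam_mono hsub (S.island_compact α).isBounded) fun heq => ?_
  have h1 := diam_similar hs
  rw [heq] at h1
  have hr : (Dilation.ratio (S.φ α β) : ℝ) = 1 := by
    have := diam_pos (S := S) α
    nlinarith
  have hiso : Isometry (S.φ α β) := Isometry.of_dist_eq fun x y => by
    rw [Dilation.dist_eq, hr, one_mul]
  have h2 := image_eq_of_isometric (S.island_compact α) hiso (by rw [S.φ_image _ _ hs]; exact hsub)
  rw [S.φ_image _ _ hs] at h2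
  have := S.island_injective h2
  subst this
  exact not_isAncestor_self _ h

namespace Representatives

variable {R : S.Representatives}

instance : Finite S.Types := S.finite_types

instance : Finite R.Edge := by
  unfold Edge
  infer_instance

@[simp] theorem edge_final (γ : Λ) (β : S.children γ) : (R.edge γ β).final = S.type β :=
  (S.type_eq_iff.2 (childEquiv_similar (R.similar_rep γ) β)).symm

theorem exists_edge_eq {γ : Λ} {e : R.Edge} (h : e.init = S.type γ) :
    ∃ β : S.children γ, R.edge γ β = e := by
  obtain ⟨i, b⟩ := e
  change i = S.type γ at h
  subst h
  refine ⟨(S.childEquiv (R.similar_rep γ)).symm b, ?_⟩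
  simp only [edge, Equiv.apply_symm_apply]
  rfl

variable (R) in
/-- Possibly empty walks from `i` to `j`. -/
def IsPath : S.Types → S.Types → List R.Edge → Prop
  | i, j, [] => i = j
  | i, j, e :: w => e.init = i ∧ IsPath e.final j w

theorem isPath_append {i k : S.Types} {w w' : List R.Edge} :
    R.IsPath i k (w ++ w') ↔ ∃ j, R.IsPath i j w ∧ R.IsPath j k w' := by
  induction w generalizing i with
  | nil => simp [IsPath]
  | cons e w ih => simp [IsPath, ih, and_assoc]

theorem IsPath.unique {i j j' : S.Types} {w : List R.Edge} (h : R.IsPath i j w)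
    (h' : R.IsPath i j' w) : j = j' := by
  induction w generalizing i with
  | nil => exact h.symm.trans h'
  | cons e w ih => exact ih h.2 h'.2

theorem isWalk_iff {i j : S.Types} {w : List R.Edge} : R.IsWalk i j w ↔ w ≠ [] ∧ R.IsPath i j w := by
  constructor
  · intro h
    induction h with
    | single e => exact ⟨by simp, rfl, rfl⟩
    | cons e _ ih => exact ⟨by simp, rfl, ih.2⟩
  · rintro ⟨hw, h⟩
    induction w generalizing i with
    | nil => exact absurd rfl hw
    | cons e w ih =>
      obtain ⟨rfl, h2⟩ := h
      cases w with
      | nil =>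
        obtain rfl : e.final = j := h2
        exact IsWalk.single e
      | cons e' w' => exact IsWalk.cons e (ih (by simp) h2)

/-- Pigeonhole for the states reached by the prefixes of length at most the number of types. This
also bounds the length of the cycle that is found. -/
theorem IsPath.exists_cycle [Fintype S.Types] {i j : S.Types} {w : List R.Edge}
    (h : R.IsPath i j w) (hw : Fintype.card S.Types ≤ w.length) :
    ∃ s w₁ w₂ w₃, w = w₁ ++ (w₂ ++ w₃) ∧ R.IsPath i s w₁ ∧ R.IsPath s s w₂ ∧ R.IsPath s j w₃ ∧
      w₂ ≠ [] ∧ w₂.length ≤ Fintype.card S.Types := by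
  have hsp : ∀ m, ∃ s, R.IsPath i s (w.take m) ∧ R.IsPath s j (w.drop m) := fun m => by
    rw [← isPath_append, List.take_append_drop]; exact h
  choose st h1 h2 using hsp
  obtain ⟨a, b, hab, hst⟩ := Fintype.exists_ne_map_eq_of_card_lt
    (fun m : Fin (Fintype.card S.Types + 1) => st m) (by simp)
  wlog hlt : a < b generalizing a b
  · exact this b a hab.symm hst.symm (lt_of_le_of_ne (not_lt.1 hlt) hab.symm)
  have hlt' : (a : ℕ) < b := hlt
  have hb := b.2
  obtain ⟨c, hc⟩ : ∃ c, (b : ℕ) = a + c := ⟨b - a, by omega⟩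
  have hdrop : w.drop a = (w.drop a).take c ++ w.drop b := by
    rw [hc, ← List.drop_drop, List.take_append_drop]
  have hp := h2 a
  rw [hdrop, isPath_append] at hp
  obtain ⟨s, h3, h4⟩ := hp
  have hs : s = st b := by
    have : R.IsPath i s (w.take b) := by
      rw [hc, List.take_add]
      exact isPath_append.2 ⟨_, h1 a, h3⟩
    exact this.unique (h1 b)
  subst hs
  rw [show st b = st a from hst.symm] at h3
  refine ⟨st a, w.take a, (w.drop a).take c, w.drop b, ?_, h1 a, h3, ?_, ?_, ?_⟩
  · rw [← hdrop, List.take_append_drop]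
  · rw [show st a = st b from hst]; exact h2 b
  · rw [← List.length_pos_iff, List.length_take, List.length_drop]
    omega
  · rw [List.length_take]
    omega

theorem exists_lt_one_of_finite {T : Set ℝ} (hT : T.Finite) (h : ∀ x ∈ T, x < 1) :
    ∃ θ : ℝ, 0 < θ ∧ θ < 1 ∧ ∀ x ∈ T, x ≤ θ := by
  induction T, hT using Set.Finite.induction_on with
  | empty => exact ⟨1 / 2, by norm_num, by norm_num, by simp⟩
  | @insert a s _ _ ih =>
    obtain ⟨θ, h1, h2, h3⟩ := ih fun x hx => h x (Set.mem_insert_of_mem _ hx)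
    refine ⟨max θ a, lt_max_of_lt_left h1, max_lt h2 (h a (Set.mem_insert _ _)), ?_⟩
    rintro x (rfl | hx)
    · exact le_max_right _ _
    · exact (h3 x hx).trans (le_max_left _ _)

/-- If all cycles have weight less than one, weights of walks decay geometrically. -/
theorem exists_decay {f : R.Edge → ℝ} (hf : ∀ e, 0 < f e)
    (hcyc : ∀ i w, R.IsWalk i i w → (w.map f).prod < 1) :
    ∃ C θ : ℝ, 0 < C ∧ 0 < θ ∧ θ < 1 ∧
      ∀ i j w, R.IsPath i j w → (w.map f).prod ≤ C * θ ^ w.length := by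
  classical
  have : Fintype S.Types := Fintype.ofFinite _
  set M := Fintype.card S.Types with hM
  have hMpos : M ≠ 0 := (Fintype.card_pos_iff.2 ⟨S.type S.root⟩).ne'
  have hpos : ∀ w : List R.Edge, 0 < (w.map f).prod := fun w =>
    List.prod_pos (by simpa using fun e _ => hf e)
  -- Only finitely many cycles have length at most `M`, so their weights have a common bound below
  -- one.
  obtain ⟨θ₀, h0, h1, h2⟩ := exists_lt_one_of_finite
    (T := (fun w : List R.Edge => (w.map f).prod) '' {w | w.length ≤ M ∧ ∃ i, R.IsWalk i i w})
    (((List.finite_length_le R.Edge M).subset fun w hw => hw.1).image _) (by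
      rintro _ ⟨w, ⟨-, i, hi⟩, rfl⟩
      exact hcyc i w hi)
  obtain ⟨A, hA⟩ : ∃ A, ∀ e, f e ≤ A := by
    obtain ⟨A, hA⟩ := (Set.finite_range f).bddAbove
    exact ⟨A, fun e => hA ⟨e, rfl⟩⟩
  set A' := max A 1 with hA'
  -- The root is taken so that a cycle of length at most `M`, of weight at most `θ₀`, also has
  -- weight at most `θ` to the power of its length.
  set θ := θ₀ ^ ((M : ℝ)⁻¹) with hθ
  have hθM : θ ^ M = θ₀ := Real.rpow_inv_natCast_pow h0.le hMpos
  have hθ0 : 0 < θ := Real.rpow_pos_of_pos h0 _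
  have hθ1 : θ < 1 := by
    by_contra hge
    have := one_le_pow₀ (n := M) (not_lt.1 hge)
    linarith
  have hA1 : 1 ≤ A' := le_max_right _ _
  have hAθ : 1 ≤ A' / θ := (one_le_div hθ0).2 (hθ1.le.trans hA1)
  -- The constant absorbs the paths shorter than `M`. From longer paths a short cycle is cut out and
  -- induction applies to the rest.
  refine ⟨(A' / θ) ^ M, θ, by positivity, hθ0, hθ1, ?_⟩
  intro i j w
  induction hn : w.length using Nat.strong_induction_on generalizing w with
  | _ n ih =>
    subst hn
    intro hw
    rcases lt_or_ge w.length M with hlt | hge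
    · have hb : ∀ w : List R.Edge, (w.map f).prod ≤ A' ^ w.length := by
        intro w
        induction w with
        | nil => simp
        | cons e w ihw =>
          simp only [List.map_cons, List.prod_cons, List.length_cons, pow_succ']
          exact mul_le_mul ((hA e).trans (le_max_left _ _)) ihw (hpos w).le (by positivity)
      calc (w.map f).prod ≤ A' ^ w.length := hb w
        _ = (A' / θ) ^ w.length * θ ^ w.length := by
          rw [← mul_pow, div_mul_cancel₀ _ hθ0.ne']
        _ ≤ (A' / θ) ^ M * θ ^ w.length := by
          gcongr
    · obtain ⟨s, w₁, w₂, w₃, rfl, p1, p2, p3, hne, hlen⟩ := hw.exists_cycle hge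
      have hc : (w₂.map f).prod ≤ θ ^ w₂.length :=
        (h2 _ ⟨w₂, ⟨hlen, s, isWalk_iff.2 ⟨hne, p2⟩⟩, rfl⟩).trans
          (hθM ▸ pow_le_pow_of_le_one hθ0.le hθ1.le hlen)
      have hl : 0 < w₂.length := List.length_pos_iff.2 hne
      have hrec := ih (w₁ ++ w₃).length (by simp only [List.length_append]; omega) (w₁ ++ w₃) rfl
        (isPath_append.2 ⟨s, p1, p3⟩)
      simp only [List.map_append, List.prod_append, List.length_append] at hrec ⊢
      calc (w₁.map f).prod * ((w₂.map f).prod * (w₃.map f).prod)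
          = (w₁.map f).prod * (w₃.map f).prod * (w₂.map f).prod := by ring
        _ ≤ (A' / θ) ^ M * θ ^ (w₁.length + w₃.length) * θ ^ w₂.length :=
          mul_le_mul hrec hc (hpos _).le (by positivity)
        _ = _ := by ring

variable (R) in
/-- A function of the islands that is multiplied by `f e` along the edge `e`. -/
def IsMultiplicative (f : R.Edge → ℝ) (σ : Λ → ℝ) : Prop :=
  ∀ (γ : Λ) (β : S.children γ), σ β = σ γ * f (R.edge γ β)

/-- The edges leaving the type of an index correspond to the children of this very index, so every
path in the graph is realized by a line of descent. -/
theorem IsPath.exists_desc {α : Λ} {j : S.Types} {w : List R.Edge} (h : R.IsPath (S.type α) j w) :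
    ∃ β ∈ S.desc α w.length, S.type β = j ∧
      (∀ f σ, R.IsMultiplicative f σ → σ β = σ α * (w.map f).prod) ∧
      ∀ w₀, R.IsRootWalk α w₀ → R.IsRootWalk β (w₀ ++ w) := by
  induction w generalizing α with
  | nil => exact ⟨α, by simp, h, by simp, by simp⟩
  | cons e w ih =>
    obtain ⟨h1, h2⟩ := h
    obtain ⟨β, rfl⟩ := exists_edge_eq h1
    rw [edge_final] at h2
    obtain ⟨δ, h3, h4, h5, h6⟩ := ih h2
    refine ⟨δ, mem_desc_succ_left.2 ⟨β, β.2, h3⟩, h4, ?_, ?_⟩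
    · intro f σ hσ
      rw [h5 f σ hσ, hσ]
      simp [mul_assoc]
    · intro w₀ hw₀
      have := h6 _ (hw₀.step β)
      simpa using this

theorem IsRootWalk.isPath {α : Λ} {w : List R.Edge} (h : R.IsRootWalk α w) :
    R.IsPath (S.type S.root) (S.type α) w := by
  induction h with
  | root => rfl
  | step β _ ih => exact isPath_append.2 ⟨_, ih, rfl, edge_final _ _⟩

theorem IsRootWalk.eq_mul {α : Λ} {w : List R.Edge} (h : R.IsRootWalk α w) {f : R.Edge → ℝ}
    {σ : Λ → ℝ} (hσ : R.IsMultiplicative f σ) : σ α = σ S.root * (w.map f).prod := by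
  induction h with
  | root => simp
  | step β _ ih =>
    rw [hσ, ih]
    simp [mul_assoc]

theorem exists_isRootWalk_of_gen {α : Λ} {n : ℕ} (h : α ∈ S.gen n) :
    ∃ w, R.IsRootWalk α w ∧ w.length = n := by
  induction n generalizing α with
  | zero =>
    obtain rfl := mem_desc_zero.1 h
    exact ⟨[], IsRootWalk.root, rfl⟩
  | succ n ih =>
    obtain ⟨β, h1, h2⟩ := mem_gen_succ.1 h
    obtain ⟨w, hw, rfl⟩ := ih h1
    exact ⟨_, hw.step ⟨α, h2⟩, by simp⟩

variable (R) in
theorem exists_isRootWalk (α : Λ) : ∃ w, R.IsRootWalk α w := by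
  obtain ⟨n, hn⟩ := S.exists_gen α
  obtain ⟨w, hw, -⟩ := exists_isRootWalk_of_gen (R := R) hn
  exact ⟨w, hw⟩

variable (R) in
theorem isMultiplicative_diam : R.IsMultiplicative
    (fun e => Metric.diam (S.island e.2) / Metric.diam (S.island (R.rep e.1)))
    (fun α => Metric.diam (S.island α)) := by
  intro γ β
  change _ = Metric.diam (S.island γ) *
    (Metric.diam (S.island (S.childEquiv (R.similar_rep γ) β)) /
      Metric.diam (S.island (R.rep (S.type γ))))
  rw [diam_child, diam_similar (R.similar_rep γ)]
  have h1 := diam_pos (S := S) γ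
  have h2 : (0 : ℝ) < Dilation.ratio (S.φ γ (R.rep (S.type γ))) := Dilation.ratio_pos _
  field_simp

/-- A multiplicative function with weights less than one on cycles decays geometrically with the
generation. -/
theorem IsMultiplicative.exists_decay {f : R.Edge → ℝ} {σ : Λ → ℝ} (hσ : R.IsMultiplicative f σ)
    (h0 : 0 < σ S.root) (hf : ∀ e, 0 < f e)
    (hcyc : ∀ i w, R.IsWalk i i w → (w.map f).prod < 1) :
    ∃ C θ : ℝ, 0 < C ∧ 0 < θ ∧ θ < 1 ∧ ∀ n, ∀ α ∈ S.gen n, σ α ≤ C * θ ^ n := by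
  obtain ⟨C, θ, hC, h1, h2, h3⟩ := Representatives.exists_decay hf hcyc
  refine ⟨σ S.root * C, θ, by positivity, h1, h2, fun n α hα => ?_⟩
  obtain ⟨w, hw, rfl⟩ := exists_isRootWalk_of_gen (R := R) hα
  rw [hw.eq_mul hσ, mul_assoc]
  exact mul_le_mul_of_nonneg_left (h3 _ _ _ hw.isPath) h0.le

/-- A cycle of the graph is realized by a descent from an island to a similar one, where the
diameter strictly decreases by `diam_lt`. -/
theorem exists_diam_decay (R : S.Representatives) : ∃ C θ : ℝ, 0 < C ∧ 0 < θ ∧ θ < 1 ∧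
    ∀ n, ∀ α ∈ S.gen n, Metric.diam (S.island α) ≤ C * θ ^ n := by
  refine (isMultiplicative_diam R).exists_decay (diam_pos _)
    (fun e => div_pos (diam_pos _) (diam_pos _)) ?_
  intro i w hw
  obtain ⟨hne, hp⟩ := isWalk_iff.1 hw
  have hp' : R.IsPath (S.type (R.rep i)) i w := by rwa [R.type_rep]
  obtain ⟨β, h1, h2, h3, -⟩ := hp'.exists_desc
  have h4 := h3 _ _ (isMultiplicative_diam R)
  have hs : S.Similar (R.rep i) β := S.type_eq_iff.1 (by rw [h2, R.type_rep])
  obtain ⟨m, hm⟩ : ∃ m, w.length = m + 1 :=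
    Nat.exists_eq_succ_of_ne_zero (List.length_pos_iff.2 hne).ne'
  rw [hm] at h1
  have h5 := diam_lt (isAncestor_of_desc h1) hs
  have h6 := diam_pos (S := S) (R.rep i)
  by_contra hge
  have := mul_le_mul_of_nonneg_left (not_lt.1 hge) h6.le
  rw [← h4] at this
  linarith

theorem exists_diam_lt (R : S.Representatives) {ε : ℝ} (hε : 0 < ε) :
    ∃ n₀, ∀ n ≥ n₀, ∀ α ∈ S.gen n, Metric.diam (S.island α) < ε := by
  obtain ⟨C, θ, hC, h1, h2, h3⟩ := exists_diam_decay R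
  have hlim : Filter.Tendsto (fun n : ℕ => C * θ ^ n) Filter.atTop (nhds 0) := by
    simpa using (tendsto_pow_atTop_nhds_zero_of_lt_one h1.le h2).const_mul C
  obtain ⟨n₀, hn₀⟩ := Filter.eventually_atTop.1 (hlim.eventually (gt_mem_nhds hε))
  exact ⟨n₀, fun n hn α hα => (h3 n α hα).trans_lt (hn₀ n hn)⟩

end Representatives

end Walks

end FRFT

/-! ### Dirichlet forms on finite sets. -/

section DirichletForm

variable {V : Type*} [Fintype V] {D : Matrix V V ℝ}

theorem dirichletForm_comm (D : Matrix V V ℝ) (u v : V → ℝ) :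
    dirichletForm D u v = dirichletForm D v u := by
  simp only [dirichletForm, mul_right_comm]

theorem dirichletForm_add_left (D : Matrix V V ℝ) (u u' v : V → ℝ) :
    dirichletForm D (fun x => u x + u' x) v = dirichletForm D u v + dirichletForm D u' v := by
  simp only [dirichletForm, ← mul_add, ← Finset.sum_add_distrib]
  congr 1
  refine Finset.sum_congr rfl fun x _ => Finset.sum_congr rfl fun y _ => ?_
  ring

theorem dirichletForm_smul_left (D : Matrix V V ℝ) (c : ℝ) (u v : V → ℝ) :
    dirichletForm D (fun x => c * u x) v = c * dirichletForm D u v := by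
  simp only [dirichletForm, Finset.mul_sum]
  refine Finset.sum_congr rfl fun x _ => Finset.sum_congr rfl fun y _ => ?_
  ring

/-- The Markov property, from nonnegativity of the off-diagonal entries. The diagonal terms vanish
whatever their sign. -/
theorem dirichletForm_contraction (hD : IsLaplacian D) {u w : V → ℝ}
    (h : ∀ x y, |w x - w y| ≤ |u x - u y|) : dirichletForm D w w ≤ dirichletForm D u u := by
  unfold dirichletForm
  refine mul_le_mul_of_nonneg_left ?_ (by norm_num)
  refine Finset.sum_le_sum fun x _ => Finset.sum_le_sum fun y _ => ?_
  rcases eq_or_ne x y with rfl | hne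
  · simp
  · rw [mul_assoc, mul_assoc]
    refine mul_le_mul_of_nonneg_left ?_ (hD.offDiag_nonneg x y hne)
    rw [← sq, ← sq]
    exact sq_le_sq.2 (h x y)

theorem dirichletForm_const {u : V → ℝ} (h : ∀ x y, u x = u y) : dirichletForm D u u = 0 := by
  unfold dirichletForm
  rw [Finset.sum_eq_zero fun x _ => Finset.sum_eq_zero fun y _ => by rw [h x y]; ring, mul_zero]

theorem dirichletForm_nonneg (hD : IsLaplacian D) (u : V → ℝ) : 0 ≤ dirichletForm D u u := by
  have := dirichletForm_contraction hD (u := u) (w := fun _ => 0) (by simp)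
  rwa [dirichletForm_const (by simp)] at this

end DirichletForm

namespace FRFT

/-! ### Weights of islands and the localized energy. -/

section Energy

variable {d : ℕ} {K : Set (Euc d)} {Λ : Type*} {S : FRFT K Λ} {R : S.Representatives}

theorem phi_rep_mem (R : S.Representatives) {γ : Λ} {x : Euc d}
    (hx : x ∈ S.island (R.rep (S.type γ))) : S.φ (R.rep (S.type γ)) γ x ∈ S.island γ :=
  phi_mem (S.similar_symm (R.similar_rep γ)) hx

theorem phi_rep_mem_V (R : S.Representatives) {γ : Λ} {x : Euc d}
    (hx : x ∈ S.V (R.rep (S.type γ))) : S.φ (R.rep (S.type γ)) γ x ∈ S.V γ :=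
  V_map (S.similar_symm (R.similar_rep γ)) hx

/-- The identification of a child with its representative does not depend on whether it passes
through the corresponding child of the representative of α. This turns the recursion over
representatives into one over actual islands. -/
theorem phi_child {α : Λ} (β : S.children α) {x : Euc d}
    (hx : x ∈ S.island (R.rep (S.type β))) :
    S.φ (R.rep (S.type α)) α
      (S.φ (R.rep (S.type β)) (S.childEquiv (R.similar_rep α) β) x) =
      S.φ (R.rep (S.type β)) β x := by
  have h := R.similar_rep α
  have h1 := childEquiv_similar h β
  have h2 := S.similar_symm (R.similar_rep β)
  have h3 : S.φ (R.rep (S.type β)) (S.childEquiv h β) x =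
      S.φ α (R.rep (S.type α)) (S.φ (R.rep (S.type β)) β x) := by
    rw [← childEquiv_phi h β (phi_mem h2 hx), phi_phi h2 h1 hx]
  rw [h3, phi_inv h (island_subset_of_child β.2 (phi_mem h2 hx))]

theorem NetworkData.energy_congr (N : NetworkData R) (n : ℕ) {i : S.Types}
    {u u' v v' : Euc d → ℝ} (hu : Set.EqOn u u' (S.island (R.rep i)))
    (hv : Set.EqOn v v' (S.island (R.rep i))) : N.energy n i u v = N.energy n i u' v' := by
  induction n generalizing i u u' v v' with
  | zero =>
    have h1 : (fun x : S.V (R.rep i) => u x) = fun x : S.V (R.rep i) => u' x :=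
      funext fun x => hu (V_subset _ x.2)
    have h2 : (fun x : S.V (R.rep i) => v x) = fun x : S.V (R.rep i) => v' x :=
      funext fun x => hv (V_subset _ x.2)
    simp only [energy, h1, h2]
  | succ n ih =>
    refine Finset.sum_congr rfl fun β _ => ?_
    rw [ih]
    · exact fun x hx => hu (island_subset_of_child β.2 (phi_rep_mem R hx))
    · exact fun x hx => hv (island_subset_of_child β.2 (phi_rep_mem R hx))

/-- The weights of the islands in a harmonic structure: the products of the factors along the walks
from the root. -/
structure Weight (H : HarmonicStructure R) where
  ρ : Λ → ℝ
  mult : R.IsMultiplicative H.r ρ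
  root_eq : ρ S.root = 1

namespace Weight

variable {H : HarmonicStructure R} (W : Weight H)

theorem pos (α : Λ) : 0 < W.ρ α := by
  obtain ⟨w, hw⟩ := R.exists_isRootWalk α
  rw [hw.eq_mul W.mult, W.root_eq, one_mul]
  exact List.prod_pos (by simpa using fun e _ => H.r_pos e)

/-- The energy of the boundary values on one island. -/
noncomputable def cell (γ : Λ) (u v : Euc d → ℝ) : ℝ :=
  (W.ρ γ)⁻¹ * H.energy 0 (S.type γ) (u ∘ S.φ (R.rep (S.type γ)) γ) (v ∘ S.φ (R.rep (S.type γ)) γ)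

/-- Unrolling the recursion replaces the forms on representatives by sums of cell energies over
actual offspring. The factors along the walk combine to a quotient of weights. -/
theorem energy_eq (n : ℕ) (α : Λ) (u v : Euc d → ℝ) :
    H.energy n (S.type α) (u ∘ S.φ (R.rep (S.type α)) α) (v ∘ S.φ (R.rep (S.type α)) α) =
      W.ρ α * ∑ γ ∈ S.desc α n, W.cell γ u v := by
  induction n generalizing α with
  | zero =>
    have := (W.pos α).ne'
    simp only [desc, Finset.sum_singleton, cell]
    field_simp
  | succ n ih =>
    rw [sum_desc_succ_left, NetworkData.energy, Finset.mul_sum,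
      ← Finset.sum_coe_sort (S.children α),
      ← Equiv.sum_comp (S.childEquiv (R.similar_rep α))]
    refine Finset.sum_congr rfl fun β _ => ?_
    have ht : S.type (S.childEquiv (R.similar_rep α) β) = S.type β :=
      (S.type_eq_iff.2 (childEquiv_similar (R.similar_rep α) β)).symm
    have hw : W.ρ β = W.ρ α * H.r ⟨S.type α, S.childEquiv (R.similar_rep α) β⟩ := W.mult α β
    have h0 := H.r_pos ⟨S.type α, S.childEquiv (R.similar_rep α) β⟩
    rw [ht, H.energy_congr n (u' := u ∘ S.φ (R.rep (S.type β)) β)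
      (v' := v ∘ S.φ (R.rep (S.type β)) β), ih β, hw]
    · field_simp
    · exact fun x hx => congrArg u (phi_child β hx)
    · exact fun x hx => congrArg v (phi_child β hx)

theorem cell_congr {γ : Λ} {u u' v v' : Euc d → ℝ} (hu : Set.EqOn u u' (S.V γ))
    (hv : Set.EqOn v v' (S.V γ)) : W.cell γ u v = W.cell γ u' v' := by
  have h1 : (fun x : S.V (R.rep (S.type γ)) => (u ∘ S.φ (R.rep (S.type γ)) γ) x) =
      fun x : S.V (R.rep (S.type γ)) => (u' ∘ S.φ (R.rep (S.type γ)) γ) x :=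
    funext fun x => hu (phi_rep_mem_V R x.2)
  have h2 : (fun x : S.V (R.rep (S.type γ)) => (v ∘ S.φ (R.rep (S.type γ)) γ) x) =
      fun x : S.V (R.rep (S.type γ)) => (v' ∘ S.φ (R.rep (S.type γ)) γ) x :=
    funext fun x => hv (phi_rep_mem_V R x.2)
  simp only [cell, NetworkData.energy, h1, h2]

theorem cell_comm (γ : Λ) (u v : Euc d → ℝ) : W.cell γ u v = W.cell γ v u := by
  simp only [cell, NetworkData.energy]
  rw [dirichletForm_comm]

theorem cell_add_left (γ : Λ) (u u' v : Euc d → ℝ) :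
    W.cell γ (u + u') v = W.cell γ u v + W.cell γ u' v := by
  simp only [cell, NetworkData.energy, Function.comp_apply, Pi.add_apply]
  rw [dirichletForm_add_left, mul_add]

theorem cell_smul_left (γ : Λ) (c : ℝ) (u v : Euc d → ℝ) :
    W.cell γ (c • u) v = c * W.cell γ u v := by
  simp only [cell, NetworkData.energy, Function.comp_apply, Pi.smul_apply, smul_eq_mul]
  rw [dirichletForm_smul_left]
  ring

theorem cell_contraction {γ : Λ} {u w : Euc d → ℝ}
    (h : ∀ x ∈ S.V γ, ∀ y ∈ S.V γ, |w x - w y| ≤ |u x - u y|) : W.cell γ w w ≤ W.cell γ u u :=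
  mul_le_mul_of_nonneg_left (dirichletForm_contraction (H.isLaplacian _) fun x y =>
    h _ (phi_rep_mem_V R x.2) _ (phi_rep_mem_V R y.2)) (inv_nonneg.2 (W.pos γ).le)

theorem cell_eq_zero {γ : Λ} {u : Euc d → ℝ} (h : ∀ x ∈ S.V γ, ∀ y ∈ S.V γ, u x = u y) :
    W.cell γ u u = 0 := by
  exact mul_eq_zero_of_right _
    (dirichletForm_const fun x y => h _ (phi_rep_mem_V R x.2) _ (phi_rep_mem_V R y.2))

theorem cell_nonneg (γ : Λ) (u : Euc d → ℝ) : 0 ≤ W.cell γ u u :=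
  mul_nonneg (inv_nonneg.2 (W.pos γ).le) (dirichletForm_nonneg (H.isLaplacian _) _)

/-- In the renormalization equation the function itself competes in the minimum. This is what makes
discrete energies increase with the generation. -/
theorem cell_le_children (γ : Λ) (u : Euc d → ℝ) :
    W.cell γ u u ≤ ∑ δ ∈ S.children γ, W.cell δ u u := by
  have h0 := W.energy_eq 0 γ u u
  have h1 := W.energy_eq 1 γ u u
  have h2 : H.energy 0 (S.type γ) (u ∘ S.φ (R.rep (S.type γ)) γ) (u ∘ S.φ (R.rep (S.type γ)) γ) ≤
      H.energy 1 (S.type γ) (u ∘ S.φ (R.rep (S.type γ)) γ) (u ∘ S.φ (R.rep (S.type γ)) γ) :=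
    (H.renormalization (S.type γ) fun x => (u ∘ S.φ (R.rep (S.type γ)) γ) x).2
      ⟨_, fun _ => rfl, rfl⟩
  rw [h0, h1, sum_desc_succ_left] at h2
  simpa [desc] using le_of_mul_le_mul_left h2 (W.pos γ)

theorem cell_le_desc (γ : Λ) (n : ℕ) (u : Euc d → ℝ) :
    W.cell γ u u ≤ ∑ δ ∈ S.desc γ n, W.cell δ u u := by
  induction n with
  | zero => simp [desc]
  | succ n ih =>
    rw [sum_desc_succ]
    exact ih.trans (Finset.sum_le_sum fun δ _ => W.cell_le_children δ u)

theorem tendsto_cell {ι : Type*} {l : Filter ι} {γ : Λ} {u : ι → Euc d → ℝ} {u₀ : Euc d → ℝ}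
    (h : ∀ x ∈ S.V γ, Filter.Tendsto (fun i => u i x) l (nhds (u₀ x))) :
    Filter.Tendsto (fun i => W.cell γ (u i) (u i)) l (nhds (W.cell γ u₀ u₀)) := by
  simp only [cell, NetworkData.energy, dirichletForm, Function.comp_apply]
  refine Filter.Tendsto.const_mul _ (Filter.Tendsto.const_mul _ ?_)
  refine tendsto_finsetSum _ fun x _ => tendsto_finsetSum _ fun y _ => ?_
  have h1 := h _ (phi_rep_mem_V R x.2)
  have h2 := h _ (phi_rep_mem_V R y.2)
  exact ((h1.sub h2).const_mul _).mul (h1.sub h2)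

open scoped Classical in
/-- The discrete energy of generation `n` in `A`. -/
noncomputable def disc (n : ℕ) (A : Set (Euc d)) (u v : Euc d → ℝ) : ℝ :=
  ∑ γ ∈ S.gen n, if S.island γ ⊆ A then W.cell γ u v else 0

theorem disc_comm (n : ℕ) (A : Set (Euc d)) (u v : Euc d → ℝ) :
    W.disc n A u v = W.disc n A v u := by
  simp only [disc, W.cell_comm _ u v]

theorem disc_add_left (n : ℕ) (A : Set (Euc d)) (u u' v : Euc d → ℝ) :
    W.disc n A (u + u') v = W.disc n A u v + W.disc n A u' v := by
  simp only [disc, ← Finset.sum_add_distrib]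
  refine Finset.sum_congr rfl fun γ _ => ?_
  split_ifs
  · exact W.cell_add_left _ _ _ _
  · simp

theorem disc_smul_left (n : ℕ) (A : Set (Euc d)) (c : ℝ) (u v : Euc d → ℝ) :
    W.disc n A (c • u) v = c * W.disc n A u v := by
  simp only [disc, Finset.mul_sum]
  refine Finset.sum_congr rfl fun γ _ => ?_
  split_ifs
  · exact W.cell_smul_left _ _ _ _
  · simp

theorem disc_congr {n : ℕ} {A : Set (Euc d)} {u u' v v' : Euc d → ℝ} (hu : Set.EqOn u u' A)
    (hv : Set.EqOn v v' A) : W.disc n A u v = W.disc n A u' v' := by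
  refine Finset.sum_congr rfl fun γ _ => ?_
  split_ifs with h
  · exact W.cell_congr (hu.mono ((V_subset γ).trans h)) (hv.mono ((V_subset γ).trans h))
  · rfl

theorem disc_nonneg (n : ℕ) (A : Set (Euc d)) (u : Euc d → ℝ) : 0 ≤ W.disc n A u u := by
  refine Finset.sum_nonneg fun γ _ => ?_
  split_ifs
  · exact W.cell_nonneg _ _
  · exact le_rfl

theorem disc_contraction {n : ℕ} {A : Set (Euc d)} {u w : Euc d → ℝ}
    (h : ∀ x ∈ A, ∀ y ∈ A, |w x - w y| ≤ |u x - u y|) : W.disc n A w w ≤ W.disc n A u u := by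
  refine Finset.sum_le_sum fun γ _ => ?_
  split_ifs with hA
  · exact W.cell_contraction fun x hx y hy =>
      h x (hA (V_subset γ hx)) y (hA (V_subset γ hy))
  · exact le_rfl

theorem disc_mono_set {n : ℕ} {A B : Set (Euc d)} (h : A ⊆ B) (u : Euc d → ℝ) :
    W.disc n A u u ≤ W.disc n B u u := by
  refine Finset.sum_le_sum fun γ _ => ?_
  split_ifs with hA hB
  · exact le_rfl
  · exact absurd (hA.trans h) hB
  · exact W.cell_nonneg _ _
  · exact le_rfl

theorem disc_le_succ (n : ℕ) (A : Set (Euc d)) (u : Euc d → ℝ) :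
    W.disc n A u u ≤ W.disc (n + 1) A u u := by
  classical
  unfold disc gen
  rw [sum_desc_succ]
  refine Finset.sum_le_sum fun γ _ => ?_
  split_ifs with hA
  · refine (W.cell_le_children γ u).trans (le_of_eq (Finset.sum_congr rfl fun δ hδ => ?_))
    rw [if_pos ((island_subset_of_child hδ).trans hA)]
  · refine Finset.sum_nonneg fun δ _ => ?_
    split_ifs
    · exact W.cell_nonneg _ _
    · exact le_rfl

theorem disc_mono (A : Set (Euc d)) (u : Euc d → ℝ) : Monotone fun n => W.disc n A u u :=
  monotone_nat_of_le_succ fun n => W.disc_le_succ n A u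

theorem tendsto_disc {ι : Type*} {l : Filter ι} {n : ℕ} {A : Set (Euc d)} {u : ι → Euc d → ℝ}
    {u₀ : Euc d → ℝ} (h : ∀ x ∈ A, Filter.Tendsto (fun i => u i x) l (nhds (u₀ x))) :
    Filter.Tendsto (fun i => W.disc n A (u i) (u i)) l (nhds (W.disc n A u₀ u₀)) := by
  refine tendsto_finsetSum _ fun γ _ => ?_
  split_ifs with hA
  · exact W.tendsto_cell fun x hx => h x (hA (V_subset γ hx))
  · exact tendsto_const_nhds

/-- The energy of `u` in `A`, the limit of the discrete energies. -/
noncomputable def m (u : Euc d → ℝ) (A : Set (Euc d)) : ENNReal :=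
  ⨆ n, ENNReal.ofReal (W.disc n A u u)

theorem le_m (n : ℕ) (u : Euc d → ℝ) (A : Set (Euc d)) :
    ENNReal.ofReal (W.disc n A u u) ≤ W.m u A :=
  le_iSup (fun n => ENNReal.ofReal (W.disc n A u u)) n

theorem ofReal_disc_mono (u : Euc d → ℝ) (A : Set (Euc d)) :
    Monotone fun n => ENNReal.ofReal (W.disc n A u u) :=
  fun _ _ h => ENNReal.ofReal_le_ofReal (W.disc_mono A u h)

theorem m_mono_set {A B : Set (Euc d)} (h : A ⊆ B) (u : Euc d → ℝ) : W.m u A ≤ W.m u B :=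
  iSup_mono fun _ => ENNReal.ofReal_le_ofReal (W.disc_mono_set h u)

theorem m_congr {A : Set (Euc d)} {u u' : Euc d → ℝ} (h : Set.EqOn u u' A) :
    W.m u A = W.m u' A :=
  iSup_congr fun _ => by rw [W.disc_congr h h]

theorem m_contraction {A : Set (Euc d)} {u w : Euc d → ℝ}
    (h : ∀ x ∈ A, ∀ y ∈ A, |w x - w y| ≤ |u x - u y|) : W.m w A ≤ W.m u A :=
  iSup_mono fun _ => ENNReal.ofReal_le_ofReal (W.disc_contraction h)

theorem m_eq_zero {A : Set (Euc d)} {u : Euc d → ℝ} (h : ∀ x ∈ A, ∀ y ∈ A, u x = u y) :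
    W.m u A = 0 := by
  refine le_antisymm (iSup_le fun n => ?_) zero_le
  have : W.disc n A u u = 0 := by
    refine Finset.sum_eq_zero fun γ _ => ?_
    split_ifs with hA
    · exact W.cell_eq_zero fun x hx y hy => h x (hA (V_subset γ hx)) y (hA (V_subset γ hy))
    · rfl
  rw [this, ENNReal.ofReal_zero]

theorem m_le_of_tendsto {ι : Type*} {l : Filter ι} [l.NeBot] {A : Set (Euc d)} {u : ι → Euc d → ℝ}
    {u₀ : Euc d → ℝ} (h : ∀ x ∈ A, Filter.Tendsto (fun i => u i x) l (nhds (u₀ x))) {c : ENNReal}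
    (hc : ∀ n, ∀ᶠ i in l, ENNReal.ofReal (W.disc n A (u i) (u i)) ≤ c) : W.m u₀ A ≤ c :=
  iSup_le fun n => le_of_tendsto (ENNReal.tendsto_ofReal (W.tendsto_disc h)) (hc n)

/-- An island of generation n + k contained in K_α descends from α: otherwise it would lie in the
finite intersection of K_α with another island of generation n. -/
theorem disc_eq_of_gen {α : Λ} {n : ℕ} (hα : α ∈ S.gen n) (k : ℕ) (u v : Euc d → ℝ) :
    W.disc (n + k) (S.island α) u v = ∑ γ ∈ S.desc α k, W.cell γ u v := by
  classical
  unfold disc gen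
  have hα' : α ∈ S.desc S.root n := hα
  rw [sum_desc_add, Finset.sum_eq_single_of_mem α hα']
  · exact Finset.sum_congr rfl fun γ hγ => if_pos (island_subset_of_desc hγ)
  · intro β hβ hne
    refine Finset.sum_eq_zero fun γ hγ => if_neg fun hsub => ?_
    exact S.island_infinite γ ((finite_inter_of_desc hβ hα hne).subset
      (Set.subset_inter (island_subset_of_desc hγ) hsub))

theorem m_island (α : Λ) (u : Euc d → ℝ) :
    W.m u (S.island α) = ⨆ k, ENNReal.ofReal (∑ γ ∈ S.desc α k, W.cell γ u u) := by
  obtain ⟨n, hn⟩ := S.exists_gen α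
  rw [m, ← (W.ofReal_disc_mono u (S.island α)).iSup_nat_add n]
  refine iSup_congr fun k => ?_
  rw [add_comm, W.disc_eq_of_gen hn]

/-- Both sides are limits of the energies of the same function on the common representative. -/
theorem m_similar {α β : Λ} (h : S.Similar α β) (u : Euc d → ℝ) :
    ENNReal.ofReal (W.ρ α) * W.m (u ∘ S.φ α β) (S.island α) =
      ENNReal.ofReal (W.ρ β) * W.m u (S.island β) := by
  rw [m_island, m_island, ENNReal.mul_iSup, ENNReal.mul_iSup]
  refine iSup_congr fun k => ?_
  rw [← ENNReal.ofReal_mul (W.pos α).le, ← ENNReal.ofReal_mul (W.pos β).le, ← energy_eq,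
    ← energy_eq]
  have ht : S.type α = S.type β := S.type_eq_iff.2 h
  rw [ht]
  congr 1
  have hs : S.Similar (R.rep (S.type β)) α := by
    rw [← ht]; exact S.similar_symm (R.similar_rep α)
  have : Set.EqOn ((u ∘ S.φ α β) ∘ S.φ (R.rep (S.type β)) α) (u ∘ S.φ (R.rep (S.type β)) β)
      (S.island (R.rep (S.type β))) := fun x hx => congrArg u (phi_phi hs h hx)
  exact H.energy_congr k this this

theorem levelForm_eq (n : ℕ) (u v : C(K, ℝ)) :
    H.levelForm n u v =
      W.disc n K (Function.extend Subtype.val u 0) (Function.extend Subtype.val v 0) := by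
  have h0 := W.disc_eq_of_gen (α := S.root) (n := 0) (by simp [gen]) n
    (Function.extend Subtype.val u 0) (Function.extend Subtype.val v 0)
  rw [zero_add, S.island_root] at h0
  have h1 := W.energy_eq n S.root (Function.extend Subtype.val u 0)
    (Function.extend Subtype.val v 0)
  rw [W.root_eq, one_mul] at h1
  rw [h0, ← h1]
  have : Set.EqOn (S.φ (R.rep (S.type S.root)) S.root) id (S.island (R.rep (S.type S.root))) := by
    rw [R.rep_root]; exact S.φ_self _
  exact H.energy_congr n (fun x hx => congrArg _ (this hx).symm)
    fun x hx => congrArg _ (this hx).symm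

/-- An island, being infinite, lies in at most one of the sets, so no cell is counted twice. -/
theorem sum_m_le {ι : Type*} (s : Finset ι) {A : ι → Set (Euc d)} {B : Set (Euc d)}
    (hA : ∀ i ∈ s, ∀ j ∈ s, i ≠ j → (A i ∩ A j).Finite) (hB : ∀ i ∈ s, A i ⊆ B) (u : Euc d → ℝ) :
    ∑ i ∈ s, W.m u (A i) ≤ W.m u B := by
  classical
  unfold m
  rw [ENNReal.finsetSum_iSup_of_monotone fun i => W.ofReal_disc_mono u (A i)]
  refine iSup_mono fun n => ?_
  rw [← ENNReal.ofReal_sum_of_nonneg fun i _ => W.disc_nonneg n (A i) u]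
  refine ENNReal.ofReal_le_ofReal ?_
  unfold disc
  rw [Finset.sum_comm]
  refine Finset.sum_le_sum fun γ _ => ?_
  by_cases h : ∃ i ∈ s, S.island γ ⊆ A i
  · obtain ⟨i, hi, hsub⟩ := h
    rw [if_pos (hsub.trans (hB i hi)), Finset.sum_eq_single_of_mem i hi, if_pos hsub]
    intro j hj hne
    exact if_neg fun hsub' => S.island_infinite γ ((hA j hj i hi hne).subset
      (Set.subset_inter hsub' hsub))
  · push Not at h
    rw [Finset.sum_eq_zero fun i hi => if_neg (h i hi)]
    split_ifs
    · exact W.cell_nonneg _ _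
    · exact le_rfl

theorem tsum_m_le {ι : Type*} {A : ι → Set (Euc d)} {B : Set (Euc d)}
    (hA : ∀ i j, i ≠ j → (A i ∩ A j).Finite) (hB : ∀ i, A i ⊆ B) (u : Euc d → ℝ) :
    ∑' i, W.m u (A i) ≤ W.m u B := by
  rw [ENNReal.tsum_eq_iSup_sum]
  exact iSup_le fun s => W.sum_m_le s (fun i _ j _ => hA i j) (fun i _ => hB i) u

end Weight

end Energy

end FRFT

/-! ### Countable subadditivity of the energy. -/

open MeasureTheory in
/-- A contraction of the line close to the identity which is locally constant near the points of a
countable set. -/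
theorem exists_flattening {A : Set ℝ} (hA : A.Countable) {ε : ℝ} (hε : 0 < ε) :
    ∃ f : ℝ → ℝ, (∀ s t, |f s - f t| ≤ |s - t|) ∧ (∀ t, |f t - t| ≤ ε) ∧
      ∀ a ∈ A, ∃ δ > 0, ∀ t, |t - a| < δ → f t = f a := by
  obtain ⟨U, hAU, hU, hvol⟩ := A.exists_isOpen_lt_of_lt (μ := volume) (ENNReal.ofReal ε) (by
    rw [hA.measure_zero]; exact ENNReal.ofReal_pos.2 hε)
  have hUfin : volume U ≠ ⊤ := (hvol.trans ENNReal.ofReal_lt_top).ne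
  have hle : ∀ B : Set ℝ, B ⊆ U → volume.real B ≤ ε := fun B hB =>
    ENNReal.toReal_le_of_le_ofReal hε.le ((measure_mono hB).trans hvol.le)
  -- the length of `U` in an interval
  set F : ℝ → ℝ := fun t => volume.real (U ∩ Set.Ioc 0 t) - volume.real (U ∩ Set.Ioc t 0) with hF
  have hadd : ∀ s t, s ≤ t → F t - F s = volume.real (U ∩ Set.Ioc s t) := by
    intro s t hst
    have hfin : ∀ a b, volume (U ∩ Set.Ioc a b) ≠ ⊤ := fun a b =>
      ne_top_of_le_ne_top hUfin (measure_mono Set.inter_subset_left)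
    have hsplit : ∀ a b c, a ≤ b → b ≤ c → volume.real (U ∩ Set.Ioc a c) =
        volume.real (U ∩ Set.Ioc a b) + volume.real (U ∩ Set.Ioc b c) := by
      intro a b c hab hbc
      rw [← measureReal_union _ (hU.measurableSet.inter measurableSet_Ioc) (hfin _ _) (hfin _ _),
        ← Set.inter_union_distrib_left, Set.Ioc_union_Ioc_eq_Ioc hab hbc]
      exact (Set.Ioc_disjoint_Ioc_of_le le_rfl).mono Set.inter_subset_right Set.inter_subset_right
    have hempty : ∀ a b, b ≤ a → volume.real (U ∩ Set.Ioc a b) = 0 := fun a b h => by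
      rw [Set.Ioc_eq_empty (not_lt.2 h)]; simp
    simp only [hF]
    rcases le_total 0 s with h0 | h0
    · rw [hempty t 0 (h0.trans hst), hempty s 0 h0, hsplit 0 s t h0 hst]; ring
    · rcases le_total 0 t with h1 | h1
      · rw [hempty t 0 h1, hempty 0 s h0, hsplit s 0 t h0 h1]; ring
      · rw [hempty 0 t h1, hempty 0 s h0, hsplit s t 0 hst h1]; ring
  have hbd : ∀ s t, s ≤ t → 0 ≤ F t - F s ∧ F t - F s ≤ t - s := by
    intro s t hst
    rw [hadd s t hst]
    refine ⟨measureReal_nonneg, ?_⟩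
    calc volume.real (U ∩ Set.Ioc s t) ≤ volume.real (Set.Ioc s t) :=
          measureReal_mono Set.inter_subset_right (by simp)
      _ = t - s := by simp [hst]
  refine ⟨fun t => t - F t, ?_, ?_, ?_⟩
  · intro s t
    wlog hst : s ≤ t generalizing s t
    · rw [abs_sub_comm, abs_sub_comm s t]; exact this t s (not_le.1 hst).le
    obtain ⟨h1, h2⟩ := hbd s t hst
    rw [abs_of_nonpos (by linarith), abs_of_nonpos (by linarith)]
    linarith
  · intro t
    rw [sub_sub_cancel_left, abs_neg]
    have h1 : 0 ≤ volume.real (U ∩ Set.Ioc 0 t) := measureReal_nonneg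
    have h2 : 0 ≤ volume.real (U ∩ Set.Ioc t 0) := measureReal_nonneg
    have h3 := hle (U ∩ Set.Ioc 0 t) Set.inter_subset_left
    have h4 := hle (U ∩ Set.Ioc t 0) Set.inter_subset_left
    rw [abs_le]
    constructor <;> simp only [hF] <;> linarith
  · intro a ha
    obtain ⟨δ, hδ, hball⟩ := Metric.isOpen_iff.1 hU a (hAU ha)
    refine ⟨δ, hδ, ?_⟩
    have key : ∀ s t, s ≤ t → |s - a| < δ → |t - a| < δ → s - F s = t - F t := by
      intro s t hst hs ht
      have h1 := hadd s t hst
      rw [Set.inter_eq_right.2, Real.volume_real_Ioc_of_le hst] at h1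
      · linarith
      · intro x hx
        refine hball (Metric.mem_ball.2 ?_)
        rw [Real.dist_eq]
        rw [abs_lt] at hs ht ⊢
        constructor <;> linarith [hx.1, hx.2]
    intro t ht
    rcases le_total t a with h | h
    · exact key t a h ht (by simpa)
    · exact (key a t h (by simpa) ht).symm

namespace FRFT

section Covering

variable {d : ℕ} {K : Set (Euc d)} {Λ : Type*} {S : FRFT K Λ} {R : S.Representatives}
  {H : HarmonicStructure R} (W : Weight H)

namespace Weight

/-- The energy is countably subadditive for relatively open sets, and countable sets carry no
energy. -/
theorem m_le_tsum {ι : Type*} {B N : Set (Euc d)} {A : ι → Set (Euc d)} (hN : N.Countable)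
    (hA : ∀ i, ∃ U, IsOpen U ∧ A i = U ∩ K) (hB : B ⊆ N ∪ ⋃ i, A i) {u : Euc d → ℝ}
    (hu : ContinuousOn u B) : W.m u B ≤ ∑' i, W.m u (A i) := by
  classical
  refine iSup_le fun n₀ => ?_
  choose U hU hAU using hA
  set B₀ : Set (Euc d) := ⋃ γ ∈ {γ | γ ∈ S.gen n₀ ∧ S.island γ ⊆ B}, S.island γ with hB₀
  have hfin : {γ | γ ∈ S.gen n₀ ∧ S.island γ ⊆ B}.Finite :=
    (S.gen n₀).finite_toSet.subset fun _ h => h.1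
  have hB₀c : IsCompact B₀ := hfin.isCompact_biUnion fun γ _ => S.island_compact γ
  have hB₀B : B₀ ⊆ B := Set.iUnion₂_subset fun γ h => h.2
  -- If f ∘ u is locally constant near the points of `N`, then every sufficiently small island in
  -- the compact set `B₀` lies in some `A i` or carries no energy of f ∘ u.
  have key : ∀ f : ℝ → ℝ, (∀ s t, |f s - f t| ≤ |s - t|) →
      (∀ x ∈ N, ∃ δ > 0, ∀ t, |t - u x| < δ → f t = f (u x)) →
      ENNReal.ofReal (W.disc n₀ B (f ∘ u) (f ∘ u)) ≤ ∑' i, W.m u (A i) := by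
    intro f hf hloc
    have hU' : ∀ x, ∃ O, IsOpen O ∧ ((x ∈ N ∧ x ∈ B) → x ∈ O ∧ ∀ y ∈ O ∩ B, f (u y) = f (u x)) := by
      intro x
      by_cases hx : x ∈ N ∧ x ∈ B
      · obtain ⟨δ, hδ, h⟩ := hloc x hx.1
        have := hu x hx.2
        have h1 : ∀ᶠ y in nhdsWithin x B, |u y - u x| < δ := by
          have := this.eventually (Metric.ball_mem_nhds (u x) hδ)
          simpa [Metric.mem_ball, Real.dist_eq] using this
        obtain ⟨O, hO, hxO, hsub⟩ := mem_nhdsWithin.1 h1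
        exact ⟨O, hO, fun _ => ⟨hxO, fun y hy => h _ (hsub hy)⟩⟩
      · exact ⟨∅, isOpen_empty, fun h => absurd h hx⟩
    choose O hO hO' using hU'
    -- The Lebesgue number of the cover by the sets `U i` and by the neighbourhoods where f ∘ u is
    -- constant decides which islands count as small.
    obtain ⟨δ, hδ, hleb⟩ := lebesgue_number_lemma_of_metric (ι := ι ⊕ {x // x ∈ N ∧ x ∈ B})
      (c := Sum.elim U fun x => O x) hB₀c
      (by rintro (i | x); exacts [hU i, hO x])
      (by
        intro x hx
        rcases hB (hB₀B hx) with hx' | hx'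
        · exact Set.mem_iUnion.2 ⟨Sum.inr ⟨x, hx', hB₀B hx⟩, (hO' x ⟨hx', hB₀B hx⟩).1⟩
        · obtain ⟨i, hi⟩ := Set.mem_iUnion.1 hx'
          rw [hAU] at hi
          exact Set.mem_iUnion.2 ⟨Sum.inl i, hi.1⟩)
    obtain ⟨n₁, hn₁⟩ := Representatives.exists_diam_lt R hδ
    set n := n₀ + n₁
    have hdisc : W.disc n₀ B (f ∘ u) (f ∘ u) ≤ W.disc n B₀ (f ∘ u) (f ∘ u) := by
      have : W.disc n₀ B (f ∘ u) (f ∘ u) = W.disc n₀ B₀ (f ∘ u) (f ∘ u) := by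
        refine Finset.sum_congr rfl fun γ hγ => ?_
        by_cases h : S.island γ ⊆ B
        · rw [if_pos h, if_pos]
          exact Set.subset_biUnion_of_mem (u := fun γ => S.island γ)
            (show γ ∈ {γ | γ ∈ S.gen n₀ ∧ S.island γ ⊆ B} from ⟨hγ, h⟩)
        · rw [if_neg h, if_neg fun h' => h (h'.trans hB₀B)]
      rw [this]
      exact W.disc_mono _ _ (Nat.le_add_right n₀ n₁)
    refine (ENNReal.ofReal_le_ofReal hdisc).trans ?_
    have hterm : ∀ γ ∈ S.gen n, ENNReal.ofReal
        (if S.island γ ⊆ B₀ then W.cell γ (f ∘ u) (f ∘ u) else 0) ≤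
        ∑' i, ENNReal.ofReal (if S.island γ ⊆ A i then W.cell γ (f ∘ u) (f ∘ u) else 0) := by
      intro γ hγ
      by_cases h : S.island γ ⊆ B₀
      swap
      · rw [if_neg h]; simp
      rw [if_pos h]
      obtain ⟨x, hx⟩ := (S.island_nontrivial γ).nonempty
      obtain ⟨c, hc⟩ := hleb x (h hx)
      have hball : S.island γ ⊆ Metric.ball x δ := fun y hy =>
        (Metric.dist_le_diam_of_mem (S.island_compact γ).isBounded hy hx).trans_lt
          (hn₁ n (Nat.le_add_left _ _) γ hγ)
      rcases c with i | z
      · have hsub : S.island γ ⊆ A i := by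
          rw [hAU]
          exact Set.subset_inter (hball.trans hc) (S.island_subset γ)
        refine le_trans ?_ (ENNReal.le_tsum i)
        rw [if_pos hsub]
      · have hz := (hO' z z.2).2
        have hconst : ∀ y ∈ S.island γ, f (u y) = f (u z) := fun y hy =>
          hz y ⟨hc (hball hy), hB₀B (h hy)⟩
        rw [W.cell_eq_zero fun y hy y' hy' => by
          rw [Function.comp_apply, Function.comp_apply, hconst y (V_subset γ hy),
            hconst y' (V_subset γ hy')]]
        simp
    have hnn : ∀ (C : Set (Euc d)), ∀ γ ∈ S.gen n,
        0 ≤ if S.island γ ⊆ C then W.cell γ (f ∘ u) (f ∘ u) else 0 := by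
      intro C γ _
      split_ifs
      · exact W.cell_nonneg _ _
      · exact le_rfl
    unfold disc
    rw [ENNReal.ofReal_sum_of_nonneg (hnn B₀)]
    refine (Finset.sum_le_sum hterm).trans ?_
    rw [← Summable.tsum_finsetSum fun _ _ => ENNReal.summable]
    refine ENNReal.tsum_le_tsum fun i => ?_
    rw [← ENNReal.ofReal_sum_of_nonneg (hnn (A i))]
    exact (W.le_m n (f ∘ u) (A i)).trans (W.m_contraction fun x _ y _ => hf _ _)
  -- The image of `N` under `u` is a countable set of reals, so flattenings converging to the
  -- identity exist. A discrete energy is continuous under pointwise convergence, so the bound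
  -- passes to `u`.
  have hex : ∀ k : ℕ, ∃ f : ℝ → ℝ, (∀ s t, |f s - f t| ≤ |s - t|) ∧
      (∀ t, |f t - t| ≤ 1 / ((k : ℝ) + 1)) ∧
      ∀ a ∈ u '' N, ∃ δ > 0, ∀ t, |t - a| < δ → f t = f a :=
    fun k => exists_flattening (hN.image u) (by positivity)
  choose f hf1 hf2 hf3 using hex
  have hlim : ∀ x ∈ B, Filter.Tendsto (fun k => (f k ∘ u) x) Filter.atTop (nhds (u x)) := by
    intro x _
    rw [tendsto_iff_dist_tendsto_zero]
    exact squeeze_zero (fun _ => dist_nonneg) (fun k => hf2 k (u x))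
      tendsto_one_div_add_atTop_nhds_zero_nat
  exact le_of_tendsto' (ENNReal.tendsto_ofReal (W.tendsto_disc hlim)) fun k =>
    key (f k) (hf1 k) fun x hx => hf3 k _ ⟨x, hx, rfl⟩

theorem m_le_sum {ι : Type*} (s : Finset ι) {B N : Set (Euc d)} {A : ι → Set (Euc d)}
    (hN : N.Countable) (hA : ∀ i, ∃ U, IsOpen U ∧ A i = U ∩ K) (hB : B ⊆ N ∪ ⋃ i ∈ s, A i)
    {u : Euc d → ℝ} (hu : ContinuousOn u B) : W.m u B ≤ ∑ i ∈ s, W.m u (A i) := by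
  rw [← Finset.sum_coe_sort s]
  refine (W.m_le_tsum hN (A := fun i : s => A i) (fun i => hA i) ?_ hu).trans
    (tsum_fintype _).le
  simpa [Set.iUnion_subtype] using hB

end Weight

end Covering

end FRFT

/-! ### Differences of values are controlled by the Dirichlet form. -/

section Laplacian

variable {V : Type*} [Fintype V] {D : Matrix V V ℝ}

theorem dirichletForm_eq_neg (hs : D.IsSymm) (hrow : ∀ x, ∑ y, D x y = 0) (u v : V → ℝ) :
    dirichletForm D u v = -(u ⬝ᵥ D.mulVec v) := by
  have hcol : ∀ y, ∑ x, D x y = 0 := fun y => by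
    rw [← hrow y]
    exact Finset.sum_congr rfl fun x _ => hs.apply y x
  have h1 : ∑ x, ∑ y, D x y * (u x * v x) = 0 :=
    Finset.sum_eq_zero fun x _ => by rw [← Finset.sum_mul, hrow, zero_mul]
  have h2 : ∑ x, ∑ y, D x y * (u y * v y) = 0 := by
    rw [Finset.sum_comm]
    exact Finset.sum_eq_zero fun x _ => by rw [← Finset.sum_mul, hcol, zero_mul]
  have h3 : ∑ x, ∑ y, D x y * (u x * v y) = u ⬝ᵥ D.mulVec v := by
    simp only [dotProduct, Matrix.mulVec, Finset.mul_sum]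
    exact Finset.sum_congr rfl fun x _ => Finset.sum_congr rfl fun y _ => by ring
  have h4 : ∑ x, ∑ y, D x y * (u y * v x) = u ⬝ᵥ D.mulVec v := by
    rw [Finset.sum_comm, ← h3]
    exact Finset.sum_congr rfl fun x _ => Finset.sum_congr rfl fun y _ => by rw [hs.apply]
  have h5 : ∑ x, ∑ y, D x y * (u x - u y) * (v x - v y) =
      (∑ x, ∑ y, D x y * (u x * v x)) - (∑ x, ∑ y, D x y * (u x * v y)) -
        (∑ x, ∑ y, D x y * (u y * v x)) + ∑ x, ∑ y, D x y * (u y * v y) := by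
    simp only [← Finset.sum_sub_distrib, ← Finset.sum_add_distrib]
    exact Finset.sum_congr rfl fun x _ => Finset.sum_congr rfl fun y _ => by ring
  rw [dirichletForm, h5, h1, h2, h3, h4]
  ring

theorem IsLaplacian.row_sum (hD : IsLaplacian D) (x : V) : ∑ y, D x y = 0 := by
  have := congrFun ((hD.ker fun _ => 1).2 ⟨1, fun _ => rfl⟩) x
  simpa [Matrix.mulVec, dotProduct] using this

theorem dirichletForm_cauchy_schwarz (hD : IsLaplacian D) (u v : V → ℝ) :
    dirichletForm D u v ^ 2 ≤ dirichletForm D u u * dirichletForm D v v := by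
  have h : ∀ t : ℝ, 0 ≤ dirichletForm D v v * (t * t) + 2 * dirichletForm D u v * t +
      dirichletForm D u u := by
    intro t
    have h0 := dirichletForm_nonneg hD fun x => t * v x + u x
    have h1 : dirichletForm D (fun x => t * v x + u x) (fun x => t * v x + u x) =
        dirichletForm D v v * (t * t) + 2 * dirichletForm D u v * t + dirichletForm D u u := by
      have e1 := dirichletForm_add_left D (fun x => t * v x) u (fun x => t * v x + u x)
      rw [e1, dirichletForm_smul_left, dirichletForm_comm D v, dirichletForm_comm D u (fun x => _),
        dirichletForm_add_left, dirichletForm_add_left, dirichletForm_smul_left,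
        dirichletForm_smul_left, dirichletForm_comm D v u]
      ring
    rwa [← h1]
  have := discrim_le_zero h
  rw [discrim] at this
  linarith

/-- The functional u x - u y vanishes on constants, the kernel of D, hence factors through D. It is
therefore represented by the form, and Cauchy–Schwarz applies. -/
theorem exists_sub_sq_le (hD : IsLaplacian D) (x y : V) :
    ∃ C : ℝ, 0 ≤ C ∧ ∀ u : V → ℝ, (u x - u y) ^ 2 ≤ C * dirichletForm D u u := by
  classical
  let T : (V → ℝ) →ₗ[ℝ] (V → ℝ) := D.mulVecLin
  let l : (V → ℝ) →ₗ[ℝ] ℝ := LinearMap.proj (R := ℝ) (φ := fun _ : V => ℝ) x -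
    LinearMap.proj (R := ℝ) (φ := fun _ : V => ℝ) y
  have hl : l ∈ LinearMap.range T.dualMap := by
    rw [LinearMap.range_dualMap_eq_dualAnnihilator_ker, Submodule.mem_dualAnnihilator]
    intro w hw
    obtain ⟨c, hc⟩ := (hD.ker w).1 hw
    simp [l, hc]
  obtain ⟨ψ, hψ⟩ := hl
  let w : V → ℝ := fun z => ψ (Pi.single z 1)
  have hw : ∀ u : V → ℝ, u x - u y = -dirichletForm D w u := by
    intro u
    rw [dirichletForm_eq_neg hD.symm hD.row_sum, neg_neg]
    have h1 : u x - u y = l u := rfl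
    have h2 : l u = ψ (D.mulVec u) := by rw [← hψ]; rfl
    rw [h1, h2, LinearMap.pi_apply_eq_sum_univ ψ (D.mulVec u)]
    simp only [dotProduct, w, smul_eq_mul]
    refine Finset.sum_congr rfl fun z _ => ?_
    rw [mul_comm]
    congr 2
    ext j
    simp [Pi.single_apply, eq_comm]
  refine ⟨dirichletForm D w w, dirichletForm_nonneg hD w, fun u => ?_⟩
  rw [hw, neg_sq]
  exact dirichletForm_cauchy_schwarz hD w u

end Laplacian

namespace FRFT

/-! ### Oscillation of functions of bounded energy. -/

section Oscillation

variable {d : ℕ} {K : Set (Euc d)} {Λ : Type*} {S : FRFT K Λ} {R : S.Representatives}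
  {H : HarmonicStructure R} (W : Weight H)

theorem exists_uniform_sub_sq_le (H : HarmonicStructure R) : ∃ C : ℝ, 0 < C ∧
    ∀ (i : S.Types) (x y : S.V (R.rep i)) (u : S.V (R.rep i) → ℝ),
      (u x - u y) ^ 2 ≤ C * dirichletForm (H.D i) u u := by
  have h : ∀ p : Σ i : S.Types, S.V (R.rep i) × S.V (R.rep i), ∃ C : ℝ, 0 ≤ C ∧
      ∀ u : S.V (R.rep p.1) → ℝ, (u p.2.1 - u p.2.2) ^ 2 ≤ C * dirichletForm (H.D p.1) u u :=
    fun p => exists_sub_sq_le (H.isLaplacian p.1) p.2.1 p.2.2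
  choose C hC hCu using h
  obtain ⟨B, hB⟩ := (Set.finite_range C).bddAbove
  refine ⟨max B 1, by positivity, fun i x y u => (hCu ⟨i, x, y⟩ u).trans ?_⟩
  exact mul_le_mul_of_nonneg_right ((hB ⟨_, rfl⟩).trans (le_max_left _ _))
    (dirichletForm_nonneg (H.isLaplacian i) u)

theorem exists_card_children_le (R : S.Representatives) :
    ∃ P : ℕ, 0 < P ∧ ∀ γ, (S.children γ).card ≤ P := by
  obtain ⟨B, hB⟩ := (Set.finite_range fun i => (S.children (R.rep i)).card).bddAbove
  refine ⟨B + 1, by omega, fun γ => ?_⟩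
  have h1 := Fintype.card_congr (S.childEquiv (R.similar_rep γ))
  simp only [Fintype.card_coe] at h1
  rw [h1]
  have : (S.children (R.rep (S.type γ))).card ≤ B := hB ⟨S.type γ, rfl⟩
  omega

/-- For the root, a cycle at its type yields a proper offspring similar to the root. The boundary of
that offspring is nonempty and is carried to the root. -/
theorem V_nonempty_of_stronglyConnected (hG : R.StronglyConnected) (α : Λ) : (S.V α).Nonempty := by
  by_cases h : α = S.root
  · subst h
    obtain ⟨w, hw⟩ := hG (S.type S.root) (S.type S.root)
    obtain ⟨hne, hp⟩ := Representatives.isWalk_iff.1 hw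
    obtain ⟨β, h1, h2, -⟩ := hp.exists_desc
    obtain ⟨m, hm⟩ : ∃ m, w.length = m + 1 :=
      Nat.exists_eq_succ_of_ne_zero (List.length_pos_iff.2 hne).ne'
    rw [hm] at h1
    have hβ : β ≠ S.root := by
      rintro rfl
      exact not_isAncestor_self _ (isAncestor_of_desc h1)
    obtain ⟨x, hx⟩ := V_nonempty hβ
    exact ⟨_, V_map (S.type_eq_iff.1 h2) hx⟩
  · exact V_nonempty h

namespace Weight

/-- Oscillation of functions of bounded energy on islands of generation `k`. -/
def OscBound (B τ : ℝ) : Prop :=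
  0 < B ∧ 0 < τ ∧ τ < 1 ∧ ∀ (j k : ℕ), ∀ δ ∈ S.gen k, ∀ (u : Euc d → ℝ) (t : ℝ),
    ∑ γ ∈ S.desc δ j, W.cell γ u u ≤ t → ∀ γ ∈ S.desc δ j, ∀ γ' ∈ S.desc δ j,
      ∀ x ∈ S.V γ, ∀ y ∈ S.V γ', |u x - u y| ≤ B * τ ^ k * √t

theorem sub_sq_le_of_cell {C : ℝ}
    (hC : ∀ (i : S.Types) (x y : S.V (R.rep i)) (u : S.V (R.rep i) → ℝ),
      (u x - u y) ^ 2 ≤ C * dirichletForm (H.D i) u u) (γ : Λ) (u : Euc d → ℝ) {x y : Euc d}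
    (hx : x ∈ S.V γ) (hy : y ∈ S.V γ) : (u x - u y) ^ 2 ≤ C * (W.ρ γ * W.cell γ u u) := by
  have hs := R.similar_rep γ
  have h := hC (S.type γ) ⟨_, V_map hs hx⟩ ⟨_, V_map hs hy⟩
    fun z => (u ∘ S.φ (R.rep (S.type γ)) γ) z
  simp only [Function.comp_apply, phi_inv hs (V_subset _ hx), phi_inv hs (V_subset _ hy)] at h
  have h2 : W.ρ γ * W.cell γ u u = dirichletForm (H.D (S.type γ))
      (fun z => (u ∘ S.φ (R.rep (S.type γ)) γ) z) (fun z => (u ∘ S.φ (R.rep (S.type γ)) γ) z) := by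
    rw [cell, mul_inv_cancel_left₀ (W.pos γ).ne']
    rfl
  rw [h2]
  exact h

/-- Neighbouring children share a boundary point, so estimates chain along a path of neighbours. A
path without repetition visits at most all children. -/
theorem abs_sub_le_of_children {γ : Λ} {u : Euc d → ℝ} {M : ℝ}
    (h : ∀ β ∈ S.children γ, ∀ x ∈ S.V β, ∀ y ∈ S.V β, |u x - u y| ≤ M) {β β' : Λ}
    (hβ : β ∈ S.children γ) (hβ' : β' ∈ S.children γ) {x y : Euc d} (hx : x ∈ S.V β)
    (hy : y ∈ S.V β') : |u x - u y| ≤ (S.children γ).card * M := by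
  classical
  have hM : 0 ≤ M := (abs_nonneg _).trans (h β hβ x hx x hx)
  have key : ∀ (b b' : S.children γ) (p : (S.childGraph γ).Walk b b'), ∀ x ∈ S.V b, ∀ y ∈ S.V b',
      |u x - u y| ≤ (p.length + 1 : ℕ) * M := by
    intro b b' p
    induction p with
    | @nil b => intro x hx y hy; simpa using h b b.2 x hx y hy
    | @cons b c b' hadj p ih =>
      intro x hx y hy
      obtain ⟨hne, z, hz, hz'⟩ := childGraph_adj.1 hadj
      have hne' : (b : Λ) ≠ c := fun h => hne (Subtype.ext h)
      have h1 := h b b.2 x hx z (mem_V_of_mem_siblings b.2 c.2 hne' hz hz')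
      have h2 := ih z (mem_V_of_mem_siblings c.2 b.2 hne'.symm hz' hz) y hy
      have h3 := abs_sub_le (u x) (u z) (u y)
      rw [SimpleGraph.Walk.length_cons]
      push_cast at h2 ⊢
      linarith
  obtain ⟨p, hp⟩ := (childGraph_preconnected γ ⟨β, hβ⟩ ⟨β', hβ'⟩).exists_isPath
  have hlen := hp.length_lt
  rw [Fintype.card_coe] at hlen
  refine (key _ _ p x hx y hy).trans (mul_le_mul_of_nonneg_right ?_ hM)
  exact_mod_cast hlen

/-- Regularity makes weights decay like θ^k, so the oscillation on the boundary of one cell of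
generation k is of order τ^k √t with τ = √θ. Passing from a deep vertex up to the boundary of δ sums
these bounds into a geometric series. -/
theorem exists_oscBound (hreg : H.Regular) (hV : ∀ α, (S.V α).Nonempty) :
    ∃ B τ, W.OscBound B τ := by
  obtain ⟨C₁, hC₁, hCu⟩ := exists_uniform_sub_sq_le H
  obtain ⟨P, hP, hPc⟩ := exists_card_children_le R
  obtain ⟨C₂, θ, hC₂, hθ0, hθ1, hdec⟩ := W.mult.exists_decay (by rw [W.root_eq]; norm_num) H.r_pos
    hreg
  set τ := √θ with hτ
  set c := √(C₁ * C₂) with hc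
  have hτ0 : 0 < τ := Real.sqrt_pos.2 hθ0
  have hτ1 : τ < 1 := by rw [hτ, Real.sqrt_lt' one_pos]; simpa using hθ1
  have hc0 : 0 < c := Real.sqrt_pos.2 (by positivity)
  have hP1 : (1 : ℝ) ≤ P := by exact_mod_cast hP
  set A := P * c / (1 - τ) with hA
  have h1τ : 0 < 1 - τ := by linarith
  have hA0 : 0 < A := by positivity
  have hAc : c ≤ A := by
    rw [hA, le_div_iff₀ h1τ]
    nlinarith
  -- The constant `A` is chosen so that the induction closes: one further generation adds at most P
  -- c τ to the bound A τ.
  have hAτ : (A + P * c) * τ ≤ A := by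
    have : A * (1 - τ) = P * c := by rw [hA]; field_simp
    have h2 : (P : ℝ) * c * τ ≤ P * c := by
      have : 0 < (P : ℝ) * c := by positivity
      nlinarith
    nlinarith
  have hcell : ∀ k, ∀ γ ∈ S.gen k, ∀ (u : Euc d → ℝ) (t : ℝ), W.cell γ u u ≤ t →
      ∀ x ∈ S.V γ, ∀ y ∈ S.V γ, |u x - u y| ≤ c * τ ^ k * √t := by
    intro k γ hγ u t ht x hx y hy
    have h0 := W.cell_nonneg γ u
    have h1 := W.sub_sq_le_of_cell hCu γ u hx hy
    have h2 : (u x - u y) ^ 2 ≤ (c * τ ^ k * √t) ^ 2 := by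
      have e : (c * τ ^ k * √t) ^ 2 = C₁ * (C₂ * θ ^ k * t) := by
        rw [mul_pow, mul_pow, hc, Real.sq_sqrt (by positivity), ← pow_mul, mul_comm k 2, pow_mul,
          hτ, Real.sq_sqrt hθ0.le, Real.sq_sqrt (h0.trans ht)]
        ring
      rw [e]
      refine h1.trans (mul_le_mul_of_nonneg_left ?_ hC₁.le)
      exact mul_le_mul (hdec k γ hγ) ht h0 (by positivity)
    exact abs_le_of_sq_le_sq h2 (by positivity)
  have key : ∀ (j k : ℕ), ∀ δ ∈ S.gen k, ∀ (u : Euc d → ℝ) (t : ℝ),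
      ∑ γ ∈ S.desc δ j, W.cell γ u u ≤ t → ∀ γ ∈ S.desc δ j, ∀ x ∈ S.V γ, ∀ y ∈ S.V δ,
        |u x - u y| ≤ A * τ ^ k * √t := by
    intro j
    induction j with
    | zero =>
      intro k δ hδ u t ht γ hγ x hx y hy
      obtain rfl := mem_desc_zero.1 hγ
      refine (hcell k γ hδ u t (by simpa [desc] using ht) x hx y hy).trans ?_
      gcongr
    | succ j ih =>
      intro k δ hδ u t ht γ hγ x hx y hy
      obtain ⟨δ₁, hδ₁, hγ₁⟩ := mem_desc_succ_left.1 hγ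
      obtain ⟨z, hz⟩ := hV δ₁
      rw [sum_desc_succ_left] at ht
      have hle : ∀ β ∈ S.children δ, ∑ γ ∈ S.desc β j, W.cell γ u u ≤ t := fun β hβ =>
        (Finset.single_le_sum (f := fun β => ∑ γ ∈ S.desc β j, W.cell γ u u)
          (fun β _ => Finset.sum_nonneg fun γ _ => W.cell_nonneg γ u) hβ).trans ht
      have hgen : ∀ β ∈ S.children δ, β ∈ S.gen (k + 1) := fun β hβ => mem_gen_succ.2 ⟨δ, hδ, hβ⟩
      have h1 := ih (k + 1) δ₁ (hgen _ hδ₁) u t (hle _ hδ₁) γ hγ₁ x hx z hz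
      obtain ⟨δ₂, hδ₂, hy₂⟩ := exists_child_mem (V_subset δ hy)
      have h2 := abs_sub_le_of_children (u := u) (M := c * τ ^ (k + 1) * √t)
        (fun β hβ => hcell (k + 1) β (hgen β hβ) u t ((W.cell_le_desc β j u).trans (hle β hβ)))
        hδ₁ hδ₂ hz (mem_V_child hδ₂ hy hy₂)
      have hPc' : ((S.children δ).card : ℝ) ≤ P := by exact_mod_cast hPc δ
      have h3 : ((S.children δ).card : ℝ) * (c * τ ^ (k + 1) * √t) ≤
          P * (c * τ ^ (k + 1) * √t) := by gcongr
      calc |u x - u y| ≤ |u x - u z| + |u z - u y| := abs_sub_le _ _ _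
        _ ≤ A * τ ^ (k + 1) * √t + P * (c * τ ^ (k + 1) * √t) := add_le_add h1 (h2.trans h3)
        _ = ((A + P * c) * τ) * (τ ^ k * √t) := by ring
        _ ≤ A * (τ ^ k * √t) := by gcongr
        _ = A * τ ^ k * √t := by ring
  -- Two deep vertices are compared through one boundary point of δ, whence the factor two.
  refine ⟨2 * A, τ, by positivity, hτ0, hτ1, ?_⟩
  intro j k δ hδ u t ht γ hγ γ' hγ' x hx y hy
  obtain ⟨z, hz⟩ := hV δ
  have h1 := key j k δ hδ u t ht γ hγ x hx z hz
  have h2 := key j k δ hδ u t ht γ' hγ' y hy z hz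
  rw [abs_sub_comm] at h2
  have := abs_sub_le (u x) (u z) (u y)
  linarith

end Weight

/-- Nearby points lie in neighbouring islands. -/
theorem exists_modulus (S : FRFT K Λ) (n : ℕ) : ∃ η > 0, ∀ x ∈ K, ∀ y ∈ K, dist x y < η →
    ∃ z ∈ K, ∃ γ ∈ S.gen n, ∃ γ' ∈ S.gen n, x ∈ S.island γ ∧ z ∈ S.island γ ∧
      z ∈ S.island γ' ∧ y ∈ S.island γ' := by
  have hK : IsCompact K := by rw [← S.island_root]; exact S.island_compact _
  -- In this neighbourhood of z only islands of generation n that contain z occur. A Lebesgue number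
  -- for these neighbourhoods is the modulus.
  let U : K → Set (Euc d) := fun z => (⋃ γ ∈ {γ | γ ∈ S.gen n ∧ (z : Euc d) ∉ S.island γ},
    S.island γ)ᶜ
  have hU : ∀ z, IsOpen (U z) := fun z => by
    rw [isOpen_compl_iff]
    exact Set.Finite.isClosed_biUnion ((S.gen n).finite_toSet.subset fun x hx => hx.1)
      fun β _ => S.island_closed β
  have hmem : ∀ (z : K) (x : Euc d), x ∈ U z → ∀ γ ∈ S.gen n, x ∈ S.island γ →
      (z : Euc d) ∈ S.island γ := by
    intro z x hx γ hγ hxγ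
    by_contra hz
    exact hx (Set.mem_biUnion (x := γ) ⟨hγ, hz⟩ hxγ)
  obtain ⟨η, hη, h⟩ := lebesgue_number_lemma_of_metric hK hU (fun x hx =>
    Set.mem_iUnion.2 ⟨⟨x, hx⟩, fun hx' => by
      simp only [Set.mem_iUnion] at hx'
      obtain ⟨γ, h1, h2⟩ := hx'
      exact h1.2 h2⟩)
  refine ⟨η, hη, fun x hx y hy hxy => ?_⟩
  obtain ⟨z, hz⟩ := h x hx
  obtain ⟨γ, hγ, hxγ⟩ := exists_gen_mem (S := S) n hx
  obtain ⟨γ', hγ', hyγ'⟩ := exists_gen_mem (S := S) n hy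
  exact ⟨z, z.2, γ, hγ, γ', hγ', hxγ, hmem z x (hz (Metric.mem_ball_self hη)) γ hγ hxγ,
    hmem z y (hz (Metric.mem_ball'.2 hxy)) γ' hγ' hyγ', hyγ'⟩

end Oscillation

/-! ### Harmonic extension and functions of finite energy. -/

section Extension

variable {d : ℕ} {K : Set (Euc d)} {Λ : Type*} {S : FRFT K Λ} {R : S.Representatives}
  {H : HarmonicStructure R} {W : Weight H}

namespace Weight

theorem disc_univ (n : ℕ) (u v : Euc d → ℝ) : W.disc n K u v = ∑ γ ∈ S.gen n, W.cell γ u v :=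
  Finset.sum_congr rfl fun γ _ => if_pos (S.island_subset γ)

theorem sum_desc_le_disc {δ : Λ} {k : ℕ} (hδ : δ ∈ S.gen k) (j : ℕ) (u : Euc d → ℝ) :
    ∑ γ ∈ S.desc δ j, W.cell γ u u ≤ W.disc (k + j) K u u := by
  rw [← W.disc_eq_of_gen hδ]
  exact W.disc_mono_set (S.island_subset δ) u

/-- Vertices close to a given point of an island. -/
theorem exists_vertex_seq (hV : ∀ α, (S.V α).Nonempty) {δ : Λ} {x : Euc d}
    (hx : x ∈ S.island δ) (R : S.Representatives) : ∃ s : ℕ → Euc d,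
      (∀ j, ∃ γ ∈ S.desc δ j, s j ∈ S.V γ) ∧ Filter.Tendsto s Filter.atTop (nhds x) := by
  have h : ∀ j, ∃ y, ∃ γ ∈ S.desc δ j, x ∈ S.island γ ∧ y ∈ S.V γ := fun j => by
    obtain ⟨γ, h1, h2⟩ := exists_desc_mem j hx
    obtain ⟨y, hy⟩ := hV γ
    exact ⟨y, γ, h1, h2, hy⟩
  choose s γ hγ hxγ hs using h
  refine ⟨s, fun j => ⟨γ j, hγ j, hs j⟩, ?_⟩
  obtain ⟨k, hk⟩ := S.exists_gen δ
  rw [Metric.tendsto_atTop]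
  intro ε hε
  obtain ⟨n₀, hn₀⟩ := Representatives.exists_diam_lt R hε
  refine ⟨n₀, fun n hn => ?_⟩
  exact (Metric.dist_le_diam_of_mem (S.island_compact (γ n)).isBounded (V_subset _ (hs n))
    (hxγ n)).trans_lt (hn₀ (k + n) (by omega) _ (mem_gen_add.2 ⟨δ, hk, hγ n⟩))

variable {B τ : ℝ}

/-- The vertices of the offspring of δ are dense in the island, so the bound at vertices extends by
continuity to all points. -/
theorem OscBound.abs_sub_le (hB : W.OscBound B τ) (hV : ∀ α, (S.V α).Nonempty) {k : ℕ} {δ : Λ}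
    (hδ : δ ∈ S.gen k) {u : Euc d → ℝ} (hu : ContinuousOn u (S.island δ)) {t : ℝ} (ht : 0 ≤ t)
    (hm : W.m u (S.island δ) ≤ ENNReal.ofReal t) {x y : Euc d} (hx : x ∈ S.island δ)
    (hy : y ∈ S.island δ) : |u x - u y| ≤ B * τ ^ k * √t := by
  have hsum : ∀ j, ∑ γ ∈ S.desc δ j, W.cell γ u u ≤ t := fun j => by
    rw [← W.disc_eq_of_gen hδ]
    exact (ENNReal.ofReal_le_ofReal_iff ht).1 ((W.le_m _ _ _).trans hm)
  obtain ⟨s, hs, hsx⟩ := exists_vertex_seq hV hx R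
  obtain ⟨s', hs', hsy⟩ := exists_vertex_seq hV hy R
  have hlim : ∀ (s : ℕ → Euc d) (x : Euc d), x ∈ S.island δ →
      (∀ j, ∃ γ ∈ S.desc δ j, s j ∈ S.V γ) → Filter.Tendsto s Filter.atTop (nhds x) →
      Filter.Tendsto (fun j => u (s j)) Filter.atTop (nhds (u x)) := by
    intro s x hx hs hsx
    refine (hu x hx).tendsto.comp (tendsto_nhdsWithin_iff.2 ⟨hsx, Filter.Eventually.of_forall ?_⟩)
    intro j
    obtain ⟨γ, h1, h2⟩ := hs j
    exact island_subset_of_desc h1 (V_subset γ h2)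
  refine le_of_tendsto' ((hlim s x hx hs hsx).sub (hlim s' y hy hs' hsy)).abs fun j => ?_
  obtain ⟨γ, h1, h2⟩ := hs j
  obtain ⟨γ', h1', h2'⟩ := hs' j
  exact hB.2.2.2 j k δ hδ u t (hsum j) γ h1 γ' h1' _ h2 _ h2'

theorem OscBound.eq_of_m_eq_zero (hB : W.OscBound B τ) (hV : ∀ α, (S.V α).Nonempty) {δ : Λ}
    {u : Euc d → ℝ} (hu : ContinuousOn u (S.island δ)) (hm : W.m u (S.island δ) = 0)
    {x y : Euc d} (hx : x ∈ S.island δ) (hy : y ∈ S.island δ) : u x = u y := by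
  obtain ⟨k, hk⟩ := S.exists_gen δ
  have := hB.abs_sub_le hV hk hu le_rfl (by rw [hm]; exact zero_le) hx hy
  rw [Real.sqrt_zero, mul_zero] at this
  exact sub_eq_zero.1 (abs_nonpos_iff.1 this)

/-- Functions of bounded energy are equicontinuous. -/
theorem OscBound.equicontinuous (hB : W.OscBound B τ) (hV : ∀ α, (S.V α).Nonempty) {t : ℝ}
    (ht : 0 ≤ t) {ε : ℝ} (hε : 0 < ε) : ∃ η > 0, ∀ u : Euc d → ℝ, ContinuousOn u K →
      W.m u K ≤ ENNReal.ofReal t → ∀ x ∈ K, ∀ y ∈ K, dist x y < η → |u x - u y| < ε := by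
  have hlim : Filter.Tendsto (fun n : ℕ => B * τ ^ n * √t) Filter.atTop (nhds 0) := by
    simpa using ((tendsto_pow_atTop_nhds_zero_of_lt_one hB.2.1.le hB.2.2.1).const_mul B).mul_const
      (√t)
  obtain ⟨n, hn⟩ := (hlim.eventually (gt_mem_nhds (half_pos hε))).exists
  obtain ⟨η, hη, h⟩ := exists_modulus S n
  refine ⟨η, hη, fun u hu hm x hx y hy hxy => ?_⟩
  obtain ⟨z, -, γ, hγ, γ', hγ', h1, h2, h3, h4⟩ := h x hx y hy hxy
  have e1 := hB.abs_sub_le hV hγ (hu.mono (S.island_subset γ)) ht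
    ((W.m_mono_set (S.island_subset γ) u).trans hm) h1 h2
  have e2 := hB.abs_sub_le hV hγ' (hu.mono (S.island_subset γ')) ht
    ((W.m_mono_set (S.island_subset γ') u).trans hm) h3 h4
  have := _root_.abs_sub_le (u x) (u z) (u y)
  linarith

/-- Compactness of families with controlled oscillation on the islands. -/
theorem exists_limit (S : FRFT K Λ) {u : ℕ → Euc d → ℝ} {A : ℝ} (hτ0 : 0 ≤ τ) (hτ1 : τ < 1)
    (hu : ∀ k, ∀ᶠ n in Filter.atTop, ∀ δ ∈ S.gen k, ∀ x ∈ S.island δ, ∀ y ∈ S.island δ,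
      |u n x - u n y| ≤ A * τ ^ k) {x₀ : Euc d} (hx₀ : x₀ ∈ K) {c : ℝ} (hc : ∀ n, |u n x₀| ≤ c) :
    ∃ v : Euc d → ℝ, ContinuousOn v K ∧ ∃ l : Filter ℕ, l.NeBot ∧ l ≤ Filter.atTop ∧
      ∀ x ∈ K, Filter.Tendsto (fun n => u n x) l (nhds (v x)) := by
  -- An ultrafilter gives the limits at all points of `K` at once, in place of a diagonal
  -- subsequence.
  have hle : (Filter.hyperfilter ℕ : Filter ℕ) ≤ Filter.atTop := by
    rw [← Nat.cofinite_eq_atTop]; exact Filter.hyperfilter_le_cofinite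
  have hex : ∀ x, ∃ a : ℝ, x ∈ K →
      Filter.Tendsto (fun n => u n x) (Filter.hyperfilter ℕ : Filter ℕ) (nhds a) := by
    intro x
    by_cases hx : x ∈ K
    · have hev : ∀ᶠ n in Filter.atTop, u n x ∈ Set.Icc (-(c + A)) (c + A) := by
        filter_upwards [hu 0] with n hn
        have h1 := hn S.root (by simp [gen]) x (by rwa [S.island_root]) x₀ (by rwa [S.island_root])
        have h2 := hc n
        rw [pow_zero, mul_one, abs_le] at h1
        rw [abs_le] at h2
        constructor <;> linarith [h1.1, h1.2, h2.1, h2.2]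
      obtain ⟨a, -, ha⟩ := (isCompact_Icc (a := -(c + A)) (b := c + A)).ultrafilter_le_nhds
        ((Filter.hyperfilter ℕ).map fun n => u n x) (by
          rw [Filter.le_principal_iff]
          exact hle hev)
      exact ⟨a, fun _ => ha⟩
    · exact ⟨0, fun h => absurd h hx⟩
  choose v hv using hex
  have hosc : ∀ k, ∀ δ ∈ S.gen k, ∀ x ∈ S.island δ, ∀ y ∈ S.island δ,
      |v x - v y| ≤ A * τ ^ k := by
    intro k δ hδ x hx y hy
    refine le_of_tendsto ((hv x (S.island_subset δ hx)).sub (hv y (S.island_subset δ hy))).abs ?_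
    exact hle ((hu k).mono fun n hn => hn δ hδ x hx y hy)
  refine ⟨v, ?_, _, inferInstance, hle, fun x hx => hv x hx⟩
  rw [Metric.continuousOn_iff]
  intro x hx ε hε
  have hlim : Filter.Tendsto (fun n : ℕ => A * τ ^ n) Filter.atTop (nhds 0) := by
    simpa using (tendsto_pow_atTop_nhds_zero_of_lt_one hτ0 hτ1).const_mul A
  obtain ⟨n, hn⟩ := (hlim.eventually (gt_mem_nhds (half_pos hε))).exists
  obtain ⟨η, hη, h⟩ := exists_modulus S n
  refine ⟨η, hη, fun y hy hxy => ?_⟩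
  obtain ⟨z, -, γ, hγ, γ', hγ', h1, h2, h3, h4⟩ := h y hy x hx hxy
  have e1 := hosc n γ hγ y h1 z h2
  have e2 := hosc n γ' hγ' z h3 x h4
  have := _root_.abs_sub_le (v y) (v z) (v x)
  rw [Real.dist_eq]
  linarith

theorem exists_desc_mem_V {γ : Λ} {x : Euc d} (hx : x ∈ S.V γ) (j : ℕ) :
    ∃ γ' ∈ S.desc γ j, x ∈ S.V γ' := by
  obtain ⟨γ', h1, h2⟩ := exists_desc_mem j (V_subset γ hx)
  exact ⟨γ', h1, mem_V_desc h1 hx h2⟩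

/-- One step of the harmonic extension. -/
theorem exists_extension_succ (W : Weight H) (n : ℕ) (v : Euc d → ℝ) : ∃ g : Euc d → ℝ,
    (∀ γ ∈ S.gen n, Set.EqOn g v (S.V γ)) ∧ W.disc (n + 1) K g g ≤ W.disc n K v v := by
  have h : ∀ γ : Λ, ∃ w : Euc d → ℝ, (∀ x ∈ S.V (R.rep (S.type γ)),
      w x = (v ∘ S.φ (R.rep (S.type γ)) γ) x) ∧
      H.energy 0 (S.type γ) (v ∘ S.φ (R.rep (S.type γ)) γ) (v ∘ S.φ (R.rep (S.type γ)) γ) =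
        H.energy 1 (S.type γ) w w := fun γ => by
    obtain ⟨w, h1, h2⟩ := (H.renormalization (S.type γ)
      fun x => (v ∘ S.φ (R.rep (S.type γ)) γ) x).1
    exact ⟨w, fun x hx => h1 ⟨x, hx⟩, h2⟩
  choose w hw1 hw2 using h
  obtain ⟨g, hg⟩ := exists_glue (S.gen n)
    (fun α hα β hβ hne x hx => mem_V_of_mem_desc hα hβ hne hx.1 hx.2) v
    (fun γ => w γ ∘ S.φ γ (R.rep (S.type γ))) (by
      intro γ _ x hx
      have hs := R.similar_rep γ
      simp only [Function.comp_apply]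
      rw [hw1 γ _ (V_map hs hx), Function.comp_apply, phi_inv hs (V_subset γ hx)])
  refine ⟨g, fun γ hγ x hx => ?_, ?_⟩
  · have hs := R.similar_rep γ
    rw [hg γ hγ (V_subset γ hx), Function.comp_apply, hw1 γ _ (V_map hs hx), Function.comp_apply,
      phi_inv hs (V_subset γ hx)]
  · rw [disc_univ, disc_univ, gen, sum_desc_succ]
    refine Finset.sum_le_sum fun γ hγ => le_of_eq ?_
    have h1 := W.energy_eq 1 γ g g
    have h2 := W.energy_eq 0 γ v v
    have hs := R.similar_rep γ
    have : Set.EqOn (g ∘ S.φ (R.rep (S.type γ)) γ) (w γ) (S.island (R.rep (S.type γ))) := by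
      intro x hx
      rw [Function.comp_apply, hg γ hγ (phi_rep_mem R hx), Function.comp_apply,
        phi_inv (S.similar_symm hs) hx]
    rw [H.energy_congr 1 this this, ← hw2 γ, h2, sum_desc_succ_left] at h1
    have := mul_left_cancel₀ (W.pos γ).ne' h1
    simpa [desc] using this.symm

theorem exists_extension_add (W : Weight H) (n j : ℕ) (v : Euc d → ℝ) : ∃ g : Euc d → ℝ,
    (∀ γ ∈ S.gen n, Set.EqOn g v (S.V γ)) ∧ W.disc (n + j) K g g ≤ W.disc n K v v := by
  induction j with
  | zero => exact ⟨v, fun _ _ _ _ => rfl, le_rfl⟩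
  | succ j ih =>
    obtain ⟨g, h1, h2⟩ := ih
    obtain ⟨g', h3, h4⟩ := W.exists_extension_succ (n + j) g
    refine ⟨g', fun γ hγ x hx => ?_, h4.trans h2⟩
    obtain ⟨γ', h5, h6⟩ := exists_desc_mem_V hx j
    rw [h3 γ' (mem_gen_add.2 ⟨γ, hγ, h5⟩) h6, h1 γ hγ hx]

/-- A retraction of `K` onto the vertices of generation `n`. -/
theorem exists_retraction (S : FRFT K Λ) (hV : ∀ α, (S.V α).Nonempty) (n : ℕ) :
    ∃ s : Euc d → Euc d, (∀ γ ∈ S.gen n, ∀ x ∈ S.V γ, s x = x) ∧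
      ∀ k j, k + j = n → ∀ δ ∈ S.gen k, ∀ x ∈ S.island δ, ∃ γ ∈ S.desc δ j, s x ∈ S.V γ := by
  classical
  have h : ∀ x : Euc d, ∃ y, (∀ γ ∈ S.gen n, x ∈ S.V γ → y = x) ∧
      ((∀ γ ∈ S.gen n, x ∉ S.V γ) → ∀ γ ∈ S.gen n, x ∈ S.island γ → y ∈ S.V γ) := by
    intro x
    by_cases h1 : ∃ γ ∈ S.gen n, x ∈ S.V γ
    · obtain ⟨γ, h1, h2⟩ := h1
      exact ⟨x, fun _ _ _ => rfl, fun h => absurd h2 (h γ h1)⟩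
    · push Not at h1
      by_cases h2 : ∃ γ ∈ S.gen n, x ∈ S.island γ
      · obtain ⟨γ, h2, h3⟩ := h2
        obtain ⟨y, hy⟩ := hV γ
        refine ⟨y, fun γ' h4 h5 => absurd h5 (h1 γ' h4), fun _ γ' h4 h5 => ?_⟩
        by_cases hne : γ = γ'
        · exact hne ▸ hy
        · exact absurd (mem_V_of_mem_desc h2 h4 hne h3 h5) (h1 γ h2)
      · push Not at h2
        exact ⟨x, fun _ _ _ => rfl, fun _ γ h3 h4 => absurd h4 (h2 γ h3)⟩
  choose s hs1 hs2 using h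
  refine ⟨s, fun γ hγ x hx => hs1 x γ hγ hx, ?_⟩
  rintro k j rfl δ hδ x hx
  obtain ⟨γ, h1, h2⟩ := exists_desc_mem j hx
  have hγ : γ ∈ S.gen (k + j) := mem_gen_add.2 ⟨δ, hδ, h1⟩
  by_cases h3 : ∃ γ' ∈ S.gen (k + j), x ∈ S.V γ'
  · obtain ⟨γ', h3, h4⟩ := h3
    rw [hs1 x γ' h3 h4]
    by_cases hne : γ = γ'
    · exact ⟨γ, h1, hne ▸ h4⟩
    · exact ⟨γ, h1, mem_V_of_mem_desc hγ h3 hne h2 (V_subset γ' h4)⟩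
  · push Not at h3
    exact ⟨γ, h1, hs2 x h3 γ hγ h2⟩

/-- Harmonic extension of boundary values of generation `n`. -/
theorem OscBound.exists_extension (hB : W.OscBound B τ) (hV : ∀ α, (S.V α).Nonempty) (n : ℕ)
    (v : Euc d → ℝ) : ∃ u : Euc d → ℝ, ContinuousOn u K ∧
      (∀ γ ∈ S.gen n, Set.EqOn u v (S.V γ)) ∧
      W.m u K ≤ ENNReal.ofReal (W.disc n K v v) ∧
      ∀ γ ∈ S.gen n, W.m u (S.island γ) ≤ ENNReal.ofReal (W.cell γ v v) := by
  classical
  set t := W.disc n K v v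
  choose g hg1 hg2 using fun j => W.exists_extension_add n j v
  -- The functions `g j` are controlled only at vertices of generation n + j. Composing with the
  -- retraction keeps these values and controls the oscillation everywhere.
  choose s hs1 hs2 using fun j => exists_retraction S hV (n + j)
  have hgs : ∀ j, ∀ k ≤ n + j, ∀ γ ∈ S.gen k, Set.EqOn (g j ∘ s j) (g j) (S.V γ) := by
    intro j k hk γ hγ x hx
    obtain ⟨i, hi⟩ := Nat.exists_eq_add_of_le hk
    obtain ⟨γ', h1, h2⟩ := exists_desc_mem_V hx i
    rw [Function.comp_apply, hs1 j γ' (by rw [hi]; exact mem_gen_add.2 ⟨γ, hγ, h1⟩) x h2]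
  have hgv : ∀ j, ∀ γ ∈ S.gen n, Set.EqOn (g j ∘ s j) v (S.V γ) := fun j γ hγ x hx =>
    (hgs j n (Nat.le_add_right _ _) γ hγ hx).trans (hg1 j γ hγ hx)
  obtain ⟨γ₀, hγ₀⟩ : ∃ γ, γ ∈ S.gen n := by
    obtain ⟨x, hx⟩ := (S.island_nontrivial S.root).nonempty
    obtain ⟨γ, h, -⟩ := exists_desc_mem n hx
    exact ⟨γ, h⟩
  obtain ⟨x₀, hx₀⟩ := hV γ₀
  obtain ⟨u, hu, l, hl, hle, hlim⟩ := exists_limit S (u := fun j => g j ∘ s j) (A := B * √t)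
    hB.2.1.le hB.2.2.1 (by
      intro k
      filter_upwards [Filter.eventually_ge_atTop k] with j hj δ hδ x hx y hy
      obtain ⟨i, hi⟩ := Nat.exists_eq_add_of_le (show k ≤ n + j by omega)
      obtain ⟨γ, h1, h2⟩ := hs2 j k i hi.symm δ hδ x hx
      obtain ⟨γ', h1', h2'⟩ := hs2 j k i hi.symm δ hδ y hy
      have := hB.2.2.2 i k δ hδ (g j) t
        ((sum_desc_le_disc hδ i (g j)).trans (by rw [← hi]; exact hg2 j)) γ h1 γ' h1' _ h2 _ h2'
      refine this.trans (le_of_eq ?_)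
      ring)
    (x₀ := x₀) (S.island_subset _ (V_subset _ hx₀)) (c := |v x₀|)
    (fun j => by rw [hgv j γ₀ hγ₀ hx₀])
  have huv : ∀ γ ∈ S.gen n, Set.EqOn u v (S.V γ) := by
    intro γ hγ x hx
    refine tendsto_nhds_unique (hlim x (S.island_subset γ (V_subset γ hx))) ?_
    simp only [hgv _ γ hγ hx]
    exact tendsto_const_nhds
  have hm : W.m u K ≤ ENNReal.ofReal t := by
    refine W.m_le_of_tendsto hlim fun k => ?_
    refine hle ?_
    filter_upwards [Filter.eventually_ge_atTop k] with j hj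
    refine ENNReal.ofReal_le_ofReal ?_
    have : W.disc k K (g j ∘ s j) (g j ∘ s j) = W.disc k K (g j) (g j) := by
      rw [disc_univ, disc_univ]
      refine Finset.sum_congr rfl fun γ hγ => ?_
      exact W.cell_congr (hgs j k (by omega) γ hγ) (hgs j k (by omega) γ hγ)
    rw [this]
    exact (W.disc_mono K (g j) (show k ≤ n + j by omega)).trans (hg2 j)
  refine ⟨u, hu, huv, hm, fun γ hγ => ?_⟩
  -- Every island carries at least the energy of its cell, while the total is at most the sum of the
  -- cells. Cancelling the other islands bounds the energy on each single one.
  have h1 : ∑ β ∈ S.gen n, W.m u (S.island β) ≤ ∑ β ∈ S.gen n, ENNReal.ofReal (W.cell β v v) := by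
    refine (W.sum_m_le (S.gen n) (fun i hi j hj hne => finite_inter_of_desc hi hj hne)
      (fun i _ => S.island_subset i) u).trans (hm.trans (le_of_eq ?_))
    rw [← ENNReal.ofReal_sum_of_nonneg fun β _ => W.cell_nonneg β v, ← disc_univ]
  rw [← Finset.add_sum_erase _ _ hγ, ← Finset.add_sum_erase _ _ hγ] at h1
  have h2 : ∑ β ∈ (S.gen n).erase γ, ENNReal.ofReal (W.cell β v v) ≤
      ∑ β ∈ (S.gen n).erase γ, W.m u (S.island β) := by
    refine Finset.sum_le_sum fun β hβ => ?_
    have hβ' := huv β (Finset.mem_of_mem_erase hβ)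
    rw [← W.cell_congr hβ' hβ', W.m_island]
    refine le_trans (le_of_eq ?_) (le_iSup _ 0)
    simp [desc]
  have h3 : ∑ β ∈ (S.gen n).erase γ, ENNReal.ofReal (W.cell β v v) ≠ ⊤ :=
    (ENNReal.sum_lt_top.2 fun β _ => ENNReal.ofReal_lt_top).ne
  exact ENNReal.le_of_add_le_add_right h3 ((add_le_add_right h2 _).trans h1)

theorem disc_smul_right (W : Weight H) (n : ℕ) (A : Set (Euc d)) (c : ℝ) (u v : Euc d → ℝ) :
    W.disc n A u (c • v) = c * W.disc n A u v := by
  rw [disc_comm, disc_smul_left, disc_comm]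

theorem disc_add_right (W : Weight H) (n : ℕ) (A : Set (Euc d)) (u v v' : Euc d → ℝ) :
    W.disc n A u (v + v') = W.disc n A u v + W.disc n A u v' := by
  rw [disc_comm, disc_add_left, W.disc_comm n A v, W.disc_comm n A v']

theorem disc_add_self (W : Weight H) (n : ℕ) (A : Set (Euc d)) (u v : Euc d → ℝ) :
    W.disc n A (u + v) (u + v) = W.disc n A u u + 2 * W.disc n A u v + W.disc n A v v := by
  rw [disc_add_left, disc_add_right, disc_add_right, W.disc_comm n A v u]
  ring

/-- The parallelogram inequality for the nonnegative quadratic form of each generation. -/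
theorem m_add_le (W : Weight H) (A : Set (Euc d)) (u w : Euc d → ℝ) :
    W.m (u + w) A ≤ 2 * W.m u A + 2 * W.m w A := by
  refine iSup_le fun n => ?_
  have h : W.disc n A (u + w) (u + w) ≤ 2 * W.disc n A u u + 2 * W.disc n A w w := by
    have h0 := W.disc_nonneg n A (u + (-1 : ℝ) • w)
    rw [disc_add_self, disc_smul_right, disc_smul_left, disc_smul_right] at h0
    rw [disc_add_self]
    linarith
  calc ENNReal.ofReal (W.disc n A (u + w) (u + w))
      ≤ ENNReal.ofReal (2 * W.disc n A u u + 2 * W.disc n A w w) := ENNReal.ofReal_le_ofReal h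
    _ = 2 * ENNReal.ofReal (W.disc n A u u) + 2 * ENNReal.ofReal (W.disc n A w w) := by
      rw [ENNReal.ofReal_add (mul_nonneg zero_le_two (W.disc_nonneg n A u))
        (mul_nonneg zero_le_two (W.disc_nonneg n A w)), ENNReal.ofReal_mul zero_le_two,
        ENNReal.ofReal_mul zero_le_two]
      simp
    _ ≤ _ := add_le_add (mul_le_mul_right (W.le_m n u A) 2) (mul_le_mul_right (W.le_m n w A) 2)

theorem m_smul (W : Weight H) (A : Set (Euc d)) (c : ℝ) (u : Euc d → ℝ) :
    W.m (c • u) A = ENNReal.ofReal (c ^ 2) * W.m u A := by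
  unfold m
  rw [ENNReal.mul_iSup]
  refine iSup_congr fun n => ?_
  rw [disc_smul_left, disc_smul_right, ← ENNReal.ofReal_mul (sq_nonneg c)]
  congr 1
  ring

/-- The functions that are continuous on `K` and have finite energy. -/
def space (W : Weight H) : Submodule ℝ (Euc d → ℝ) where
  carrier := {u | ContinuousOn u K ∧ W.m u K ≠ ⊤}
  add_mem' := fun {u w} hu hw => ⟨hu.1.add hw.1, ne_top_of_le_ne_top
    (ENNReal.add_ne_top.2 ⟨ENNReal.mul_ne_top (by simp) hu.2, ENNReal.mul_ne_top (by simp) hw.2⟩)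
    (W.m_add_le K u w)⟩
  zero_mem' := ⟨continuousOn_const, by rw [W.m_eq_zero fun _ _ _ _ => rfl]; simp⟩
  smul_mem' := fun c u hu => ⟨hu.1.const_smul c, by
    rw [m_smul]; exact ENNReal.mul_ne_top ENNReal.ofReal_ne_top hu.2⟩

/-- Boundary values one around the islands containing x and zero elsewhere are extended. A cell with
constant boundary values has zero energy, so the extension is constant there. The generation is so
fine that islands meeting those around x contain no point of `A`. -/
theorem OscBound.exists_bump (hB : W.OscBound B τ) (hV : ∀ α, (S.V α).Nonempty)
    {A : Set (Euc d)} (hA : A.Finite) (hAK : A ⊆ K) {x : Euc d} (hx : x ∈ K) (hxA : x ∉ A) :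
    ∃ u ∈ W.space, u x = 1 ∧ ∀ a ∈ A, u a = 0 := by
  classical
  obtain ⟨ε, hε, hball⟩ := Metric.isOpen_iff.1 hA.isClosed.isOpen_compl x hxA
  obtain ⟨n, hn⟩ := Representatives.exists_diam_lt R (half_pos hε)
  let v : Euc d → ℝ := fun z => if ∃ γ ∈ S.gen n, x ∈ S.island γ ∧ z ∈ S.V γ then 1 else 0
  obtain ⟨u, hu, huv, hm, hcell⟩ := hB.exists_extension hV n v
  have hconst : ∀ γ ∈ S.gen n, ∀ c, (∀ z ∈ S.V γ, v z = c) → ∀ y ∈ S.island γ, u y = c := by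
    intro γ hγ c hc y hy
    obtain ⟨z, hz⟩ := hV γ
    have h0 := hcell γ hγ
    rw [W.cell_eq_zero fun a ha b hb => by rw [hc a ha, hc b hb], ENNReal.ofReal_zero] at h0
    rw [hB.eq_of_m_eq_zero hV (hu.mono (S.island_subset γ)) (le_antisymm h0 zero_le) hy
      (V_subset γ hz), huv γ hγ hz, hc z hz]
  refine ⟨u, ⟨hu, ne_top_of_le_ne_top ENNReal.ofReal_ne_top hm⟩, ?_, ?_⟩
  · obtain ⟨γ, hγ, hxγ⟩ := exists_gen_mem (S := S) n hx
    exact hconst γ hγ 1 (fun z hz => if_pos ⟨γ, hγ, hxγ, hz⟩) x hxγ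
  · intro a ha
    obtain ⟨γ, hγ, haγ⟩ := exists_gen_mem (S := S) n (hAK ha)
    refine hconst γ hγ 0 (fun z hz => if_neg ?_) a haγ
    rintro ⟨γ', hγ', hxγ', hz'⟩
    refine hball (Metric.mem_ball.2 ?_) ha
    have h1 := Metric.dist_le_diam_of_mem (S.island_compact γ).isBounded haγ (V_subset γ hz)
    have h2 := Metric.dist_le_diam_of_mem (S.island_compact γ').isBounded (V_subset γ' hz') hxγ'
    have h3 := hn n le_rfl γ hγ
    have h4 := hn n le_rfl γ' hγ'
    have := dist_triangle a z x
    linarith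

/-- Functions of finite energy take arbitrary values on finite sets. -/
theorem OscBound.exists_interpolation (hB : W.OscBound B τ) (hV : ∀ α, (S.V α).Nonempty)
    {A : Set (Euc d)} (hA : A.Finite) (hAK : A ⊆ K) (v : Euc d → ℝ) :
    ∃ u ∈ W.space, Set.EqOn u v A := by
  classical
  have h : ∀ a, ∃ u ∈ W.space, a ∈ A → u a = 1 ∧ ∀ b ∈ A, b ≠ a → u b = 0 := by
    intro a
    by_cases ha : a ∈ A
    · obtain ⟨u, h1, h2, h3⟩ := hB.exists_bump hV (hA.subset (Set.sdiff_subset (t := {a})))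
        (Set.sdiff_subset.trans hAK) (hAK ha) (fun h => h.2 rfl)
      exact ⟨u, h1, fun _ => ⟨h2, fun b hb hne => h3 b ⟨hb, hne⟩⟩⟩
    · exact ⟨0, W.space.zero_mem, fun h => absurd h ha⟩
  choose b hb1 hb2 using h
  refine ⟨∑ a ∈ hA.toFinset, v a • b a,
    Submodule.sum_mem _ fun a _ => W.space.smul_mem _ (hb1 a), fun x hx => ?_⟩
  rw [Finset.sum_apply, Finset.sum_eq_single_of_mem x (hA.mem_toFinset.2 hx)]
  · simp [(hb2 x hx).1]
  · intro a ha hne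
    simp [(hb2 a (hA.mem_toFinset.1 ha)).2 x hx hne.symm]

end Weight

end Extension

/-! ### Size ratios determine energy ratios. -/

section Scaling

variable {d : ℕ} {K : Set (Euc d)} {Λ Λ' : Type*} {S : FRFT K Λ} {R : S.Representatives}
  {H : HarmonicStructure R}

/-- The weights of the islands in a homogeneous harmonic structure. -/
noncomputable def HarmonicStructure.Homogeneous.weight (hhom : H.Homogeneous) : Weight H where
  -- Homogeneity applied to an index and itself shows that the weight does not depend on the chosen
  -- walk.
  ρ α := H.weight (R.exists_isRootWalk α).choose
  mult γ β := by
    have h1 := (R.exists_isRootWalk γ).choose_spec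
    have h2 := (R.exists_isRootWalk (β : Λ)).choose_spec
    refine (hhom β β _ _ (S.similar_refl _) rfl h2 (h1.step β)).trans ?_
    simp [NetworkData.weight]
  root_eq := by
    have h := (R.exists_isRootWalk S.root).choose_spec
    refine (hhom _ _ _ [] (S.similar_refl _) rfl h Representatives.IsRootWalk.root).trans ?_
    simp [NetworkData.weight]

namespace Weight

variable (W : Weight H)

theorem eq_weight {α : Λ} {w : List R.Edge} (h : R.IsRootWalk α w) : W.ρ α = H.weight w := by
  rw [h.eq_mul W.mult, W.root_eq, one_mul]
  rfl

theorem eq_of_homogeneous (hhom : H.Homogeneous) {α β : Λ} (h : S.Similar α β)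
    (hd : Metric.diam (S.island α) = Metric.diam (S.island β)) : W.ρ α = W.ρ β := by
  obtain ⟨w, hw⟩ := R.exists_isRootWalk α
  obtain ⟨w', hw'⟩ := R.exists_isRootWalk β
  rw [W.eq_weight hw, W.eq_weight hw']
  exact hhom α β w w' h hd hw hw'

/-- There are islands of the same type whose sizes have ratio `κ` and whose weights have
ratio `σ`. -/
def IsRatio (κ σ : ℝ) : Prop :=
  ∃ α β : Λ, S.Similar α β ∧ Metric.diam (S.island β) = κ * Metric.diam (S.island α) ∧
    W.ρ β = σ * W.ρ α

variable {W}

/-- A walk from type i to the root type is fixed, and the root walk of β is appended. This plants a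
copy of β below α, whose size and weight are products up to constants depending only on i. -/
theorem exists_concat (W : Weight H) (hG : R.StronglyConnected) (i : S.Types) :
    ∃ s r : ℝ, 0 < s ∧ 0 < r ∧ ∀ α β : Λ, S.type α = i → ∃ x, S.type x = S.type β ∧
      Metric.diam (S.island x) = Metric.diam (S.island α) * s * Metric.diam (S.island β) ∧
      W.ρ x = W.ρ α * r * W.ρ β := by
  obtain ⟨v, hv⟩ := hG i (S.type S.root)
  have hv' := (Representatives.isWalk_iff.1 hv).2
  set f : R.Edge → ℝ := fun e => Metric.diam (S.island e.2) / Metric.diam (S.island (R.rep e.1))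
  have hroot := diam_pos (S := S) S.root
  refine ⟨(v.map f).prod / Metric.diam (S.island S.root), (v.map H.r).prod,
    div_pos (List.prod_pos ?_) hroot, List.prod_pos (by simpa using fun e _ => H.r_pos e), ?_⟩
  · simpa [f] using fun e _ => div_pos (diam_pos (S := S) _) (diam_pos (S := S) _)
  · intro α β hα
    subst hα
    obtain ⟨w, hw⟩ := R.exists_isRootWalk β
    obtain ⟨x, -, hx, hmul, -⟩ :=
      (Representatives.isPath_append.2 ⟨_, hv', hw.isPath⟩).exists_desc
    refine ⟨x, hx, ?_, ?_⟩
    · rw [hmul f _ R.isMultiplicative_diam, hw.eq_mul R.isMultiplicative_diam, List.map_append,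
        List.prod_append]
      field_simp
      rfl
    · rw [hmul H.r _ W.mult, hw.eq_mul W.mult, W.root_eq, List.map_append, List.prod_append]
      ring

/-- Planting β below α' and planting β' below α gives two islands of the same type and the same
size. Homogeneity makes their weights equal, and the common factors cancel. -/
theorem IsRatio.unique (hG : R.StronglyConnected) (hhom : H.Homogeneous) {κ σ σ' : ℝ}
    (h : W.IsRatio κ σ) (h' : W.IsRatio κ σ') : σ = σ' := by
  obtain ⟨α, α', hs, hd, hr⟩ := h
  obtain ⟨β, β', hs', hd', hr'⟩ := h'
  obtain ⟨s, r, -, hr0, hc⟩ := W.exists_concat hG (S.type α)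
  obtain ⟨x, hx1, hx2, hx3⟩ := hc α' β (S.type_eq_iff.2 (S.similar_symm hs))
  obtain ⟨y, hy1, hy2, hy3⟩ := hc α β' rfl
  have hxy : S.Similar x y := S.type_eq_iff.1 (by rw [hx1, hy1, S.type_eq_iff.2 hs'])
  have := W.eq_of_homogeneous hhom hxy (by rw [hx2, hy2, hd, hd']; ring)
  rw [hx3, hy3, hr, hr'] at this
  have h1 := W.pos α
  have h2 := W.pos β
  have h3 : W.ρ α * r * W.ρ β ≠ 0 := by positivity
  refine mul_right_cancel₀ h3 ?_
  linarith

/-- Planting β below α and β' below α' composes the two ratios. -/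
theorem IsRatio.mul (hG : R.StronglyConnected) {κ κ' σ σ' : ℝ}
    (h : W.IsRatio κ σ) (h' : W.IsRatio κ' σ') : W.IsRatio (κ * κ') (σ * σ') := by
  obtain ⟨α, α', hs, hd, hr⟩ := h
  obtain ⟨β, β', hs', hd', hr'⟩ := h'
  obtain ⟨s, r, -, -, hc⟩ := W.exists_concat hG (S.type α)
  obtain ⟨x, hx1, hx2, hx3⟩ := hc α β rfl
  obtain ⟨y, hy1, hy2, hy3⟩ := hc α' β' (S.type_eq_iff.2 (S.similar_symm hs))
  refine ⟨x, y, S.type_eq_iff.1 (by rw [hx1, hy1, S.type_eq_iff.2 hs']), ?_, ?_⟩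
  · rw [hx2, hy2, hd, hd']; ring
  · rw [hx3, hy3, hr, hr']; ring

theorem isRatio_one (W : Weight H) : W.IsRatio 1 1 :=
  ⟨S.root, S.root, S.similar_refl _, by ring, by ring⟩

variable {S' : FRFT K Λ'}

/-- Superadditivity gives one inequality. For the other, the tiles without their boundaries are
relatively open in K, and the boundaries of countably many tiles form a countable set. -/
theorem m_tile (W : Weight H) {α' : Λ'} {L : Set Λ} (hL : L.Countable)
    (hun : S'.island α' \ S'.V α' = ⋃ α ∈ L, S.island α)
    (hfin : ∀ α ∈ L, ∀ β ∈ L, α ≠ β → (S.island α ∩ S.island β).Finite) {u : Euc d → ℝ}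
    (hu : ContinuousOn u (S'.island α')) :
    W.m u (S'.O α') = ∑' α : L, W.m u (S.island α) := by
  have hsub : ∀ α : L, S.island α ⊆ S'.O α' := fun α => by
    rw [O, hun]
    exact Set.subset_biUnion_of_mem (u := fun α => S.island α) α.2
  refine le_antisymm ?_ (W.tsum_m_le (fun (i j : L) hij => hfin i i.2 j j.2 fun h => hij (Subtype.ext h))
    hsub u)
  have : Countable L := hL
  refine (W.m_le_tsum (N := ⋃ α : L, S.V α) (A := fun α : L => S.O α)
    (Set.countable_iUnion fun α => (S.finite_V α).countable) (fun α => S.exists_open_O α) ?_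
    (hu.mono (S'.O_subset α'))).trans (ENNReal.tsum_le_tsum fun α => W.m_mono_set (S.O_subset α) u)
  intro x hx
  rw [O, hun] at hx
  simp only [Set.mem_iUnion] at hx
  obtain ⟨α, hα, hx⟩ := hx
  by_cases hV : x ∈ S.V α
  · exact Or.inl (Set.mem_iUnion.2 ⟨⟨α, hα⟩, hV⟩)
  · exact Or.inr (Set.mem_iUnion.2 ⟨⟨α, hα⟩, hx, hV⟩)

theorem O_nonempty (S : FRFT K Λ) (α : Λ) : (S.O α).Nonempty :=
  ((S.island_infinite α).sdiff (S.finite_V α)).nonempty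

/-- The energy on an island of a tiled structure scales under the similitudes of that structure. -/
theorem exists_scale (W : Weight H) (hG : R.StronglyConnected) (hhom : H.Homogeneous)
    (htile : IsTiledBy S' S) {α' β' : Λ'} (h : S'.Similar α' β') :
    ∃ σ : ℝ, 0 < σ ∧
      W.IsRatio (Metric.diam (S'.island β') / Metric.diam (S'.island α')) σ ∧
      ∀ u : Euc d → ℝ, ContinuousOn u (S'.island β') →
        W.m (u ∘ S'.φ α' β') (S'.O α') = ENNReal.ofReal σ * W.m u (S'.O β') := by
  obtain ⟨L, M, ⟨hLc, hLu, hLf⟩, ⟨hMc, hMu, hMf⟩, p, hp⟩ := htile α' β' h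
  -- All tiles have the size ratio of the large islands, so by uniqueness their weight ratios agree
  -- and the factor can be taken out of the sum.
  have hratio : ∀ α : L, W.IsRatio (Metric.diam (S'.island β') / Metric.diam (S'.island α'))
      (W.ρ (p α) / W.ρ α) := by
    intro α
    refine ⟨α, p α, (hp α).1, ?_, by rw [div_mul_cancel₀ _ (W.pos _).ne']⟩
    rw [diam_similar h, mul_div_assoc, div_self (diam_pos _).ne', mul_one]
    refine diam_image_of_eqOn ?_
    rw [← S.φ_image _ _ (hp α).1]
    exact Set.image_congr fun x hx => ((hp α).2 hx).symm
  obtain ⟨x, hx⟩ := O_nonempty S' α'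
  rw [O, hLu] at hx
  simp only [Set.mem_iUnion] at hx
  obtain ⟨α₀, hα₀, -⟩ := hx
  set σ := W.ρ (p ⟨α₀, hα₀⟩) / W.ρ α₀
  have hσ : 0 < σ := div_pos (W.pos _) (W.pos _)
  refine ⟨σ, hσ, hratio ⟨α₀, hα₀⟩, fun u hu => ?_⟩
  have hcont : ContinuousOn (u ∘ S'.φ α' β') (S'.island α') :=
    hu.comp (S'.φ α' β').toHomeomorph.continuous.continuousOn fun x hx => phi_mem h hx
  rw [W.m_tile hLc hLu hLf hcont, W.m_tile hMc hMu hMf hu, ← ENNReal.tsum_mul_left,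
    ← p.tsum_eq]
  refine tsum_congr fun α => ?_
  have h1 := W.m_similar (hp α).1 u
  have h2 : W.ρ (p α) = W.ρ α * σ := by
    rw [show σ = W.ρ (p α) / W.ρ α from (hratio ⟨α₀, hα₀⟩).unique hG hhom (hratio α),
      mul_div_cancel₀ _ (W.pos _).ne']
  rw [h2, ENNReal.ofReal_mul (W.pos _).le, mul_assoc] at h1
  have h3 := (ENNReal.mul_right_inj (ENNReal.ofReal_pos.2 (W.pos α)).ne' ENNReal.ofReal_ne_top).1 h1
  rw [← h3]
  exact W.m_congr fun x hx => congrArg u ((hp α).2 hx).symm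

end Weight

end Scaling

/-! ### Polarization, energy minimizers and traces. -/

section Trace

variable {d : ℕ} {K : Set (Euc d)} {Λ Λ' : Type*} {S : FRFT K Λ} {R : S.Representatives}
  {H : HarmonicStructure R} {W : Weight H} {S' : FRFT K Λ'}

namespace Weight

theorem tendsto_disc_m {u : Euc d → ℝ} {A : Set (Euc d)} (h : W.m u A ≠ ⊤) :
    Filter.Tendsto (fun n => W.disc n A u u) Filter.atTop (nhds (W.m u A).toReal) := by
  have h1 := (ENNReal.tendsto_toReal h).comp (tendsto_atTop_iSup (W.ofReal_disc_mono u A))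
  refine h1.congr fun n => ?_
  exact ENNReal.toReal_ofReal (W.disc_nonneg n A u)

theorem m_ne_top_of_mem {u : Euc d → ℝ} (hu : u ∈ W.space) {A : Set (Euc d)} (hA : A ⊆ K) :
    W.m u A ≠ ⊤ := ne_top_of_le_ne_top hu.2 (W.m_mono_set hA u)

theorem tendsto_disc_polar {u w : Euc d → ℝ} (hu : u ∈ W.space) (hw : w ∈ W.space)
    {A : Set (Euc d)} (hA : A ⊆ K) :
    Filter.Tendsto (fun n => W.disc n A u w) Filter.atTop
      (nhds (1 / 2 * ((W.m (u + w) A).toReal - (W.m u A).toReal - (W.m w A).toReal))) := by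
  have h1 := tendsto_disc_m (m_ne_top_of_mem (W.space.add_mem hu hw) hA)
  have h2 := tendsto_disc_m (m_ne_top_of_mem hu hA)
  have h3 := tendsto_disc_m (m_ne_top_of_mem hw hA)
  refine (((h1.sub h2).sub h3).const_mul (1 / 2)).congr fun n => ?_
  rw [disc_add_self]
  ring

theorem exists_tendsto_disc {u w : Euc d → ℝ} (hu : u ∈ W.space) (hw : w ∈ W.space)
    {A : Set (Euc d)} (hA : A ⊆ K) :
    ∃ t, Filter.Tendsto (fun n => W.disc n A u w) Filter.atTop (nhds t) :=
  ⟨_, tendsto_disc_polar hu hw hA⟩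

/-- The energy form in a subset of `K`. -/
noncomputable def form (W : Weight H) {A : Set (Euc d)} (hA : A ⊆ K) :
    W.space →ₗ[ℝ] W.space →ₗ[ℝ] ℝ :=
  LinearMap.mk₂ ℝ (fun u w => (exists_tendsto_disc u.2 w.2 hA).choose)
    (fun u u' w => tendsto_nhds_unique (exists_tendsto_disc (u + u').2 w.2 hA).choose_spec
      (((exists_tendsto_disc u.2 w.2 hA).choose_spec.add
        (exists_tendsto_disc u'.2 w.2 hA).choose_spec).congr fun n =>
          (W.disc_add_left n A u u' w).symm))
    (fun c u w => tendsto_nhds_unique (exists_tendsto_disc (c • u).2 w.2 hA).choose_spec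
      (((exists_tendsto_disc u.2 w.2 hA).choose_spec.const_mul c).congr fun n =>
        (W.disc_smul_left n A c u w).symm))
    (fun u w w' => tendsto_nhds_unique (exists_tendsto_disc u.2 (w + w').2 hA).choose_spec
      (((exists_tendsto_disc u.2 w.2 hA).choose_spec.add
        (exists_tendsto_disc u.2 w'.2 hA).choose_spec).congr fun n =>
          (W.disc_add_right n A u w w').symm))
    (fun c u w => tendsto_nhds_unique (exists_tendsto_disc u.2 (c • w).2 hA).choose_spec
      (((exists_tendsto_disc u.2 w.2 hA).choose_spec.const_mul c).congr fun n =>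
        (W.disc_smul_right n A c u w).symm))

theorem tendsto_form {A : Set (Euc d)} (hA : A ⊆ K) (u w : W.space) :
    Filter.Tendsto (fun n => W.disc n A u w) Filter.atTop (nhds (W.form hA u w)) :=
  (exists_tendsto_disc u.2 w.2 hA).choose_spec

theorem form_comm {A : Set (Euc d)} (hA : A ⊆ K) (u w : W.space) :
    W.form hA u w = W.form hA w u :=
  tendsto_nhds_unique (tendsto_form hA u w)
    ((tendsto_form hA w u).congr fun n => W.disc_comm n A w u)

theorem ofReal_form_self {A : Set (Euc d)} (hA : A ⊆ K) (u : W.space) :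
    ENNReal.ofReal (W.form hA u u) = W.m u A := by
  have h := m_ne_top_of_mem u.2 hA
  rw [tendsto_nhds_unique (tendsto_form hA u u) (tendsto_disc_m h), ENNReal.ofReal_toReal h]

theorem form_self_nonneg {A : Set (Euc d)} (hA : A ⊆ K) (u : W.space) : 0 ≤ W.form hA u u :=
  ge_of_tendsto' (tendsto_form hA u u) fun n => W.disc_nonneg n A u

theorem form_self_add {A : Set (Euc d)} (hA : A ⊆ K) (u w : W.space) :
    W.form hA (u + w) (u + w) = W.form hA u u + 2 * W.form hA u w + W.form hA w w := by
  simp only [map_add, LinearMap.add_apply]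
  rw [form_comm hA w u]
  ring

theorem form_eq_zero_of_self {A : Set (Euc d)} (hA : A ⊆ K) {z : W.space}
    (hz : W.form hA z z = 0) (u : W.space) : W.form hA u z = 0 := by
  have h : ∀ t : ℝ, 0 ≤ W.form hA u u + 2 * (t * W.form hA u z) := by
    intro t
    have := form_self_nonneg hA (u + t • z)
    rw [form_self_add] at this
    simpa [hz] using this
  by_contra hne
  have := h (-(W.form hA u u + 1) / (2 * W.form hA u z))
  field_simp at this
  linarith

/-- Functions that agree on the boundary of an island can be exchanged on this island. -/
theorem exists_exchange (W : Weight H) (α' : Λ') {f g : Euc d → ℝ} (hf : ContinuousOn f K)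
    (hg : ContinuousOn g (S'.island α')) (hfg : Set.EqOn g f (S'.V α')) :
    ∃ G : Euc d → ℝ, ContinuousOn G K ∧ Set.EqOn G g (S'.island α') ∧
      Set.EqOn G f (K \ S'.island α') ∧
      W.m G K ≤ W.m g (S'.O α') + W.m f (K \ S'.island α') := by
  classical
  obtain ⟨n, hn⟩ := S'.exists_gen α'
  obtain ⟨G, hG⟩ := exists_glue (S := S') (S'.gen n)
    (fun α hα β hβ hne x hx => mem_V_of_mem_desc hα hβ hne hx.1 hx.2) f
    (fun β => if β = α' then g else f) (by
      intro β _
      by_cases h : β = α'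
      · subst h; simpa using hfg
      · simp only [if_neg h]; exact fun _ _ => rfl)
  have h1 : Set.EqOn G g (S'.island α') := by simpa using hG α' hn
  have h2 : Set.EqOn G f (K \ S'.island α') := by
    intro x hx
    obtain ⟨β, hβ, hxβ⟩ := exists_gen_mem (S := S') n hx.1
    have hne : β ≠ α' := by rintro rfl; exact hx.2 hxβ
    simpa [hne] using hG β hβ hxβ
  have hK : K ⊆ ⋃ β ∈ S'.gen n, S'.island β := fun x hx => by
    obtain ⟨β, hβ, hxβ⟩ := exists_gen_mem (S := S') n hx
    exact Set.mem_biUnion hβ hxβ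
  have hcont : ContinuousOn G K := by
    refine (continuousOn_biUnion_island (S := S') (S'.gen n) fun β hβ => ?_).mono hK
    refine ContinuousOn.congr ?_ (hG β hβ)
    by_cases h : β = α'
    · subst h; simpa using hg
    · simpa [h] using hf.mono (S'.island_subset β)
  refine ⟨G, hcont, h1, h2, ?_⟩
  -- `K` is the union of the finite boundary and two relatively open pieces, so nothing is lost
  -- across the boundary.
  have := W.m_le_tsum (ι := Bool) (N := S'.V α')
    (A := fun b => if b then S'.O α' else K \ S'.island α') (S'.finite_V α').countable (by
      rintro (_ | _)
      · refine ⟨(S'.island α')ᶜ, (S'.island_closed α').isOpen_compl, ?_⟩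
        simp [Set.sdiff_eq, Set.inter_comm]
      · simpa using S'.exists_open_O α')
    (B := K) (by
      intro x hx
      by_cases hxα : x ∈ S'.island α'
      · by_cases hxV : x ∈ S'.V α'
        · exact Or.inl hxV
        · exact Or.inr (Set.mem_iUnion.2 ⟨true, by simpa using ⟨hxα, hxV⟩⟩)
      · exact Or.inr (Set.mem_iUnion.2 ⟨false, by simpa using ⟨hx, hxα⟩⟩)) hcont
  refine this.trans (le_of_eq ?_)
  rw [tsum_fintype, Fintype.sum_bool]
  simp only [if_true, Bool.false_eq_true, if_false]
  rw [W.m_congr (h1.mono (S'.O_subset α')), W.m_congr h2]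

theorem O_subset_K (S : FRFT K Λ) (α : Λ) : S.O α ⊆ K :=
  (S.O_subset α).trans (S.island_subset α)

variable {B τ : ℝ}

/-- There is a function of least energy with given boundary values. -/
theorem OscBound.exists_minimizer (hB : W.OscBound B τ) (hV : ∀ α, (S.V α).Nonempty) {α' : Λ'}
    (hV' : (S'.V α').Nonempty) {f : Euc d → ℝ} (hf : f ∈ W.space) :
    ∃ h ∈ W.space, Set.EqOn h f (S'.V α') ∧ ∀ g, ContinuousOn g (S'.island α') →
      Set.EqOn g f (S'.V α') → W.m h (S'.O α') ≤ W.m g (S'.O α') := by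
  -- Competitors carry a bound on their energy in all of `K`, since compactness needs it. The
  -- exchange lemma replaces any g on the island by such a competitor.
  let Adm := {g : Euc d → ℝ // ContinuousOn g K ∧ Set.EqOn g f (S'.V α') ∧
    W.m g K ≤ W.m g (S'.O α') + W.m f K}
  set I : ENNReal := ⨅ g : Adm, W.m g.1 (S'.O α')
  have hle : ∀ g, ContinuousOn g (S'.island α') → Set.EqOn g f (S'.V α') →
      I ≤ W.m g (S'.O α') := by
    intro g hg hgf
    obtain ⟨G, h1, h2, h3, h4⟩ := W.exists_exchange α' hf.1 hg hgf
    have h5 := W.m_congr (h2.mono (S'.O_subset α'))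
    refine (iInf_le (fun g : Adm => W.m g.1 (S'.O α'))
      ⟨G, h1, fun x hx => (h2 (V_subset α' hx)).trans (hgf hx), ?_⟩).trans h5.le
    rw [h5]
    exact h4.trans (add_le_add_right (W.m_mono_set Set.sdiff_subset f) _)
  have hI : I ≠ ⊤ := ne_top_of_le_ne_top (m_ne_top_of_mem hf (O_subset_K S' α'))
    (hle f (hf.1.mono (S'.island_subset α')) fun _ _ => rfl)
  have hseq : ∀ n : ℕ, ∃ g : Adm, W.m g.1 (S'.O α') < I + ((n : ENNReal) + 1)⁻¹ := fun n =>
    iInf_lt_iff.1 (ENNReal.lt_add_right hI (by simp))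
  choose g hg using hseq
  set T : ENNReal := I + 1 + W.m f K
  have hT : T ≠ ⊤ := by
    simp only [T, ne_eq, ENNReal.add_eq_top, not_or]
    exact ⟨⟨hI, by simp⟩, hf.2⟩
  have hgT : ∀ n, W.m (g n).1 K ≤ ENNReal.ofReal T.toReal := by
    intro n
    rw [ENNReal.ofReal_toReal hT]
    refine (g n).2.2.2.trans (add_le_add ((hg n).le.trans (add_le_add le_rfl ?_)) le_rfl)
    exact ENNReal.inv_le_one.2 (by simp)
  obtain ⟨x₀, hx₀⟩ := hV'
  have hx₀K := S'.island_subset α' (V_subset α' hx₀)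
  obtain ⟨h, hh, l, hl, hlt, hlim⟩ := exists_limit S (u := fun n => (g n).1)
    (A := B * √T.toReal) hB.2.1.le hB.2.2.1 (by
      intro k
      refine Filter.Eventually.of_forall fun n δ hδ x hx y hy => ?_
      have := hB.abs_sub_le hV hδ ((g n).2.1.mono (S.island_subset δ)) ENNReal.toReal_nonneg
        ((W.m_mono_set (S.island_subset δ) _).trans (hgT n)) hx hy
      refine this.trans (le_of_eq ?_)
      ring) hx₀K (c := |f x₀|) (fun n => by rw [(g n).2.2.1 hx₀])
  refine ⟨h, ⟨hh, ?_⟩, ?_, ?_⟩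
  · refine ne_top_of_le_ne_top ENNReal.ofReal_ne_top (b := ENNReal.ofReal T.toReal) ?_
    exact W.m_le_of_tendsto hlim fun k => Filter.Eventually.of_forall fun n =>
      (W.le_m k _ _).trans (hgT n)
  · intro x hx
    refine tendsto_nhds_unique (hlim x (S'.island_subset α' (V_subset α' hx))) ?_
    simp only [fun n => (g n).2.2.1 hx]
    exact tendsto_const_nhds
  · intro w hw hwf
    refine le_trans ?_ (hle w hw hwf)
    refine ENNReal.le_of_forall_pos_le_add fun ε hε _ => ?_
    refine W.m_le_of_tendsto (fun x hx => hlim x (O_subset_K S' α' hx)) fun k => hlt ?_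
    have hinv : Filter.Tendsto (fun n : ℕ => ((n : ENNReal) + 1)⁻¹) Filter.atTop (nhds 0) := by
      have := (Filter.tendsto_add_atTop_iff_nat 1).2 ENNReal.tendsto_inv_nat_nhds_zero
      simpa using this
    filter_upwards [hinv.eventually (gt_mem_nhds (ENNReal.coe_pos.2 hε))] with n hn
    exact (W.le_m k _ _).trans ((hg n).le.trans (add_le_add le_rfl hn.le))

/-- Pythagoras: after exchange, g differs from h by a function that vanishes on the boundary and is
orthogonal to h. -/
theorem m_le_of_orthogonal {α' : Λ'} {h : W.space}
    (horth : ∀ w : W.space, (∀ x ∈ S'.V α', (w : Euc d → ℝ) x = 0) →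
      W.form (O_subset_K S' α') h w = 0) {g : Euc d → ℝ}
    (hg : ContinuousOn g (S'.island α')) (hgh : Set.EqOn g h (S'.V α')) :
    W.m h (S'.O α') ≤ W.m g (S'.O α') := by
  by_cases htop : W.m g (S'.O α') = ⊤
  · rw [htop]; exact le_top
  obtain ⟨G, h1, h2, -, h4⟩ := W.exists_exchange α' h.2.1 hg hgh
  have hG : G ∈ W.space := ⟨h1, ne_top_of_le_ne_top (ENNReal.add_ne_top.2 ⟨htop,
    m_ne_top_of_mem h.2 Set.sdiff_subset⟩) h4⟩
  rw [← W.m_congr (h2.mono (S'.O_subset α'))]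
  let w : W.space := ⟨G, hG⟩ - h
  have hw : (⟨G, hG⟩ : W.space) = h + w := by simp [w]
  have hw0 : W.form (O_subset_K S' α') h w = 0 := horth w fun x hx => by
    simp [w, h2 (V_subset α' hx), hgh hx]
  have e1 := ofReal_form_self (O_subset_K S' α') (⟨G, hG⟩ : W.space)
  rw [hw, form_self_add, hw0] at e1
  rw [← hw] at e1
  rw [← e1, ← ofReal_form_self (O_subset_K S' α')]
  refine ENNReal.ofReal_le_ofReal ?_
  have := form_self_nonneg (O_subset_K S' α') w
  linarith

theorem OscBound.exists_harmonic (hB : W.OscBound B τ) (hV : ∀ α, (S.V α).Nonempty) {α' : Λ'}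
    (hV' : (S'.V α').Nonempty) (v : Euc d → ℝ) :
    ∃ h : W.space, Set.EqOn (h : Euc d → ℝ) v (S'.V α') ∧
      ∀ w : W.space, (∀ x ∈ S'.V α', (w : Euc d → ℝ) x = 0) →
        W.form (O_subset_K S' α') h w = 0 := by
  obtain ⟨f, hf, hfv⟩ := hB.exists_interpolation hV (S'.finite_V α')
    ((V_subset α').trans (S'.island_subset α')) v
  obtain ⟨h, hh, hhf, hmin⟩ := hB.exists_minimizer hV hV' hf
  refine ⟨⟨h, hh⟩, hhf.trans hfv, fun w hw => ?_⟩
  have hA := O_subset_K S' α'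
  -- Minimality against h + t w. The quadratic polynomial has no constant term, so its linear
  -- coefficient must vanish.
  have key : ∀ t : ℝ, 0 ≤ W.form hA w w * (t * t) + 2 * W.form hA ⟨h, hh⟩ w * t + 0 := by
    intro t
    have h1 := hmin (h + t • (w : Euc d → ℝ))
      (((hh.1).add (w.2.1.const_smul t)).mono (S'.island_subset α')) (fun x hx => by
        simp [hw x hx, hhf hx])
    have e1 := ofReal_form_self hA (⟨h, hh⟩ : W.space)
    have e2 := ofReal_form_self hA ((⟨h, hh⟩ : W.space) + t • w)
    have e3 : (((⟨h, hh⟩ : W.space) + t • w : W.space) : Euc d → ℝ) =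
        h + t • (w : Euc d → ℝ) := rfl
    rw [e3] at e2
    rw [← e2, ← e1, ENNReal.ofReal_le_ofReal_iff (form_self_nonneg hA _), form_self_add] at h1
    simp only [map_smul, LinearMap.smul_apply, smul_eq_mul] at h1
    linarith
  have := discrim_le_zero key
  rw [discrim] at this
  nlinarith [sq_nonneg (W.form hA ⟨h, hh⟩ w)]

/-- Such a function is constant on each of countably many tiles, so it takes countably many values
on a connected set. A nondegenerate interval of values is uncountable. -/
theorem OscBound.eq_of_m_O_eq_zero (hB : W.OscBound B τ) (hV : ∀ α, (S.V α).Nonempty)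
    (htile : IsTiledBy S' S) {α' : Λ'} {u : Euc d → ℝ} (hu : ContinuousOn u (S'.island α'))
    (hm : W.m u (S'.O α') = 0) {x y : Euc d} (hx : x ∈ S'.island α') (hy : y ∈ S'.island α') :
    u x = u y := by
  obtain ⟨L, -, ⟨hLc, hLu, -⟩, -⟩ := htile α' α' (S'.similar_refl α')
  have hsub : ∀ α ∈ L, S.island α ⊆ S'.O α' := fun α hα => by
    rw [O, hLu]
    exact Set.subset_biUnion_of_mem (u := fun α => S.island α) hα
  have hcount : (u '' S'.island α').Countable := by
    have : S'.island α' ⊆ S'.V α' ∪ ⋃ α ∈ L, S.island α := by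
      rw [← hLu]
      intro x hx
      by_cases h : x ∈ S'.V α'
      · exact Or.inl h
      · exact Or.inr ⟨hx, h⟩
    refine Set.Countable.mono (Set.image_mono this) ?_
    rw [Set.image_union, Set.image_iUnion₂]
    refine ((S'.finite_V α').countable.image u).union (hLc.biUnion fun α hα => ?_)
    refine Set.Subsingleton.countable ?_
    rintro _ ⟨a, ha, rfl⟩ _ ⟨b, hb, rfl⟩
    exact hB.eq_of_m_eq_zero hV (hu.mono ((hsub α hα).trans (S'.O_subset α')))
      (le_antisymm ((W.m_mono_set (hsub α hα) u).trans hm.le) zero_le) ha hb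
  have hconn : IsPreconnected (u '' S'.island α') :=
    (S'.island_connected α').isPreconnected.image u hu
  by_contra hne
  wlog hlt : u x < u y generalizing x y
  · exact this hy hx (Ne.symm hne) (lt_of_le_of_ne (not_lt.1 hlt) (Ne.symm hne))
  have hIcc := hconn.Icc_subset ⟨x, hx, rfl⟩ ⟨y, hy, rfl⟩
  have := Cardinal.le_aleph0_iff_set_countable.2 (hcount.mono hIcc)
  rw [Cardinal.mk_Icc_real hlt] at this
  exact absurd this (not_le.2 Cardinal.aleph0_lt_continuum)

/-- The trace of the energy on the boundary of an island is the Dirichlet form of a Laplacian. -/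
theorem OscBound.exists_trace (hB : W.OscBound B τ) (hV : ∀ α, (S.V α).Nonempty)
    (htile : IsTiledBy S' S) (α' : Λ') : ∃ D : Matrix (S'.V α') (S'.V α') ℝ, IsLaplacian D ∧
      ∀ u : Euc d → ℝ, ∃ h : Euc d → ℝ, ContinuousOn h (S'.island α') ∧ Set.EqOn h u (S'.V α') ∧
        W.m h (S'.O α') = ENNReal.ofReal (dirichletForm D (fun x => u x) fun x => u x) ∧
        ∀ g : Euc d → ℝ, ContinuousOn g (S'.island α') → Set.EqOn g u (S'.V α') →
          W.m h (S'.O α') ≤ W.m g (S'.O α') := by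
  classical
  have hA := O_subset_K S' α'
  have hex : ∀ x : S'.V α', ∃ h : W.space,
      Set.EqOn (h : Euc d → ℝ) (fun y => if y = x then 1 else 0) (S'.V α') ∧
      ∀ w : W.space, (∀ x ∈ S'.V α', (w : Euc d → ℝ) x = 0) → W.form hA h w = 0 :=
    fun x => hB.exists_harmonic hV ⟨x, x.2⟩ _
  choose h hh horth using hex
  let ext : (S'.V α' → ℝ) → W.space := fun v => ∑ x, v x • h x
  have hext : ∀ v (y : S'.V α'), (ext v : Euc d → ℝ) y = v y := by
    intro v y
    simp only [ext, AddSubmonoidClass.coe_finsetSum, Submodule.coe_smul, Finset.sum_apply,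
      Pi.smul_apply, smul_eq_mul]
    rw [Finset.sum_eq_single y]
    · rw [hh y y.2]; simp
    · intro x _ hne
      have : ¬ (y : Euc d) = x := fun h => hne (Subtype.ext h.symm)
      rw [hh x y.2]
      simp [this]
    · simp
  have hexto : ∀ v (w : W.space), (∀ x ∈ S'.V α', (w : Euc d → ℝ) x = 0) →
      W.form hA (ext v) w = 0 := by
    intro v w hw
    simp only [ext, map_sum, LinearMap.sum_apply, map_smul, LinearMap.smul_apply]
    exact Finset.sum_eq_zero fun x _ => by rw [horth x w hw, smul_zero]
  have hmin : ∀ v (g : Euc d → ℝ), ContinuousOn g (S'.island α') →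
      (∀ x : S'.V α', g x = v x) → W.m (ext v) (S'.O α') ≤ W.m g (S'.O α') :=
    fun v g hg hgv => m_le_of_orthogonal (hexto v) hg fun x hx => by
      rw [hgv ⟨x, hx⟩, hext v ⟨x, hx⟩]
  -- The entries are energies of pairs of harmonic functions with boundary values the indicators of
  -- single points.
  let D : Matrix (S'.V α') (S'.V α') ℝ := fun x y => -W.form hA (h x) (h y)
  have hform : ∀ u v : S'.V α' → ℝ, W.form hA (ext u) (ext v) = -(u ⬝ᵥ D.mulVec v) := by
    intro u v
    simp only [ext, map_sum, LinearMap.sum_apply, map_smul, LinearMap.smul_apply, dotProduct,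
      Matrix.mulVec, D, smul_eq_mul, Finset.mul_sum, neg_mul, Finset.sum_neg_distrib, mul_neg,
      neg_neg]
    rw [Finset.sum_comm]
    exact Finset.sum_congr rfl fun x _ => Finset.sum_congr rfl fun y _ => by ring
  have hsymm : D.IsSymm := Matrix.IsSymm.ext fun x y => by
    simp only [D]; rw [form_comm]
  -- The harmonic extension of the constant one has zero energy because the constant competes. By
  -- Cauchy–Schwarz it is orthogonal to everything, so the row sums vanish.
  have hone : ∀ z : W.space, W.form hA z (ext fun _ => 1) = 0 := by
    refine form_eq_zero_of_self hA ?_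
    have h1 := hmin (fun _ => 1) (fun _ => 1) continuousOn_const fun _ => rfl
    rw [W.m_eq_zero (u := fun _ => 1) fun _ _ _ _ => rfl, ← ofReal_form_self hA,
      nonpos_iff_eq_zero, ENNReal.ofReal_eq_zero] at h1
    exact le_antisymm h1 (form_self_nonneg hA _)
  have hrow : ∀ x, ∑ y, D x y = 0 := by
    intro x
    have := hone (h x)
    simp only [ext, one_smul, map_sum] at this
    simp only [D, Finset.sum_neg_distrib, this, neg_zero]
  have hdir : ∀ v, dirichletForm D v v = W.form hA (ext v) (ext v) := fun v => by
    rw [dirichletForm_eq_neg hsymm hrow, hform]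
  have hconstker : ∀ v : S'.V α' → ℝ, (∃ c : ℝ, ∀ x, v x = c) → D.mulVec v = 0 := by
    rintro v ⟨c, hc⟩
    ext x
    simp only [Matrix.mulVec, dotProduct, hc, Pi.zero_apply]
    rw [← Finset.sum_mul, hrow, zero_mul]
  refine ⟨D, ⟨hsymm, fun v => ?_, fun v => ⟨fun hv => ?_, hconstker v⟩, fun x y hne => ?_⟩,
    fun u => ⟨ext fun x => u x, (ext _).2.1.mono (S'.island_subset α'),
      fun x hx => hext _ ⟨x, hx⟩, ?_, fun g hg hgu => hmin _ g hg fun x => hgu x.2⟩⟩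
  · have := form_self_nonneg hA (ext v)
    rw [hform] at this
    linarith
  · have h0 : W.m (ext v) (S'.O α') = 0 := by
      rw [← ofReal_form_self hA, hform, hv]
      simp
    by_cases hne : Nonempty (S'.V α')
    · obtain ⟨y⟩ := hne
      refine ⟨v y, fun x => ?_⟩
      rw [← hext v x, ← hext v y]
      exact hB.eq_of_m_O_eq_zero hV htile ((ext v).2.1.mono (S'.island_subset α')) h0
        (V_subset α' x.2) (V_subset α' y.2)
    · exact ⟨0, fun x => absurd ⟨x⟩ hne⟩
  -- On the boundary |h x - h y| equals the sum of the two harmonic functions. Minimality of the sum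
  -- and the contraction property give E(h x + h y) ≤ E(h x - h y), so the mixed energy is
  -- nonpositive.
  · set a : W.space := h x - h y
    set b : Euc d → ℝ := fun z => |(a : Euc d → ℝ) z|
    have hb : ContinuousOn b K := a.2.1.abs
    have hmb : W.m b (S'.O α') ≤ W.m a (S'.O α') := W.m_contraction fun z _ z' _ =>
      abs_abs_sub_abs_le_abs_sub _ _
    have h1 := m_le_of_orthogonal (h := h x + h y) (α' := α') (fun w hw => by
      rw [map_add, LinearMap.add_apply, horth x w hw, horth y w hw, add_zero])
      (hb.mono (S'.island_subset α')) (fun z hz => by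
        simp only [b, a, Submodule.coe_sub, Submodule.coe_add, Pi.sub_apply, Pi.add_apply,
          hh x hz, hh y hz]
        split_ifs with e1 e2
        · exact absurd (Subtype.ext (e1.symm.trans e2)) hne
        · simp
        · simp
        · simp)
    have h2 := h1.trans hmb
    rw [← ofReal_form_self hA, ← ofReal_form_self hA,
      ENNReal.ofReal_le_ofReal_iff (form_self_nonneg hA _), form_self_add] at h2
    have h3 : W.form hA a a = W.form hA (h x) (h x) - 2 * W.form hA (h x) (h y) +
        W.form hA (h y) (h y) := by
      simp only [a, map_sub, LinearMap.sub_apply]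
      rw [form_comm hA (h y) (h x)]
      ring
    rw [h3] at h2
    simp only [D]
    linarith
  · rw [hdir, ofReal_form_self hA]

end Weight

end Trace

/-! ### The energy seen from the islands of the tiled structure. -/

section Tiled

variable {d : ℕ} {K : Set (Euc d)} {Λ Λ' : Type*} {S : FRFT K Λ} {R : S.Representatives}
  {H : HarmonicStructure R} {W : Weight H} {S' : FRFT K Λ'} {R' : S'.Representatives}
  {B τ : ℝ}

theorem phi_continuous (S : FRFT K Λ) (α β : Λ) : Continuous (S.φ α β) :=
  (S.φ α β).toHomeomorph.continuous

theorem continuousOn_comp_phi {α β : Λ} (h : S.Similar α β) {u : Euc d → ℝ}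
    (hu : ContinuousOn u (S.island β)) : ContinuousOn (u ∘ S.φ α β) (S.island α) :=
  hu.comp (phi_continuous S α β).continuousOn fun _ hx => phi_mem h hx

namespace Weight

/-- `q` is the trace on the boundary of the energy on the island `α'`. -/
def IsTrace (W : Weight H) (S' : FRFT K Λ') (α' : Λ') (q : (Euc d → ℝ) → ℝ) : Prop :=
  ∀ u : Euc d → ℝ, ∃ h : Euc d → ℝ, ContinuousOn h (S'.island α') ∧ Set.EqOn h u (S'.V α') ∧
    W.m h (S'.O α') = ENNReal.ofReal (q u) ∧
    ∀ g : Euc d → ℝ, ContinuousOn g (S'.island α') → Set.EqOn g u (S'.V α') →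
      W.m h (S'.O α') ≤ W.m g (S'.O α')

theorem IsTrace.le_m {α' : Λ'} {q : (Euc d → ℝ) → ℝ} (hq : W.IsTrace S' α' q) {g u : Euc d → ℝ}
    (hg : ContinuousOn g (S'.island α')) (hgu : Set.EqOn g u (S'.V α')) :
    ENNReal.ofReal (q u) ≤ W.m g (S'.O α') := by
  obtain ⟨h, -, -, h1, h2⟩ := hq u
  rw [← h1]
  exact h2 g hg hgu

/-- The similitude multiplies the energies of all competitors by the same number, hence carries
minimizers to minimizers. -/
theorem IsTrace.transport {α' β' : Λ'} (hs : S'.Similar α' β') {q : (Euc d → ℝ) → ℝ}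
    (hq : W.IsTrace S' α' q) {σ : ℝ} (hσ : 0 < σ)
    (hscale : ∀ u : Euc d → ℝ, ContinuousOn u (S'.island β') →
      W.m (u ∘ S'.φ α' β') (S'.O α') = ENNReal.ofReal σ * W.m u (S'.O β')) :
    W.IsTrace S' β' fun u => σ⁻¹ * q (u ∘ S'.φ α' β') := by
  intro u
  have hs' := S'.similar_symm hs
  have hσ0 := (ENNReal.ofReal_pos.2 hσ).ne'
  obtain ⟨h, h1, h2, h3, h4⟩ := hq (u ∘ S'.φ α' β')
  have hcont := continuousOn_comp_phi hs' h1
  have hback : W.m ((h ∘ S'.φ β' α') ∘ S'.φ α' β') (S'.O α') = W.m h (S'.O α') :=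
    W.m_congr fun x hx => congrArg h (phi_inv hs hx.1)
  have hm := hscale _ hcont
  rw [hback] at hm
  refine ⟨h ∘ S'.φ β' α', hcont, ?_, ?_, ?_⟩
  · intro x hx
    rw [Function.comp_apply, h2 (V_map hs' hx), Function.comp_apply, phi_inv hs' (V_subset _ hx)]
  · rw [ENNReal.ofReal_mul (inv_nonneg.2 hσ.le), ENNReal.ofReal_inv_of_pos hσ, ← h3, hm,
      ← mul_assoc, ENNReal.inv_mul_cancel hσ0 ENNReal.ofReal_ne_top, one_mul]
  · intro g hg hgu
    have h5 := h4 (g ∘ S'.φ α' β') (continuousOn_comp_phi hs hg) fun x hx => hgu (V_map hs hx)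
    rw [hm, hscale g hg] at h5
    exact (ENNReal.mul_le_mul_iff_right hσ0 ENNReal.ofReal_ne_top).1 h5

/-- Minimizers on finitely many islands can be glued. -/
theorem IsTrace.exists_glue (T : Finset Λ')
    (hT : ∀ α ∈ T, ∀ β ∈ T, α ≠ β → S'.island α ∩ S'.island β ⊆ S'.V α)
    {q : Λ' → (Euc d → ℝ) → ℝ} (hq : ∀ α ∈ T, W.IsTrace S' α (q α)) (u : Euc d → ℝ) :
    ∃ g : Euc d → ℝ, ContinuousOn g (⋃ α ∈ T, S'.island α) ∧
      (∀ α ∈ T, Set.EqOn g u (S'.V α)) ∧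
      W.m g (⋃ α ∈ T, S'.island α) ≤ ∑ α ∈ T, ENNReal.ofReal (q α u) := by
  have h : ∀ α, ∃ h : Euc d → ℝ, α ∈ T → ContinuousOn h (S'.island α) ∧
      Set.EqOn h u (S'.V α) ∧ W.m h (S'.O α) = ENNReal.ofReal (q α u) := by
    intro α
    by_cases hα : α ∈ T
    · obtain ⟨h, h1, h2, h3, -⟩ := hq α hα u
      exact ⟨h, fun _ => ⟨h1, h2, h3⟩⟩
    · exact ⟨0, fun h => absurd h hα⟩
  choose f hf using h
  obtain ⟨g, hg⟩ := FRFT.exists_glue T hT u f fun α hα => (hf α hα).2.1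
  have hcont : ContinuousOn g (⋃ α ∈ T, S'.island α) :=
    continuousOn_biUnion_island T fun α hα => (hf α hα).1.congr (hg α hα)
  refine ⟨g, hcont, fun α hα x hx => (hg α hα (V_subset α hx)).trans ((hf α hα).2.1 hx), ?_⟩
  refine (W.m_le_sum T (N := ⋃ α ∈ T, S'.V α) (A := fun α => S'.O α) ?_
    (fun α => S'.exists_open_O α) ?_ hcont).trans (le_of_eq (Finset.sum_congr rfl fun α hα => ?_))
  · exact T.finite_toSet.countable.biUnion fun α _ => (S'.finite_V α).countable
  · intro x hx
    simp only [Set.mem_iUnion] at hx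
    obtain ⟨α, hα, hx⟩ := hx
    by_cases hV : x ∈ S'.V α
    · exact Or.inl (Set.mem_biUnion hα hV)
    · exact Or.inr (Set.mem_biUnion hα ⟨hx, hV⟩)
  · rw [W.m_congr ((hg α hα).mono (S'.O_subset α)), (hf α hα).2.2]

/-- The sum of the traces on disjoint islands is at most the energy. -/
theorem IsTrace.sum_le (T : Finset Λ')
    (hT : ∀ α ∈ T, ∀ β ∈ T, α ≠ β → S'.island α ∩ S'.island β ⊆ S'.V α)
    {q : Λ' → (Euc d → ℝ) → ℝ} (hq : ∀ α ∈ T, W.IsTrace S' α (q α)) {A : Set (Euc d)}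
    (hA : ∀ α ∈ T, S'.O α ⊆ A) {u : Euc d → ℝ} (hu : ∀ α ∈ T, ContinuousOn u (S'.island α)) :
    ∑ α ∈ T, ENNReal.ofReal (q α u) ≤ W.m u A := by
  refine (Finset.sum_le_sum fun α hα => (hq α hα).le_m (hu α hα) fun _ _ => rfl).trans
    (W.sum_m_le T (fun α hα β hβ hne => ?_) hA u)
  exact (S'.finite_V α).subset ((Set.inter_subset_inter (S'.O_subset α) (S'.O_subset β)).trans
    (hT α hα β hβ hne))

/-- An island and a similar island inside of it: the scaling factor of the energy is less than
one. -/
theorem OscBound.scale_lt_one (hB : W.OscBound B τ) (hV : ∀ α, (S.V α).Nonempty) {α' β' : Λ'}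
    (hanc : S'.IsAncestor α' β') (hs : S'.Similar α' β') {σ : ℝ}
    (hscale : ∀ u : Euc d → ℝ, ContinuousOn u (S'.island β') →
      W.m (u ∘ S'.φ α' β') (S'.O α') = ENNReal.ofReal σ * W.m u (S'.O β')) : σ < 1 := by
  by_contra hge
  rw [not_lt] at hge
  have hs' := S'.similar_symm hs
  have hsub := island_subset_of_isAncestor hanc
  obtain ⟨k, hk⟩ := exists_desc_of_isAncestor hanc
  have hβ : β' ≠ S'.root := by
    obtain ⟨γ, -, h⟩ := mem_desc_succ.1 hk
    exact ne_root_of_child h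
  obtain ⟨y', hy'⟩ := V_nonempty hβ
  obtain ⟨y, hy⟩ : (S'.V α').Nonempty := ⟨_, V_map hs' hy'⟩
  obtain ⟨x, hx⟩ := O_nonempty S' α'
  obtain ⟨f, hf, hfx, hfV⟩ := hB.exists_bump hV (S'.finite_V α')
    ((V_subset α').trans (S'.island_subset α')) (S'.island_subset α' hx.1) hx.2
  set ψ := S'.φ α' β' with hψ
  have hit : ∀ n, ∀ z ∈ S'.island α', ψ^[n] z ∈ S'.island α' := by
    intro n z hz
    induction n with
    | zero => exact hz
    | succ n ih =>
      rw [Function.iterate_succ_apply']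
      exact hsub (phi_mem hs ih)
  have hzero : ∀ A : Set (Euc d), W.m (0 : Euc d → ℝ) A = 0 := fun A =>
    W.m_eq_zero fun _ _ _ _ => rfl
  -- The function is copied into the smaller island and extended by zero. Under the assumption σ ≥ 1
  -- its energy does not grow, while the points where it is one and zero move together under the
  -- iterates of ψ.
  have key : ∀ n, ∃ u : Euc d → ℝ, ContinuousOn u K ∧ (∀ z ∈ S'.V α', u z = 0) ∧
      u (ψ^[n] x) = 1 ∧ u (ψ^[n] y) = 0 ∧ W.m u K ≤ W.m f (S'.O α') := by
    intro n
    induction n with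
    | zero =>
      obtain ⟨G, h1, h2, -, h4⟩ := W.exists_exchange (f := 0) α' continuousOn_const
        (hf.1.mono (S'.island_subset α')) fun z hz => hfV z hz
      rw [hzero, add_zero] at h4
      exact ⟨G, h1, fun z hz => by rw [h2 (V_subset α' hz), hfV z hz], by simp [h2 hx.1, hfx],
        by simp [h2 (V_subset α' hy), hfV y hy], h4⟩
    | succ n ih =>
      obtain ⟨u, hu, huV, hux, huy, hum⟩ := ih
      have hcont := continuousOn_comp_phi hs' (hu.mono (S'.island_subset α'))
      have hgV : ∀ z ∈ S'.V β', (u ∘ S'.φ β' α') z = 0 := fun z hz => huV _ (V_map hs' hz)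
      obtain ⟨G, h1, h2, h3, h4⟩ := W.exists_exchange (f := 0) β' continuousOn_const hcont hgV
      have hval : ∀ z ∈ S'.island α', G (ψ^[n + 1] z) = u (ψ^[n] z) := by
        intro z hz
        rw [Function.iterate_succ_apply', h2 (phi_mem hs (hit n z hz)), Function.comp_apply,
          phi_inv hs (hit n z hz)]
      refine ⟨G, h1, fun z hz => ?_, by rw [hval x hx.1, hux],
        by rw [hval y (V_subset α' hy), huy], ?_⟩
      · by_cases hzβ : z ∈ S'.island β'
        · rw [h2 hzβ, hgV z (mem_V_desc hk hz hzβ)]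
        · rw [h3 ⟨S'.island_subset α' (V_subset α' hz), hzβ⟩, Pi.zero_apply]
      · rw [hzero, add_zero] at h4
        have h5 := hscale _ hcont
        have h6 : W.m ((u ∘ S'.φ β' α') ∘ S'.φ α' β') (S'.O α') = W.m u (S'.O α') :=
          W.m_congr fun z hz => congrArg u (phi_inv hs hz.1)
        rw [h6] at h5
        refine h4.trans (le_trans ?_ ((W.m_mono_set (O_subset_K S' α') u).trans hum))
        rw [h5]
        exact le_mul_of_one_le_left zero_le (ENNReal.one_le_ofReal.2 hge)
  have hT := m_ne_top_of_mem hf (O_subset_K S' α')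
  obtain ⟨η, hη, heq⟩ := hB.equicontinuous hV (ENNReal.toReal_nonneg (a := W.m f (S'.O α')))
    one_pos
  have hdist : ∀ n, dist (ψ^[n] x) (ψ^[n] y) = (Dilation.ratio ψ : ℝ) ^ n * dist x y := by
    intro n
    induction n with
    | zero => simp
    | succ n ih =>
      rw [Function.iterate_succ_apply', Function.iterate_succ_apply', Dilation.dist_eq, ih]
      ring
  have hratio : (Dilation.ratio ψ : ℝ) < 1 := by
    have h1 := diam_similar hs
    have h2 := diam_lt hanc hs
    have h3 := diam_pos (S := S') α'
    by_contra h
    rw [h1] at h2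
    nlinarith
  have hlim : Filter.Tendsto (fun n : ℕ => (Dilation.ratio ψ : ℝ) ^ n * dist x y) Filter.atTop
      (nhds 0) := by
    simpa using (tendsto_pow_atTop_nhds_zero_of_lt_one NNReal.zero_le_coe hratio).mul_const
      (dist x y)
  obtain ⟨n, hn⟩ := (hlim.eventually (gt_mem_nhds hη)).exists
  obtain ⟨u, hu, -, hux, huy, hum⟩ := key n
  have := heq u hu (by rwa [ENNReal.ofReal_toReal hT]) _ (S'.island_subset α' (hit n x hx.1)) _
    (S'.island_subset α' (hit n y (V_subset α' hy))) (by rwa [hdist])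
  rw [hux, huy] at this
  norm_num at this

/-- If the cells of a harmonic structure of `S'` are the traces of the energy of `S`, then the two
structures have the same energy. -/
theorem OscBound.m_eq_of_isTrace (hB : W.OscBound B τ) (hV : ∀ α, (S.V α).Nonempty)
    {H' : HarmonicStructure R'} (W' : Weight H')
    (hq : ∀ α', W.IsTrace S' α' fun u => W'.cell α' u u) {u : Euc d → ℝ}
    (hu : ContinuousOn u K) : W'.m u K = W.m u K := by
  have hT : ∀ n, ∀ α ∈ S'.gen n, ∀ β ∈ S'.gen n, α ≠ β → S'.island α ∩ S'.island β ⊆ S'.V α :=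
    fun n α hα β hβ hne x hx => mem_V_of_mem_desc hα hβ hne hx.1 hx.2
  have hsum : ∀ n, ENNReal.ofReal (W'.disc n K u u) =
      ∑ α ∈ S'.gen n, ENNReal.ofReal (W'.cell α u u) := fun n => by
    rw [disc_univ, ENNReal.ofReal_sum_of_nonneg fun α _ => W'.cell_nonneg α u]
  refine le_antisymm (iSup_le fun n => ?_) ?_
  · rw [hsum]
    exact IsTrace.sum_le (S'.gen n) (hT n) (fun α _ => hq α) (fun α _ => O_subset_K S' α)
      fun α _ => hu.mono (S'.island_subset α)
  · by_cases htop : W'.m u K = ⊤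
    · rw [htop]; exact le_top
    have hK : ∀ n, ⋃ α ∈ S'.gen n, S'.island α = K := fun n => by
      refine Set.Subset.antisymm (Set.iUnion₂_subset fun α _ => S'.island_subset α) fun x hx => ?_
      obtain ⟨α, h1, h2⟩ := exists_gen_mem (S := S') n hx
      exact Set.mem_biUnion h1 h2
    -- Gluing the minimizers for the boundary values of `u` at generation n gives functions whose
    -- energy is at most that of `u` in the new structure. They agree with `u` at the vertices and
    -- are equicontinuous, so they converge to `u`, and lower semicontinuity finishes.
    choose g hg1 hg2 hg3 using fun n => IsTrace.exists_glue (S'.gen n) (hT n)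
      (fun α _ => hq α) u
    simp only [hK] at hg1 hg3
    have hgm : ∀ n, W.m (g n) K ≤ W'.m u K := fun n =>
      (hg3 n).trans ((hsum n).symm.le.trans (W'.le_m n u K))
    have hlim : ∀ x ∈ K, Filter.Tendsto (fun n => g n x) Filter.atTop (nhds (u x)) := by
      intro x hx
      rw [Metric.tendsto_atTop]
      intro ε hε
      obtain ⟨η₁, hη₁, h1⟩ := hB.equicontinuous hV (ENNReal.toReal_nonneg (a := W'.m u K))
        (half_pos hε)
      obtain ⟨η₂, hη₂, h2⟩ := Metric.continuousOn_iff.1 hu x hx (ε / 2) (half_pos hε)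
      obtain ⟨n₀, hn₀⟩ := Representatives.exists_diam_lt R' (lt_min hη₁ hη₂)
      -- From generation one on, boundaries are nonempty. The root of `S'` may have empty boundary.
      refine ⟨n₀ + 1, fun n hn => ?_⟩
      obtain ⟨α, hα, hxα⟩ := exists_gen_mem (S := S') n hx
      obtain ⟨k, rfl⟩ : ∃ k, n = k + 1 := ⟨n - 1, by omega⟩
      obtain ⟨γ, -, hγ⟩ := mem_gen_succ.1 hα
      obtain ⟨y, hy⟩ := V_nonempty_of_child hγ
      have hyα := V_subset α hy
      have hd : dist y x < min η₁ η₂ :=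
        (Metric.dist_le_diam_of_mem (S'.island_compact α).isBounded hyα hxα).trans_lt
          (hn₀ _ (by omega) α hα)
      have e1 := h1 (g (k + 1)) (hg1 _) (by rw [ENNReal.ofReal_toReal htop]; exact hgm _) x hx y
        (S'.island_subset α hyα) (by rw [dist_comm]; exact hd.trans_le (min_le_left _ _))
      have e2 := h2 y (S'.island_subset α hyα) (hd.trans_le (min_le_right _ _))
      rw [hg2 _ α hα hy] at e1
      rw [Real.dist_eq] at e2 ⊢
      have := _root_.abs_sub_le (g (k + 1) x) (u y) (u x)
      linarith
    exact W.m_le_of_tendsto hlim fun k => Filter.Eventually.of_forall fun n =>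
      (W.le_m k _ _).trans (hgm n)

theorem continuousOn_extend (u : C(K, ℝ)) :
    ContinuousOn (Function.extend Subtype.val u 0 : Euc d → ℝ) K := by
  rw [continuousOn_iff_continuous_domRestrict]
  refine u.continuous.congr fun x => ?_
  rw [Set.domRestrict_apply, Subtype.val_injective.extend_apply]

theorem mem_domain_iff (W : Weight H) (u : C(K, ℝ)) :
    u ∈ H.domain ↔ W.m (Function.extend Subtype.val u 0) K ≠ ⊤ := by
  simp only [HarmonicStructure.domain, Set.mem_ofPred_eq, W.levelForm_eq]
  constructor
  · rintro ⟨t, ht⟩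
    refine ne_top_of_le_ne_top (ENNReal.ofReal_ne_top (r := t)) (iSup_le fun n => ?_)
    exact ENNReal.ofReal_le_ofReal ((W.disc_mono K _).ge_of_tendsto ht n)
  · exact fun h => ⟨_, tendsto_disc_m h⟩

/-- Finiteness of the energy determines the domain, and polarization recovers the bilinear form from
the quadratic one. -/
theorem sameResistanceForm_of_m_eq {H' : HarmonicStructure R'} (W : Weight H) (W' : Weight H')
    (h : ∀ u : Euc d → ℝ, ContinuousOn u K → W'.m u K = W.m u K) : SameResistanceForm H H' := by
  have hmem : ∀ u, u ∈ H'.domain ↔ u ∈ H.domain := fun u => by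
    rw [W.mem_domain_iff, W'.mem_domain_iff, h _ (continuousOn_extend u)]
  refine ⟨Set.ext hmem, fun u hu v hv => ?_⟩
  have hu' : Function.extend Subtype.val u 0 ∈ W.space :=
    ⟨continuousOn_extend u, (W.mem_domain_iff u).1 hu⟩
  have hv' : Function.extend Subtype.val v 0 ∈ W.space :=
    ⟨continuousOn_extend v, (W.mem_domain_iff v).1 hv⟩
  have hu'' : Function.extend Subtype.val u 0 ∈ W'.space :=
    ⟨continuousOn_extend u, by rw [h _ hu'.1]; exact hu'.2⟩
  have hv'' : Function.extend Subtype.val v 0 ∈ W'.space :=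
    ⟨continuousOn_extend v, by rw [h _ hv'.1]; exact hv'.2⟩
  refine ⟨_, (tendsto_disc_polar hu' hv' subset_rfl).congr fun n => (W.levelForm_eq n u v).symm, ?_⟩
  have := (tendsto_disc_polar hu'' hv'' subset_rfl).congr fun n => (W'.levelForm_eq n u v).symm
  rwa [h _ hu'.1, h _ hv'.1, h _ (hu'.1.add hv'.1)] at this

end Weight

end Tiled

/-! ### The harmonic structure on the tiled structure. -/

section Main

variable {d : ℕ} {K : Set (Euc d)} {Λ Λ' : Type*} {S : FRFT K Λ} {R : S.Representatives}
  {H : HarmonicStructure R} {W : Weight H} {S' : FRFT K Λ'} {R' : S'.Representatives}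
  {B τ : ℝ}

namespace Weight

/-- Traces of the energy satisfy the renormalization equation. -/
theorem IsTrace.isLeast {N : NetworkData R'} {i : S'.Types} {q : Λ' → (Euc d → ℝ) → ℝ}
    (hi : W.IsTrace S' (R'.rep i) fun u => N.energy 0 i u u) (hD : IsLaplacian (N.D i))
    (hq : ∀ β, W.IsTrace S' β (q β)) (hq0 : ∀ β u, 0 ≤ q β u)
    (hsum : ∀ u, N.energy 1 i u u = ∑ β ∈ S'.children (R'.rep i), q β u)
    (v : S'.V (R'.rep i) → ℝ) :
    IsLeast {t : ℝ | ∃ u : Euc d → ℝ, (∀ x : S'.V (R'.rep i), u x = v x) ∧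
      t = N.energy 1 i u u} (dirichletForm (N.D i) v v) := by
  have hT : ∀ β ∈ S'.children (R'.rep i), ∀ β' ∈ S'.children (R'.rep i), β ≠ β' →
      S'.island β ∩ S'.island β' ⊆ S'.V β := fun β hβ β' hβ' hne x hx =>
    mem_V_of_mem_siblings hβ hβ' hne hx.1 hx.2
  have hval : ∀ u : Euc d → ℝ, (∀ x : S'.V (R'.rep i), u x = v x) →
      N.energy 0 i u u = dirichletForm (N.D i) v v := fun u hu => by
    rw [NetworkData.energy, show (fun x : S'.V (R'.rep i) => u x) = v from funext hu]
  have hlower : ∀ u : Euc d → ℝ, (∀ x : S'.V (R'.rep i), u x = v x) →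
      dirichletForm (N.D i) v v ≤ N.energy 1 i u u := by
    intro u hu
    -- Minimizers on the children glue to a competitor on the whole island, which bounds the trace
    -- from above by the energy of generation one.
    obtain ⟨g, h1, h2, h3⟩ := IsTrace.exists_glue (S'.children (R'.rep i)) hT (fun β _ => hq β) u
    rw [← S'.island_eq (R'.rep i)] at h1 h3
    have hg : Set.EqOn g u (S'.V (R'.rep i)) := by
      intro x hx
      have hxα := V_subset (R'.rep i) hx
      rw [S'.island_eq (R'.rep i)] at hxα
      simp only [Set.mem_iUnion] at hxα
      obtain ⟨β, hβ, hxβ⟩ := hxα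
      exact h2 β hβ (mem_V_child hβ hx hxβ)
    have h4 := ((hi.le_m h1 hg).trans (W.m_mono_set (S'.O_subset (R'.rep i)) g)).trans h3
    rw [← ENNReal.ofReal_sum_of_nonneg fun β _ => hq0 β u, ← hsum, hval u hu] at h4
    refine (ENNReal.ofReal_le_ofReal_iff ?_).1 h4
    rw [hsum]
    exact Finset.sum_nonneg fun β _ => hq0 β u
  refine ⟨?_, ?_⟩
  -- The minimum is attained at the minimizer of the whole island: the traces on the children of its
  -- restrictions add up to at most its energy.
  · obtain ⟨h, h1, h2, h3, -⟩ := hi (Function.extend Subtype.val v 0)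
    have hhv : ∀ x : S'.V (R'.rep i), h x = v x := fun x => by
      rw [h2 x.2, Subtype.val_injective.extend_apply]
    refine ⟨h, hhv, le_antisymm (hlower h hhv) ?_⟩
    have h4 := IsTrace.sum_le (S'.children (R'.rep i)) hT (fun β _ => hq β) (A := S'.O (R'.rep i))
      (fun β hβ => O_desc_subset (mem_desc_one.2 hβ)) (u := h)
      fun β hβ => h1.mono (island_subset_of_child hβ)
    beta_reduce at h3
    rw [h3, ← ENNReal.ofReal_sum_of_nonneg fun β _ => hq0 β h, ← hsum,
      hval (Function.extend Subtype.val v 0) fun x => Subtype.val_injective.extend_apply _ _ x] at h4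
    exact (ENNReal.ofReal_le_ofReal_iff (dirichletForm_nonneg hD v)).1 h4
  · rintro _ ⟨u, hu, rfl⟩
    exact hlower u hu

end Weight

/-- The energy of a homogeneous regular harmonic structure, seen on a tiled structure. -/
theorem HarmonicStructure.Homogeneous.exists_tiled (hhom : H.Homogeneous) (hreg : H.Regular)
    (hG : R.StronglyConnected) (htile : IsTiledBy S' S) (R' : S'.Representatives) :
    ∃ H' : HarmonicStructure R',
      H'.Regular ∧ H'.Homogeneous ∧ SameResistanceForm H H' := by
  classical
  set W := hhom.weight
  have hV := V_nonempty_of_stronglyConnected hG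
  obtain ⟨B, τ, hB⟩ := W.exists_oscBound hreg hV
  -- `c α'` is the scaling number from the representative to α'. It will be the weight of α', and
  -- its value at a child of a representative the factor of the edge.
  choose c hc0 hcr hcs using fun α' : Λ' =>
    W.exists_scale hG hhom htile (S'.similar_symm (R'.similar_rep α'))
  choose D hD hDt using fun i : S'.Types => hB.exists_trace hV htile (R'.rep i)
  let N : NetworkData R' := ⟨D, fun e => c e.2⟩
  let q : Λ' → (Euc d → ℝ) → ℝ := fun α' u => (c α')⁻¹ *
    N.energy 0 (S'.type α') (u ∘ S'.φ (R'.rep (S'.type α')) α') (u ∘ S'.φ (R'.rep (S'.type α')) α')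
  have hi : ∀ i, W.IsTrace S' (R'.rep i) fun u => N.energy 0 i u u := fun i => hDt i
  have hq : ∀ α', W.IsTrace S' α' (q α') := fun α' =>
    (hi (S'.type α')).transport (S'.similar_symm (R'.similar_rep α')) (hc0 α') (hcs α')
  have hq0 : ∀ α' u, 0 ≤ q α' u := fun α' u =>
    mul_nonneg (inv_nonneg.2 (hc0 α').le) (dirichletForm_nonneg (hD _) _)
  let H' : HarmonicStructure R' :=
    { N with
      isLaplacian := hD
      r_pos := fun e => hc0 e.2
      renormalization := fun i v => (hi i).isLeast (hD i) hq hq0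
        (fun u => Finset.sum_coe_sort (S'.children (R'.rep i)) fun β => q β u) v }
  have hrep1 : ∀ i, c (R'.rep i) = 1 := by
    intro i
    have h := hcr (R'.rep i)
    rw [R'.type_rep, div_self (diam_pos _).ne'] at h
    exact h.unique hG hhom W.isRatio_one
  let W' : Weight H' :=
    { ρ := c
      mult := by
        intro γ β
        -- The size of β relative to its representative is the size of γ relative to its own, times
        -- that of the corresponding child of the representative of γ. Ratios multiply and are
        -- unique.
        have h1 : W.IsRatio _ (c γ * H'.r (R'.edge γ β)) :=
          (hcr γ).mul hG (hcr (S'.childEquiv (R'.similar_rep γ) β))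
        refine (hcr β).unique hG hhom ?_
        convert h1 using 1
        rw [← S'.type_eq_iff.2 (childEquiv_similar (R'.similar_rep γ) β), diam_child,
          diam_similar (R'.similar_rep γ)]
        have h2 := diam_pos (S := S') γ
        have h3 := diam_pos (S := S') (R'.rep (S'.type β))
        have h4 : (0 : ℝ) < Dilation.ratio (S'.φ γ (R'.rep (S'.type γ))) := Dilation.ratio_pos _
        field_simp
      root_eq := by rw [← R'.rep_root]; exact hrep1 _ }
  refine ⟨H', ?_, ?_, W.sameResistanceForm_of_m_eq W' fun u hu => hB.m_eq_of_isTrace hV W' hq hu⟩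
  -- A cycle is realized by a proper offspring of the representative that is similar to it, and the
  -- weight of the cycle is its scaling number.
  · intro i w hw
    obtain ⟨hne, hp⟩ := Representatives.isWalk_iff.1 hw
    have hp' : R'.IsPath (S'.type (R'.rep i)) i w := by rwa [R'.type_rep]
    obtain ⟨β, h1, h2, h3, -⟩ := hp'.exists_desc
    have h4 : c β = c (R'.rep i) * H'.weight w := h3 _ _ W'.mult
    rw [hrep1, one_mul] at h4
    rw [← h4]
    subst h2
    obtain ⟨m, hm⟩ : ∃ m, w.length = m + 1 :=
      Nat.exists_eq_succ_of_ne_zero (List.length_pos_iff.2 hne).ne'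
    rw [hm] at h1
    exact hB.scale_lt_one hV (isAncestor_of_desc h1) (S'.similar_symm (R'.similar_rep β)) (hcs β)
  -- Islands of one type and one size have the same size ratio to their common representative, hence
  -- the same weight.
  · intro α β w w' hs hd hw hw'
    rw [← W'.eq_weight hw, ← W'.eq_weight hw']
    have h := hcr α
    rw [hd, S'.type_eq_iff.2 hs] at h
    exact h.unique hG hhom (hcr β)

end Main

end FRFT

theorem theorem6p4 {d : ℕ} {K : Set (Euc d)} (hK : IsSelfSimilarSet K) (hKc : IsConnected K)
    {Λ Λ' : Type*} (S : FRFT K Λ) (S' : FRFT K Λ')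
    (R : S.Representatives) (R' : S'.Representatives)
    (htile : IsTiledBy S' S) (hG : R.StronglyConnected)
    (H : FRFT.HarmonicStructure R) (hreg : H.Regular) (hhom : H.Homogeneous) :
    ∃ H' : FRFT.HarmonicStructure R',
      H'.Regular ∧ H'.Homogeneous ∧ SameResistanceForm H H' :=
  hhom.exists_tiled hreg hG htile R'
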